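/- **Proposition 3.5.** Let $\psi,\varphi\in C_c^\infty(\mathbb R^2)$ be non-negative radial functions with $\operatorname{supp}\psi\subset\{|\xi|\le\frac43\}$, $\operatorname{supp}\varphi\subset\{\frac34\le|\xi|\le\frac83\}$, $\psi=1$ on $B(0,1)$ and $\psi(\xi)+\sum_{k\ge0}\varphi(2^{-k}\xi)=1$ for all $\xi\in\mathbb R^2$. For $\Theta>0$ let $\sigma(D)$, $D=-i\nabla$, denote the Fourier multiplier with symbol $\sigma(\xi)$, and put $$\sqrt{\mathrm{Id}-\widetilde S_0}=\sqrt{1-\psi(\Theta^{-1}D)},\qquad \widetilde\Delta_j=\varphi(2^{-j}\Theta^{-1}D)\quad(j\in\mathbb Z),$$ and let $\mathbf 1_{|D|\ge\Theta/12}$ be the sharp projection onto the frequencies $|\xi|\ge\Theta/12$. There is a constant $C>0$, depending on nothing but the fixed cutoffs $\psi,\varphi$, such that the following holds. Let $\Theta,T>0$ and $q,m\in[2,\infty]$, let $h\in L^1([0,T];L^2(\mathbb R^2;\mathbb R^2))$ with $\operatorname{div}h=0$, $F\in L^1([0,T];L^2(\mathbb R^2))$, $g_0\in L^2(\mathbb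 R^2)$, and let $$g\in L^\infty\bigl([0,T];L^2\cap L^{\frac{2m}{m-2}}\cap L^{\frac{2q}{q-1}}(\mathbb R^2)\bigr)$$ (where $\frac{2m}{m-2}$ is $\infty$ for $m=2$ and $2$ for $m=\infty$, and $\frac{2q}{q-1}$ is $2$ for $q=\infty$) be a real-valued weak solution of $$\partial_t g+h\cdot\nabla g=F,\qquad g|_{t=0}=g_0,$$ that is, $g(t)\in L^2(\mathbb R^2)$ is defined for every $t\in[0,T]$ and $$\int_{\mathbb R^2} g(t)\phi\,dx=\int_{\mathbb R^2} g_0\phi\,dx+\int_0^t\int_{\mathbb R^2}\bigl(g\,h\cdot\nabla\phi+F\phi\bigr)\,dx\,d\tau\qquad\text{for all }\phi\in C_c^\infty(\mathbb R^2),\ t\in[0,T].$$ Then, for every $t\in[0,T]$, $$\begin{aligned} \tfrac12\bigl\|\sqrt{\mathrm{Id}-\widetilde S_0}\,g(t)\bigr\|_{L^2}^2\le{}&\tfrac12\bigl\|\sqrt{\mathrm{Id}-\widetilde S_0}\,g_0\bigr\|_{L^2}^2+\int_0^t\bigl\|\sqrt{\mathrm{Id}-\widetilde S_0}\,F(\tau)\bigr\|_{L^2}\bigl\|\sqrt{\mathrm{Id}-\widetilde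 S_0}\,g(\tau)\bigr\|_{L^2}\,d\tau\\ &+C\sum_{i=-1}^0\int_0^t\|\nabla h(\tau)\|_{L^q}\,\bigl\|\widetilde\Delta_i g(\tau)\bigr\|_{L^{\frac{2q}{q-1}}}^2\,d\tau\\ &+C\int_0^t\bigl\|\mathbf 1_{|D|\ge\Theta/12}\nabla h(\tau)\bigr\|_{L^m}\|g(\tau)\|_{L^{\frac{2m}{m-2}}}\bigl\|\widetilde\Delta_0g(\tau)\bigr\|_{L^2}\,d\tau\\ &+C\int_0^t\bigl\|\mathbf 1_{|D|\ge\Theta/12}\nabla h(\tau)\bigr\|_{L^m}\|g(\tau)\|_{L^{\frac{2m}{m-2}}}\bigl\|\sqrt{\mathrm{Id}-\widetilde S_0}\,g(\tau)\bigr\|_{L^2}\,d\tau. \end{aligned}$$ Here $\nabla h$ is the distributional gradient, a norm is $+\infty$ when the distribution does not belong to the space, and the right-hand side is read in $[0,\infty]$ (with $0\cdot\infty=0$). -/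

import Mathlib

open MeasureTheory
open scoped ENNReal NNReal ContDiff FourierTransform

noncomputable section

/-- The Euclidean plane. -/
abbrev Plane : Type := EuclideanSpace ℝ (Fin 2)

/-- The complexified Euclidean plane, in which complexified plane vector fields take values. -/
abbrev CPlane : Type := EuclideanSpace ℂ (Fin 2)

/-- Square integrable functions on the plane with values in `V`. -/
abbrev L2 (V : Type*) [NormedAddCommGroup V] : Type _ :=
  Lp V 2 (volume : Measure Plane)

/-! ### Littlewood-Paley cutoffs and Fourier multipliers -/

/-- The building blocks `ψ`, `φ` of a dyadic partition of unity
`1 = ψ(ξ) + ∑_{k ≥ 0} φ(2⁻ᵏ ξ)` of the (frequency) plane. -/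
structure IsLittlewoodPaleyPair (ψ φ : Plane → ℝ) : Prop where
  contDiff_low : ContDiff ℝ ∞ ψ
  contDiff_annulus : ContDiff ℝ ∞ φ
  nonneg_low : ∀ ξ, 0 ≤ ψ ξ
  nonneg_annulus : ∀ ξ, 0 ≤ φ ξ
  radial_low : ∀ ξ η, ‖ξ‖ = ‖η‖ → ψ ξ = ψ η
  radial_annulus : ∀ ξ η, ‖ξ‖ = ‖η‖ → φ ξ = φ η
  tsupport_low : tsupport ψ ⊆ {ξ | ‖ξ‖ ≤ 4 / 3}
  tsupport_annulus : tsupport φ ⊆ {ξ | 3 / 4 ≤ ‖ξ‖ ∧ ‖ξ‖ ≤ 8 / 3}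
  low_eq_one : ∀ ξ ∈ Metric.ball (0 : Plane) 1, ψ ξ = 1
  partition : ∀ ξ, HasSum (fun k : ℕ => φ ((2 : ℝ) ^ (-(k : ℤ)) • ξ)) (1 - ψ ξ)

section Multiplier

variable {V : Type*} [NormedAddCommGroup V] [InnerProductSpace ℂ V] [CompleteSpace V]

open Classical in
/-- The Fourier multiplier `σ(D)`, `D = -i∇`, on square integrable functions:
`σ(D) f = 𝓕⁻¹ (σ 𝓕 f)` whenever the product is square integrable (always the case for bounded
measurable `σ`, see `memLp_symbol_smul`).  Mathlib's Fourier transform has the kernel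
`exp (-2πi x·ξ)`, for which the symbol of `D` is `2πξ`. -/
def fourierMul (σ : Plane → ℝ) (f : L2 V) : L2 V :=
  if hf : MemLp (fun ξ : Plane =>
      ((σ ((2 * Real.pi) • ξ) : ℝ) : ℂ) • (𝓕 f : L2 V) ξ) 2 volume
  then 𝓕⁻ (hf.toLp _) else 0

theorem memLp_symbol_smul {σ : Plane → ℝ} (hσ : Measurable σ) {B : ℝ} (hB : ∀ ξ, |σ ξ| ≤ B)
    (f : L2 V) :
    MemLp (fun ξ : Plane =>
      ((σ ((2 * Real.pi) • ξ) : ℝ) : ℂ) • (𝓕 f : L2 V) ξ) 2 volume := by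
  refine MemLp.of_le_mul (c := B) (Lp.memLp (𝓕 f : L2 V)) ?_ ?_
  · have h1 : Measurable fun ξ : Plane => ((σ ((2 * Real.pi) • ξ) : ℝ) : ℂ) := by fun_prop
    exact h1.aestronglyMeasurable.smul (Lp.aestronglyMeasurable _)
  · filter_upwards with ξ
    rw [norm_smul, Complex.norm_real, Real.norm_eq_abs]
    exact mul_le_mul_of_nonneg_right (hB _) (norm_nonneg _)

end Multiplier

/-- A real square integrable function, seen as a complex one. -/
def complexify (f : L2 ℝ) : L2 ℂ :=
  Complex.ofRealCLM.compLp f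

/-- The inclusion of the plane into the complexified plane. -/
def planeToComplex : Plane →L[ℝ] CPlane :=
  LinearMap.toContinuousLinearMap
    { toFun := fun x => WithLp.toLp 2 fun i => (x i : ℂ)
      map_add' := fun x y => by ext i; simp
      map_smul' := fun c x => by ext i; simp }

/-- A real square integrable vector field, seen as a complex one. -/
def complexifyField (h : L2 Plane) : L2 CPlane :=
  planeToComplex.compLp h

/-- The operator `√(Id - S̃₀) = √(1 - ψ(Θ⁻¹ D))`. -/
def sqrtHigh (ψ : Plane → ℝ) (Θ : ℝ) (f : L2 ℝ) : L2 ℂ :=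
  fourierMul (fun ξ => √(1 - ψ (Θ⁻¹ • ξ))) (complexify f)

/-- The dyadic block `Δ̃ⱼ = φ(2⁻ʲ Θ⁻¹ D)`, `j ∈ ℤ`. -/
def dyadicBlock (φ : Plane → ℝ) (Θ : ℝ) (j : ℤ) (f : L2 ℝ) :
    L2 ℂ :=
  fourierMul (fun ξ => φ ((2 : ℝ) ^ (-j) • Θ⁻¹ • ξ)) (complexify f)

/-- The sharp high-frequency projection `1_{|D| ≥ R}` of a vector field. -/
def sharpHigh (R : ℝ) (h : L2 Plane) : L2 CPlane :=
  fourierMul ({ξ : Plane | R ≤ ‖ξ‖}.indicator fun _ => 1) (complexifyField h)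

/-! ### Weak gradients -/

/-- `φ ∈ C_c^∞(ℝ²)`. -/
def IsTestFunction (φ : Plane → ℝ) : Prop :=
  ContDiff ℝ ∞ φ ∧ HasCompactSupport φ

/-- The locally integrable field `G` is the distributional gradient of `f`. -/
def HasWeakGradient {V : Type*} [NormedAddCommGroup V] [NormedSpace ℝ V]
    (f : Plane → V) (G : Plane → Plane →L[ℝ] V) : Prop :=
  LocallyIntegrable G volume ∧
    ∀ φ : Plane → ℝ, IsTestFunction φ → ∀ v : Plane,
      ∫ x, fderiv ℝ φ x v • f x = -∫ x, φ x • G x v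

/-- `‖∇f‖_{Lᵖ} ∈ [0, ∞]` for the distributional gradient of `f` (the weak gradient is unique up to
null sets); it is `∞` if the distribution `∇f` is not an `Lᵖ` function. -/
def gradNorm {V : Type*} [NormedAddCommGroup V] [NormedSpace ℝ V]
    (f : Plane → V) (p : ℝ≥0∞) : ℝ≥0∞ :=
  ⨅ (G : Plane → Plane →L[ℝ] V) (_ : HasWeakGradient f G), eLpNorm G p volume

/-! ### The transport equation -/

/-- `div h = 0` in the sense of distributions. -/
def IsDivergenceFree (h : Plane → Plane) : Prop :=
  ∀ φ : Plane → ℝ, IsTestFunction φ → ∫ x, fderiv ℝ φ x (h x) = 0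

/-- Weak solutions on `[0, T]` of `∂ₜ g + h·∇g = F`, `g|_{t=0} = g₀`, for divergence-free `h`
(so that `h·∇g = div (g h)`), with values in `L²`: the equation is integrated in time and tested
with `φ ∈ C_c^∞(ℝ²)`. -/
def IsWeakTransportSolution (T : ℝ) (h : ℝ → L2 Plane)
    (F g : ℝ → L2 ℝ) (g₀ : L2 ℝ) : Prop :=
  ∀ φ : Plane → ℝ, IsTestFunction φ → ∀ t ∈ Set.Icc 0 T,
    ∫ x, g t x * φ x = (∫ x, g₀ x * φ x) +
      ∫ τ in (0 : ℝ)..t, ∫ x, (g τ x * fderiv ℝ φ x (h τ x) + F τ x * φ x)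

/-- The bound `g ∈ L^∞([0, T]; Lᵖ)`. -/
def IsEssBoundedInLp (T : ℝ) (g : ℝ → L2 ℝ) (p : ℝ≥0∞) : Prop :=
  ∃ M : ℝ≥0, ∀ᵐ τ ∂volume.restrict (Set.Icc 0 T), eLpNorm (g τ) p volume ≤ M

/-- The exponent `2m/(m-2)`, i.e. `1/p = 1/2 - 1/m`, with value `∞` at `m = 2` and `2` at
`m = ∞`. -/
def exponentM (m : ℝ≥0∞) : ℝ≥0∞ := (2⁻¹ - m⁻¹)⁻¹

/-- The exponent `2q/(q-1)`, i.e. `2/p = 1 - 1/q`, with value `2` at `q = ∞`. -/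
def exponentQ (q : ℝ≥0∞) : ℝ≥0∞ := 2 * (1 - q⁻¹)⁻¹

end

/-!
Write `P_a` for the Fourier multiplier with symbol `χ(a ·)`, where `χ` is the low frequency
cutoff, so that `Id - S̃₀ = Id - P_a` for `a = 2π / Θ` (the factor `2π` comes from the
normalisation of the Fourier transform), and write `Π_b = ∫ g h · ∇ P_b g` for the flux of energy
through the frequency `1 / b`.

*Energy balance.* `P_b g` is absolutely continuous in time with values in `L²`, which gives `d/dt
⟨g, P_b g⟩ = 2 (Π_b + ⟨F, P_b g⟩)` (`IsCutoff.energy_identity`). As `b → 0` the fluxes `Π_b`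
vanish: for `b = a / 2 ^ n`, `n ≥ 1`, they are bounded uniformly in `n`
(`IsCutoff.enorm_flux_self_le_uniform`) and tend to zero at almost every time
(`IsCutoff.tendsto_flux_self_sharp`). Hence the total energy is balanced by the force alone, and
the difference of the balances for the total energy and for `b = a` reads `d/dt ‖√(Id - P_a) g‖² =
2 (⟨F, (Id - P_a) g⟩ - Π_a)` (`IsCutoff.energy_balance_high`). The integrability of the bound for
`Π_b` is the only regularity that is used, and it may be assumed since it fails only if the
right-hand side of the theorem is infinite.

*Estimate of the flux.* As the kernel of `∇ P_a` is odd, the symmetrised flux `∫ u h · ∇ P_a v + ∫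
v h · ∇ P_a u` involves only the differences of `h` (`enorm_triple_add_triple_le`), and its bound
is independent of `a` by scaling. Split `h` with the sharp projection onto `|D| ≥ Θ / 12`. For the
low part of `h` frequency supports and the skew symmetry of the flux show that only `P_{a/2} g -
P_{2a} g = Δ̃₋₁ g + Δ̃₀ g` contributes to `Π_a` (`IsCutoff.flux_localize`), and the commutator
estimate gives the terms with `‖∇h‖_{L^q}`. For the high part `h'`, one has `‖h'‖_{L^m} ≲ Θ⁻¹
‖∇h'‖_{L^m}` (`eLpNorm_le_diffNorm`) and `‖∇ P_a g‖ ≲ Θ ‖g‖`, and the flux loses nothing if its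
other factor `g` is replaced by `g - P_a g` (`IsCutoff.enorm_flux_self_le_of_high`); this gives
the last term. The term with `‖Δ̃₀ g‖_{L²}` is not needed.

Norms of gradients enter through the Lipschitz seminorm `diffNorm` of the translations in `L^p`,
which is at most `gradNorm` (`diffNorm_le_gradNorm`) and depends measurably on the field.
-/

noncomputable section

/-! ### Fourier multipliers with bounded symbols -/

open Classical in
/-- The Fourier multiplier `f ↦ 𝓕⁻¹ (s 𝓕 f)` on complex valued square integrable functions, as a
continuous linear map; it is set to `0` when `s` is not essentially bounded. In contrast to
`fourierMul`, the symbol is written in the normalisation of Mathlib's Fourier transform. -/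
def mult (s : Plane → ℂ) : L2 ℂ →L[ℂ] L2 ℂ :=
  if hs : MemLp s ⊤ (volume : Measure Plane) then
    (Lp.fourierTransformₗᵢ Plane ℂ).symm.toContinuousLinearEquiv.toContinuousLinearMap ∘L
      ((ContinuousLinearMap.mul ℂ ℂ).holderL volume ⊤ 2 2 (hs.toLp s)) ∘L
      (Lp.fourierTransformₗᵢ Plane ℂ).toContinuousLinearEquiv.toContinuousLinearMap
  else 0

theorem fourier_mult {s : Plane → ℂ} (hs : MemLp s ⊤ (volume : Measure Plane)) (f : L2 ℂ) :
    (𝓕 (mult s f) : L2 ℂ) =ᵐ[volume] fun ξ => s ξ * (𝓕 f : L2 ℂ) ξ := by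
  have h1 : (𝓕 (mult s f) : L2 ℂ) =
      (ContinuousLinearMap.mul ℂ ℂ).holder 2 (hs.toLp s) (𝓕 f : L2 ℂ) := by
    rw [mult, dif_pos hs]
    exact (Lp.fourierTransformₗᵢ Plane ℂ).apply_symm_apply _
  rw [h1]
  filter_upwards [(ContinuousLinearMap.mul ℂ ℂ).coeFn_holder (r := 2) (hs.toLp s) (𝓕 f : L2 ℂ),
    hs.coeFn_toLp] with ξ h2 h3
  rw [h2, h3]; rfl

theorem fourier_injective_ae {f g : L2 ℂ} (h : (𝓕 f : L2 ℂ) =ᵐ[volume] (𝓕 g : L2 ℂ)) : f = g :=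
  (Lp.fourierTransformₗᵢ Plane ℂ).injective (Lp.ext h)

theorem mult_eq_of_fourier {s : Plane → ℂ} (hs : MemLp s ⊤ (volume : Measure Plane)) {f g : L2 ℂ}
    (h : (𝓕 g : L2 ℂ) =ᵐ[volume] fun ξ => s ξ * (𝓕 f : L2 ℂ) ξ) : mult s f = g :=
  fourier_injective_ae ((fourier_mult hs f).trans h.symm)

theorem mult_mult {s t : Plane → ℂ} (hs : MemLp s ⊤ (volume : Measure Plane))
    (ht : MemLp t ⊤ (volume : Measure Plane)) (f : L2 ℂ) :
    mult s (mult t f) = mult (fun ξ => s ξ * t ξ) f := by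
  refine (mult_eq_of_fourier (ht.mul' hs) ?_).symm
  filter_upwards [fourier_mult hs (mult t f), fourier_mult ht f] with ξ h1 h2
  rw [h1, h2, mul_assoc]

theorem fourier_sub_ae (f g : L2 ℂ) :
    (𝓕 (f - g) : L2 ℂ) =ᵐ[volume] fun ξ => (𝓕 f : L2 ℂ) ξ - (𝓕 g : L2 ℂ) ξ := by
  have : (𝓕 (f - g) : L2 ℂ) = 𝓕 f - 𝓕 g := (Lp.fourierTransformₗᵢ Plane ℂ).map_sub f g
  rw [this]; exact Lp.coeFn_sub _ _

theorem mult_sub_symbol {s t : Plane → ℂ} (hs : MemLp s ⊤ (volume : Measure Plane))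
    (ht : MemLp t ⊤ (volume : Measure Plane)) (f : L2 ℂ) :
    mult (fun ξ => s ξ - t ξ) f = mult s f - mult t f := by
  refine mult_eq_of_fourier (hs.sub ht) ?_
  filter_upwards [fourier_mult hs f, fourier_mult ht f, fourier_sub_ae (mult s f) (mult t f)]
    with ξ h1 h2 h3
  rw [h3, h1, h2, Pi.sub_apply, sub_mul]

theorem mult_one (f : L2 ℂ) : mult (fun _ => 1) f = f := by
  refine mult_eq_of_fourier (memLp_top_const 1) ?_
  filter_upwards with ξ
  rw [one_mul]

theorem norm_mult_le {s : Plane → ℂ} (hs : MemLp s ⊤ (volume : Measure Plane)) {B : ℝ}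
    (hB : ∀ ξ, ‖s ξ‖ ≤ B) (f : L2 ℂ) : ‖mult s f‖ ≤ B * ‖f‖ := by
  rw [← Lp.norm_fourier_eq (mult s f), ← Lp.norm_fourier_eq f]
  refine Lp.norm_le_mul_norm_of_ae_le_mul ?_
  filter_upwards [fourier_mult hs f] with ξ h1
  rw [h1, norm_mul]
  exact mul_le_mul_of_nonneg_right (hB ξ) (norm_nonneg _)

theorem inner_mult {s : Plane → ℂ} (hs : MemLp s ⊤ (volume : Measure Plane))
    (hreal : ∀ ξ, (starRingEnd ℂ) (s ξ) = s ξ) (f g : L2 ℂ) :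
    inner ℂ (mult s f) g = inner ℂ f (mult s g) := by
  rw [← Lp.inner_fourier_eq (mult s f) g, ← Lp.inner_fourier_eq f (mult s g),
    L2.inner_def, L2.inner_def]
  refine integral_congr_ae ?_
  filter_upwards [fourier_mult hs f, fourier_mult hs g] with ξ h1 h2
  rw [h1, h2, RCLike.inner_apply, RCLike.inner_apply, map_mul, hreal]
  ring

/-- The bilinear (not sesquilinear) pairing `∫ f g`. -/
def pair : L2 ℂ →L[ℂ] L2 ℂ →L[ℂ] ℂ := (ContinuousLinearMap.mul ℂ ℂ).lpPairing volume 2 2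

theorem pair_apply (f g : L2 ℂ) : pair f g = ∫ x, f x * g x :=
  (ContinuousLinearMap.mul ℂ ℂ).lpPairing_eq_integral f g

theorem dense_schwartz : DenseRange (fun f : SchwartzMap Plane ℂ => f.toLp 2 volume) :=
  SchwartzMap.denseRange_toLpCLM (p := 2) ENNReal.ofNat_ne_top

theorem pair_toLp (f g : SchwartzMap Plane ℂ) :
    pair (f.toLp 2 volume) (g.toLp 2 volume) = ∫ x, f x * g x := by
  rw [pair_apply]
  refine integral_congr_ae ?_
  filter_upwards [f.coeFn_toLp 2 volume, g.coeFn_toLp 2 volume] with x h1 h2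
  rw [h1, h2]

theorem pair_fourier (f g : L2 ℂ) : pair (𝓕 f) g = pair f (𝓕 g) := by
  have cF : Continuous fun f : L2 ℂ => (𝓕 f : L2 ℂ) := (Lp.fourierTransformₗᵢ Plane ℂ).continuous
  refine dense_schwartz.induction_on₂ (p := fun f g => pair (𝓕 f) g = pair f (𝓕 g)) ?_ ?_ f g
  · refine isClosed_eq ?_ ?_
    · exact (pair.continuous.comp (cF.comp continuous_fst)).clm_apply continuous_snd
    · exact (pair.continuous.comp continuous_fst).clm_apply (cF.comp continuous_snd)
  · intro f g
    rw [SchwartzMap.toLp_fourier_eq, SchwartzMap.toLp_fourier_eq, pair_toLp, pair_toLp]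
    exact SchwartzMap.integral_fourier_mul_eq f g

theorem mult_toLp {s : Plane → ℂ} (hs : MemLp s ⊤ (volume : Measure Plane))
    (hs' : s.HasTemperateGrowth) (f : SchwartzMap Plane ℂ) :
    mult s (f.toLp 2 volume) = (SchwartzMap.fourierMultiplierCLM ℂ s f).toLp 2 volume := by
  refine mult_eq_of_fourier hs ?_
  rw [SchwartzMap.toLp_fourier_eq, SchwartzMap.toLp_fourier_eq]
  filter_upwards [(𝓕 f).coeFn_toLp 2 volume,
    (𝓕 (SchwartzMap.fourierMultiplierCLM ℂ s f)).coeFn_toLp 2 volume] with ξ h1 h2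
  rw [h1, h2, SchwartzMap.fourierMultiplierCLM_apply, FourierTransform.fourier_fourierInv_eq,
    SchwartzMap.smulLeftCLM_apply_apply hs', smul_eq_mul]

/-! ### Convolution kernels of Schwartz symbols -/

theorem norm_pair_le (f g : L2 ℂ) : ‖pair f g‖ ≤ ‖f‖ * ‖g‖ := by
  have h1 : ‖pair f g‖ ≤ ‖(ContinuousLinearMap.mul ℂ ℂ).holder 1 f g‖ := by
    rw [pair_apply]
    refine (norm_integral_le_integral_norm _).trans_eq ?_
    rw [L1.norm_eq_integral_norm]
    refine integral_congr_ae ?_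
    filter_upwards [(ContinuousLinearMap.mul ℂ ℂ).coeFn_holder (r := 1) f g] with x hx
    rw [hx]; rfl
  refine h1.trans (((ContinuousLinearMap.mul ℂ ℂ).norm_holder_apply_apply_le f g).trans ?_)
  have := ContinuousLinearMap.opNorm_mul_le ℂ ℂ
  have h2 := mul_nonneg (norm_nonneg f) (norm_nonneg g)
  nlinarith

/-- The convolution kernel of the Fourier multiplier with the Schwartz symbol `s`. -/
def kernel (s : SchwartzMap Plane ℂ) : SchwartzMap Plane ℂ := 𝓕⁻ s

theorem measurePreserving_sub_left_plane (x : Plane) :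
    MeasurePreserving (fun y : Plane => x - y) volume volume :=
  Measure.measurePreserving_sub_left volume x

theorem integral_kernel_eq_pair (k : SchwartzMap Plane ℂ) (f : L2 ℂ) (x : Plane) :
    ∫ z, k z * f (x - z) = pair (Lp.compMeasurePreserving (fun y => x - y)
      (measurePreserving_sub_left_plane x) (k.toLp 2 volume)) f := by
  rw [pair_apply, ← integral_sub_left_eq_self (fun z => k z * f (x - z)) volume x]
  refine integral_congr_ae ?_
  filter_upwards [Lp.coeFn_compMeasurePreserving (k.toLp 2 volume)
    (measurePreserving_sub_left_plane x),
    (measurePreserving_sub_left_plane x).quasiMeasurePreserving.ae (k.coeFn_toLp 2 volume)]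
    with y h1 h2
  rw [h1, Function.comp_apply, h2, sub_sub_cancel]

theorem norm_integral_kernel_le (k : SchwartzMap Plane ℂ) (f : L2 ℂ) (x : Plane) :
    ‖∫ z, k z * f (x - z)‖ ≤ ‖k.toLp 2 volume‖ * ‖f‖ := by
  rw [integral_kernel_eq_pair]
  refine (norm_pair_le _ _).trans ?_
  rw [Lp.norm_compMeasurePreserving]

theorem mult_eq_kernel (s : SchwartzMap Plane ℂ) (f : L2 ℂ) :
    mult s f =ᵐ[volume] fun x => ∫ z, kernel s z * f (x - z) := by
  have hS : ∀ g : SchwartzMap Plane ℂ,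
      mult s (g.toLp 2 volume) =ᵐ[volume] fun x => ∫ z, kernel s z * g (x - z) := by
    intro g
    rw [mult_toLp (s.memLp_top volume) s.hasTemperateGrowth g]
    filter_upwards [(SchwartzMap.fourierMultiplierCLM ℂ s g).coeFn_toLp 2 volume] with x hx
    have h2 : SchwartzMap.fourierMultiplierCLM ℂ s g =
        SchwartzMap.convolution (ContinuousLinearMap.mul ℂ ℂ) (kernel s) g := by
      rw [SchwartzMap.fourierMultiplierCLM_apply]
      have : SchwartzMap.convolution (ContinuousLinearMap.mul ℂ ℂ) (kernel s) g =
        𝓕⁻ (SchwartzMap.pairing (ContinuousLinearMap.mul ℂ ℂ) (𝓕 (kernel s)) (𝓕 g)) := rfl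
      rw [this]
      congr 1
      ext ξ
      rw [SchwartzMap.smulLeftCLM_apply_apply s.hasTemperateGrowth,
        SchwartzMap.pairing_apply_apply, kernel, FourierTransform.fourier_fourierInv_eq]
      rfl
    rw [hx, h2, SchwartzMap.convolution_apply]
    rfl
  obtain ⟨u, hu⟩ : ∃ u : ℕ → SchwartzMap Plane ℂ,
      Filter.Tendsto (fun n => (u n).toLp 2 volume) Filter.atTop (nhds f) := by
    have := dense_schwartz f
    rw [mem_closure_iff_seq_limit] at this
    obtain ⟨x, hx, hlim⟩ := this
    choose u hu using hx
    exact ⟨u, by simpa only [hu] using hlim⟩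
  have h1 : Filter.Tendsto (fun n => mult s ((u n).toLp 2 volume)) Filter.atTop
      (nhds (mult s f)) := ((mult s).continuous.tendsto f).comp hu
  obtain ⟨ns, hns, hae⟩ := (tendstoInMeasure_of_tendsto_Lp h1).exists_seq_tendsto_ae
  have h2 : ∀ᵐ x : Plane, ∀ n, mult s ((u n).toLp 2 volume) x =
      ∫ z, kernel s z * (u n) (x - z) := ae_all_iff.2 fun n => hS (u n)
  filter_upwards [hae, h2] with x h3 h4
  refine tendsto_nhds_unique h3 ?_
  have h5 : ∀ n, ∫ z, kernel s z * (u n) (x - z) =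
      ∫ z, kernel s z * ((u n).toLp 2 volume) (x - z) := by
    intro n
    refine integral_congr_ae ?_
    filter_upwards [(measurePreserving_sub_left_plane x).quasiMeasurePreserving.ae
      ((u n).coeFn_toLp 2 volume)] with z hz
    rw [hz]
  simp only [h4, h5, integral_kernel_eq_pair]
  exact ((ContinuousLinearMap.continuous _).tendsto f).comp (hu.comp hns.tendsto_atTop)

theorem norm_mult_apply_le (s : SchwartzMap Plane ℂ) (f : L2 ℂ) :
    ∀ᵐ x, ‖mult s f x‖ ≤ ‖(kernel s).toLp 2 volume‖ * ‖f‖ := by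
  filter_upwards [mult_eq_kernel s f] with x hx
  rw [hx]
  exact norm_integral_kernel_le _ _ _

theorem memLp_top_mult (s : SchwartzMap Plane ℂ) (f : L2 ℂ) :
    MemLp (mult s f) ⊤ (volume : Measure Plane) :=
  memLp_top_of_bound (Lp.aestronglyMeasurable _) _ (norm_mult_apply_le s f)

/-- The Fourier multiplier with a Schwartz symbol, as a map from square integrable functions to
bounded functions. -/
def multTop (s : SchwartzMap Plane ℂ) : L2 ℂ →L[ℂ] Lp ℂ ⊤ (volume : Measure Plane) :=
  LinearMap.mkContinuous
    { toFun := fun f => (memLp_top_mult s f).toLp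
      map_add' := fun f g => by
        rw [← MemLp.toLp_add]
        refine MemLp.toLp_congr _ _ ?_
        rw [map_add]; exact Lp.coeFn_add _ _
      map_smul' := fun c f => by
        rw [RingHom.id_apply, ← MemLp.toLp_const_smul]
        refine MemLp.toLp_congr _ _ ?_
        rw [map_smul]; exact Lp.coeFn_smul _ _ }
    ‖(kernel s).toLp 2 volume‖ (fun f => by
      rw [LinearMap.coe_mk, AddHom.coe_mk, Lp.norm_toLp, eLpNorm_exponent_top]
      exact ENNReal.toReal_le_of_le_ofReal (by positivity)
        (eLpNormEssSup_le_of_ae_bound (norm_mult_apply_le s f)))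

theorem coeFn_multTop (s : SchwartzMap Plane ℂ) (f : L2 ℂ) :
    multTop s f =ᵐ[volume] mult s f := (memLp_top_mult s f).coeFn_toLp

/-- The trilinear form `∫ w u H` with bounded `w` and square integrable `u`, `H`. -/
def triple : Lp ℂ ⊤ (volume : Measure Plane) →L[ℂ] L2 ℂ →L[ℂ] L2 ℂ →L[ℂ] ℂ :=
  (ContinuousLinearMap.compL ℂ (L2 ℂ) (L2 ℂ) (L2 ℂ →L[ℂ] ℂ) pair) ∘L
    ((ContinuousLinearMap.mul ℂ ℂ).holderL volume ⊤ 2 2)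

theorem triple_apply (w : Lp ℂ ⊤ (volume : Measure Plane)) (u H : L2 ℂ) :
    triple w u H = ∫ x, w x * u x * H x := by
  have : triple w u H = pair ((ContinuousLinearMap.mul ℂ ℂ).holder 2 w u) H := rfl
  rw [this, pair_apply]
  refine integral_congr_ae ?_
  filter_upwards [(ContinuousLinearMap.mul ℂ ℂ).coeFn_holder (r := 2) w u] with x hx
  rw [hx]; rfl

theorem triple_multTop (s : SchwartzMap Plane ℂ) (v u H : L2 ℂ) :
    triple (multTop s v) u H = ∫ x, mult s v x * u x * H x := by
  rw [triple_apply]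
  refine integral_congr_ae ?_
  filter_upwards [coeFn_multTop s v] with x hx
  rw [hx]

/-! ### Minkowski's integral inequality -/

section Minkowski

variable {Z X : Type*} [MeasurableSpace Z] [MeasurableSpace X]

/-- Minkowski's integral inequality for jointly measurable integrands. Finite exponents are treated
with Jensen's and Tonelli's theorems. -/
theorem eLpNorm_lintegral_le_of_measurable (ν : Measure Z) [IsFiniteMeasure ν] (μ : Measure X)
    [SFinite μ] {F : Z → X → ℝ≥0∞} (hF : Measurable (Function.uncurry F)) {p : ℝ≥0∞} (hp : 1 ≤ p)
    {M : ℝ≥0∞} (hM : ∀ᵐ z ∂ν, eLpNorm (F z) p μ ≤ M) :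
    eLpNorm (fun x => ∫⁻ z, F z x ∂ν) p μ ≤ ν Set.univ * M := by
  have hz : ∀ x, Measurable fun z => F z x := fun x => by fun_prop
  rcases eq_or_ne p ⊤ with rfl | hptop
  · have h1 : ∀ᵐ z ∂ν, ∀ᵐ x ∂μ, F z x ≤ M := by
      filter_upwards [hM] with z hz
      rw [eLpNorm_exponent_top] at hz
      filter_upwards [enorm_ae_le_eLpNormEssSup (F z) μ] with x hx
      simpa using hx.trans hz
    have h2 := (Measure.ae_ae_comm (p := fun z x => F z x ≤ M)
      (measurableSet_le hF measurable_const)).1 h1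
    rw [eLpNorm_exponent_top]
    refine eLpNormEssSup_le_of_ae_enorm_bound ?_
    filter_upwards [h2] with x hx
    rw [enorm_eq_self]
    calc ∫⁻ z, F z x ∂ν ≤ ∫⁻ _, M ∂ν := lintegral_mono_ae hx
      _ = ν Set.univ * M := by rw [lintegral_const, mul_comm]
  · have hp0 : p ≠ 0 := (zero_lt_one.trans_le hp).ne'
    have hr : 0 < p.toReal := ENNReal.toReal_pos hp0 hptop
    have hr1 : 1 ≤ p.toReal := by
      have := ENNReal.toReal_mono hptop hp
      simpa using this
    set V := ν Set.univ with hV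
    have hVtop : V ≠ ⊤ := measure_ne_top ν _
    have hjensen : ∀ x, (∫⁻ z, F z x ∂ν) ^ p.toReal ≤
        V ^ (p.toReal - 1) * ∫⁻ z, F z x ^ p.toReal ∂ν := by
      intro x
      have h := eLpNorm_le_eLpNorm_mul_rpow_measure_univ (μ := ν) hp
        (hz x).aestronglyMeasurable
      rw [eLpNorm_one_eq_lintegral_enorm, eLpNorm_eq_lintegral_rpow_enorm_toReal hp0 hptop] at h
      simp only [enorm_eq_self] at h
      refine (ENNReal.rpow_le_rpow h hr.le).trans_eq ?_
      rw [ENNReal.mul_rpow_of_nonneg _ _ hr.le, ← ENNReal.rpow_mul, ← ENNReal.rpow_mul,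
        one_div_mul_cancel hr.ne', ENNReal.rpow_one, mul_comm]
      congr 2
      simp only [ENNReal.toReal_one]
      field_simp
    have hMp : ∀ᵐ z ∂ν, ∫⁻ x, F z x ^ p.toReal ∂μ ≤ M ^ p.toReal := by
      filter_upwards [hM] with z h
      rw [eLpNorm_eq_lintegral_rpow_enorm_toReal hp0 hptop] at h
      have := ENNReal.rpow_le_rpow h hr.le
      rw [← ENNReal.rpow_mul, one_div_mul_cancel hr.ne', ENNReal.rpow_one] at this
      simpa using this
    rw [eLpNorm_eq_lintegral_rpow_enorm_toReal hp0 hptop]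
    simp only [enorm_eq_self]
    rw [one_div, ENNReal.rpow_inv_le_iff hr]
    calc ∫⁻ x, (∫⁻ z, F z x ∂ν) ^ p.toReal ∂μ
        ≤ ∫⁻ x, V ^ (p.toReal - 1) * ∫⁻ z, F z x ^ p.toReal ∂ν ∂μ := lintegral_mono hjensen
      _ = V ^ (p.toReal - 1) * ∫⁻ x, ∫⁻ z, F z x ^ p.toReal ∂ν ∂μ :=
          lintegral_const_mul' _ _ (ENNReal.rpow_ne_top_of_nonneg (by linarith) hVtop)
      _ = V ^ (p.toReal - 1) * ∫⁻ z, ∫⁻ x, F z x ^ p.toReal ∂μ ∂ν := by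
          rw [lintegral_lintegral_swap]
          exact ((hF.comp measurable_swap).pow_const _).aemeasurable
      _ ≤ V ^ (p.toReal - 1) * ∫⁻ _, M ^ p.toReal ∂ν := by
          gcongr 1; exact lintegral_mono_ae hMp
      _ = (V * M) ^ p.toReal := by
          rw [lintegral_const, ENNReal.mul_rpow_of_nonneg _ _ hr.le, ← hV]
          rcases eq_or_ne V 0 with h0 | h0
          · rw [h0, ENNReal.zero_rpow_of_pos hr]; simp
          · rw [mul_comm (M ^ _), ← mul_assoc]
            congr 1
            nth_rewrite 2 [← ENNReal.rpow_one V]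
            rw [← ENNReal.rpow_add _ _ h0 hVtop, sub_add_cancel]

/-- Minkowski's integral inequality for a finite measure, in the form of a uniform bound. -/
theorem eLpNorm_lintegral_le (ν : Measure Z) [IsFiniteMeasure ν] (μ : Measure X)
    [SFinite μ] {F : Z → X → ℝ≥0∞} (hF : AEMeasurable (Function.uncurry F) (ν.prod μ)) {p : ℝ≥0∞}
    (hp : 1 ≤ p) {M : ℝ≥0∞} (hM : ∀ᵐ z ∂ν, eLpNorm (F z) p μ ≤ M) :
    eLpNorm (fun x => ∫⁻ z, F z x ∂ν) p μ ≤ ν Set.univ * M := by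
  have h1 : ∀ᵐ z ∂ν, ∀ᵐ x ∂μ, F z x = hF.mk _ (z, x) := Measure.ae_ae_of_ae_prod hF.ae_eq_mk
  have h2 : ∀ᵐ x ∂μ, ∀ᵐ z ∂ν, F z x = hF.mk _ (z, x) := by
    have : ∀ᵐ y ∂(μ.prod ν), Function.uncurry F y.swap = hF.mk _ y.swap :=
      Measure.measurePreserving_swap.quasiMeasurePreserving.ae hF.ae_eq_mk
    exact Measure.ae_ae_of_ae_prod this
  have h3 := eLpNorm_lintegral_le_of_measurable ν μ (F := fun z x => hF.mk _ (z, x))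
    (p := p) (M := M) hF.measurable_mk hp (by
      filter_upwards [hM, h1] with z hz h
      exact (eLpNorm_congr_ae h).symm.trans_le hz)
  refine le_trans (eLpNorm_congr_ae ?_).le h3
  filter_upwards [h2] with x hx
  exact lintegral_congr_ae hx

end Minkowski

/-- Weighted form of Minkowski's integral inequality on the plane. -/
theorem eLpNorm_lintegral_mul_le {w : Plane → ℝ≥0∞} (hw : AEMeasurable w volume)
    (hw' : ∫⁻ z, w z ≠ ⊤) {F : Plane → Plane → ℝ≥0∞}
    (hF : AEMeasurable (Function.uncurry F) (volume.prod volume)) {p : ℝ≥0∞}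
    (hp : 1 ≤ p) {M : ℝ≥0∞} (hM : ∀ z, eLpNorm (F z) p volume ≤ M) :
    eLpNorm (fun x => ∫⁻ z, w z * F z x) p volume ≤ (∫⁻ z, w z) * M := by
  have : IsFiniteMeasure ((volume : Measure Plane).withDensity w) :=
    isFiniteMeasure_withDensity hw'
  have hac : (volume : Measure Plane).withDensity w ≪ volume :=
    withDensity_absolutelyContinuous _ _
  have h := eLpNorm_lintegral_le (volume.withDensity w) (volume : Measure Plane) (F := F) (p := p)
    (M := M) (hF.mono_ac (hac.prod Measure.AbsolutelyContinuous.rfl)) hp (ae_of_all _ hM)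
  rw [withDensity_apply _ MeasurableSet.univ, Measure.restrict_univ] at h
  refine le_trans (eLpNorm_congr_ae ?_).le h
  have hs : ∀ᵐ x : Plane, ∀ᵐ z : Plane, F z x = hF.mk _ (z, x) := by
    have : ∀ᵐ y : Plane × Plane, Function.uncurry F y.swap = hF.mk _ y.swap :=
      Measure.measurePreserving_swap.quasiMeasurePreserving.ae hF.ae_eq_mk
    exact Measure.ae_ae_of_ae_prod this
  filter_upwards [hs] with x hx
  have hx' : AEMeasurable (fun z => F z x) volume :=
    ⟨fun z => hF.mk _ (z, x), hF.measurable_mk.comp (by fun_prop), hx⟩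
  exact (lintegral_withDensity_eq_lintegral_mul₀ hw hx').symm

/-! ### Difference quotients and dilated symbols -/

theorem aestronglyMeasurable_comp_sub {V : Type*} [TopologicalSpace V] {f : Plane → V}
    (hf : AEStronglyMeasurable f volume) :
    AEStronglyMeasurable (fun q : Plane × Plane => f (q.2 - q.1)) (volume.prod volume) :=
  hf.comp_quasiMeasurePreserving
    ((quasiMeasurePreserving_sub_of_right_invariant (volume : Measure Plane) volume).comp
      Measure.measurePreserving_swap.quasiMeasurePreserving)

theorem measurePreserving_sub_right_plane (z : Plane) :
    MeasurePreserving (fun y : Plane => y - z) volume volume :=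
  measurePreserving_sub_right volume z

theorem eLpNorm_comp_sub {V : Type*} [NormedAddCommGroup V] {f : Plane → V}
    (hf : AEStronglyMeasurable f volume) (p : ℝ≥0∞) (z : Plane) :
    eLpNorm (fun x => f (x - z)) p volume = eLpNorm f p volume :=
  eLpNorm_comp_measurePreserving hf (measurePreserving_sub_right_plane z)

theorem lintegral_schwartz_ne_top (k : SchwartzMap Plane ℂ) : ∫⁻ z, ‖k z‖ₑ ≠ ⊤ :=
  (k.integrable (μ := volume)).2.ne

theorem lintegral_schwartz_mul_ne_top (k : SchwartzMap Plane ℂ) : ∫⁻ z, ‖k z‖ₑ * ‖z‖ₑ ≠ ⊤ := by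
  have h := (k.integrable_pow_mul volume 1).2.ne
  convert! h using 2
  ext z
  simp only [pow_one]
  rw [enorm_mul, enorm_norm, enorm_norm, mul_comm]

/-- Young's inequality for the convolution with the kernel of a Schwartz symbol. -/
theorem eLpNorm_mult_le (s : SchwartzMap Plane ℂ) (f : L2 ℂ) {p : ℝ≥0∞} (hp : 1 ≤ p) :
    eLpNorm (mult s f) p volume ≤ (∫⁻ z, ‖kernel s z‖ₑ) * eLpNorm f p volume := by
  rw [eLpNorm_congr_ae (mult_eq_kernel s f)]
  refine le_trans (eLpNorm_mono_enorm (g := fun x => ∫⁻ z, ‖kernel s z‖ₑ * ‖f (x - z)‖ₑ) ?_)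
    (eLpNorm_lintegral_mul_le (F := fun z x => ‖f (x - z)‖ₑ)
      (kernel s).continuous.enorm.aemeasurable (lintegral_schwartz_ne_top _)
      (aestronglyMeasurable_comp_sub (Lp.aestronglyMeasurable f)).enorm hp fun z => ?_)
  · intro x
    rw [enorm_eq_self]
    refine (enorm_integral_le_lintegral_enorm _).trans_eq ?_
    simp only [enorm_mul]
  · rw [eLpNorm_enorm]
    exact (eLpNorm_comp_sub (Lp.aestronglyMeasurable f) p z).le

/-- The Lipschitz seminorm of `z ↦ H(· - z)` in `Lᵖ`. It is bounded by the `Lᵖ` norm of the weak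
gradient, and, in contrast to the latter, plainly depends measurably on `H`. -/
def diffNorm {V : Type*} [NormedAddCommGroup V] (H : Plane → V) (p : ℝ≥0∞) : ℝ≥0∞ :=
  ⨆ z : Plane, eLpNorm (fun x => H (x - z) - H x) p volume / ‖z‖ₑ

theorem eLpNorm_diff_le {V : Type*} [NormedAddCommGroup V] (H : Plane → V) (p : ℝ≥0∞) (z : Plane) :
    eLpNorm (fun x => H (x - z) - H x) p volume ≤ ‖z‖ₑ * diffNorm H p := by
  rcases eq_or_ne z 0 with rfl | hz
  · simp
  · rw [mul_comm, ← ENNReal.div_le_iff (by simpa using hz) enorm_ne_top]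
    exact le_iSup (fun z : Plane => eLpNorm (fun x => H (x - z) - H x) p volume / ‖z‖ₑ) z

theorem integral_kernel (s : SchwartzMap Plane ℂ) : ∫ z, kernel s z = s 0 := by
  have h : (𝓕 (kernel s)) 0 = s 0 := by rw [kernel, FourierTransform.fourier_fourierInv_eq]
  rw [← h, SchwartzMap.fourier_coe, Real.fourier_eq]
  simp

theorem integrable_schwartz_mul (k : SchwartzMap Plane ℂ) (f : L2 ℂ) (x : Plane) :
    Integrable (fun z => k z * f (x - z)) volume := by
  have h1 : MemLp (fun z => f (x - z)) 2 volume :=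
    (Lp.memLp f).comp_measurePreserving (measurePreserving_sub_left_plane x)
  exact MemLp.integrable_mul (k.memLp 2 volume) h1

/-- Reverse Bernstein inequality: a function without low frequencies is controlled by its
difference quotients. -/
theorem eLpNorm_le_diffNorm (s : SchwartzMap Plane ℂ) (hs : s 0 = 1) (H : L2 ℂ)
    (hH : mult s H = 0) {p : ℝ≥0∞} (hp : 1 ≤ p) :
    eLpNorm H p volume ≤ (∫⁻ z, ‖kernel s z‖ₑ * ‖z‖ₑ) * diffNorm H p := by
  set F : Plane → Plane → ℝ≥0∞ := fun z x => ‖‖z‖⁻¹ • (H (x - z) - H x)‖ₑ with hF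
  have hmeas : AEMeasurable (Function.uncurry F) (volume.prod volume) := by
    refine AEStronglyMeasurable.enorm (AEStronglyMeasurable.smul
      (f := fun q : Plane × Plane => ‖q.1‖⁻¹)
      (Measurable.aestronglyMeasurable (by fun_prop))
      ((aestronglyMeasurable_comp_sub (Lp.aestronglyMeasurable H)).sub ?_))
    exact (Lp.aestronglyMeasurable H).comp_snd
  refine le_trans (eLpNorm_mono_enorm_ae
    (g := fun x => ∫⁻ z, (‖kernel s z‖ₑ * ‖z‖ₑ) * F z x) ?_)
    (eLpNorm_lintegral_mul_le (F := F)
      ((kernel s).continuous.enorm.aemeasurable.mul continuous_id.enorm.aemeasurable)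
      (lintegral_schwartz_mul_ne_top _) hmeas hp fun z => ?_)
  · have h0 : mult s H =ᵐ[volume] 0 := by rw [hH]; exact Lp.coeFn_zero _ _ _
    filter_upwards [mult_eq_kernel s H, h0] with x h1 h2
    have h3 : ∫ z, kernel s z * (H (x - z) - H x) = - H x := by
      simp only [mul_sub]
      rw [integral_sub (integrable_schwartz_mul _ H x) ((kernel s).integrable.mul_const _), ← h1, h2,
        integral_mul_const, integral_kernel, hs]
      simp
    rw [enorm_eq_self, ← enorm_neg, ← h3]
    refine (enorm_integral_le_lintegral_enorm _).trans (lintegral_mono fun z => ?_)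
    rw [enorm_mul, mul_assoc]
    gcongr
    rcases eq_or_ne z 0 with rfl | hz
    · simp
    · rw [hF, ← enorm_norm z]
      simp only
      rw [← enorm_norm (‖z‖⁻¹ • (H (x - z) - H x)), norm_smul, norm_inv, norm_norm, ← enorm_mul,
        mul_inv_cancel_left₀ (norm_ne_zero_iff.2 hz), enorm_norm]
  · have h1 : eLpNorm (F z) p volume =
        ‖‖z‖⁻¹‖ₑ * eLpNorm (fun x => H (x - z) - H x) p volume := by
      rw [hF]
      simp only
      rw [eLpNorm_enorm]
      exact eLpNorm_const_smul ‖z‖⁻¹ (fun x => H (x - z) - H x) p volume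
    rw [h1]
    calc ‖‖z‖⁻¹‖ₑ * eLpNorm (fun x => H (x - z) - H x) p volume
        ≤ ‖‖z‖⁻¹‖ₑ * (‖z‖ₑ * diffNorm H p) := by gcongr; exact eLpNorm_diff_le _ _ _
      _ = ‖‖z‖⁻¹ * ‖z‖‖ₑ * diffNorm H p := by rw [← mul_assoc, enorm_mul, enorm_norm z]
      _ ≤ 1 * diffNorm H p := by
          gcongr
          rcases eq_or_ne z 0 with rfl | hz
          · simp
          · rw [inv_mul_cancel₀ (norm_ne_zero_iff.2 hz)]; simp
      _ = diffNorm H p := one_mul _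

/-- The dilated Schwartz function `ξ ↦ s(a ξ)`, for `a ≠ 0`. -/
def dil (a : ℝ) (s : SchwartzMap Plane ℂ) : SchwartzMap Plane ℂ :=
  if ha : a ≠ 0 then
    SchwartzMap.compCLMOfContinuousLinearEquiv ℂ (ContinuousLinearEquiv.smulLeft (Units.mk0 a ha)) s
  else s

theorem dil_apply {a : ℝ} (ha : a ≠ 0) (s : SchwartzMap Plane ℂ) (ξ : Plane) :
    dil a s ξ = s (a • ξ) := by
  rw [dil, dif_pos ha]; rfl

theorem kernel_dil {a : ℝ} (ha : 0 < a) (s : SchwartzMap Plane ℂ) (x : Plane) :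
    kernel (dil a s) x = ((a⁻¹ ^ 2 : ℝ) : ℂ) * kernel s (a⁻¹ • x) := by
  rw [kernel, kernel, SchwartzMap.fourierInv_coe, SchwartzMap.fourierInv_coe, Real.fourierInv_eq,
    Real.fourierInv_eq]
  have h := Measure.integral_comp_smul (volume : Measure Plane)
    (fun v => Real.fourierChar (inner ℝ v (a⁻¹ • x)) • s v) a
  have h2 : ∀ v : Plane, inner ℝ (a • v) (a⁻¹ • x) = inner ℝ v x := by
    intro v
    rw [real_inner_smul_left, real_inner_smul_right, ← mul_assoc, mul_inv_cancel₀ ha.ne', one_mul]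
  simp only [h2, finrank_euclideanSpace, Fintype.card_fin] at h
  simp only [dil_apply ha.ne']
  rw [h, Complex.real_smul, abs_of_pos (by positivity), inv_pow]

theorem lintegral_comp_inv_smul {a : ℝ} (ha : 0 < a) {f : Plane → ℝ≥0∞} (hf : Measurable f) :
    ∫⁻ z, f (a⁻¹ • z) = ENNReal.ofReal (a ^ 2) * ∫⁻ z, f z := by
  have h := Measure.map_addHaar_smul (volume : Measure Plane) (inv_ne_zero ha.ne')
  rw [← lintegral_map (f := f) (g := fun z : Plane => a⁻¹ • z) hf (by fun_prop), h,
    lintegral_smul_measure, smul_eq_mul]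
  congr 2
  rw [finrank_euclideanSpace, Fintype.card_fin, inv_pow, inv_inv, abs_of_pos (by positivity)]

theorem lintegral_kernel_dil {a : ℝ} (ha : 0 < a) (s : SchwartzMap Plane ℂ) :
    ∫⁻ z, ‖kernel (dil a s) z‖ₑ = ∫⁻ z, ‖kernel s z‖ₑ := by
  simp only [kernel_dil ha, enorm_mul]
  rw [lintegral_const_mul' _ _ enorm_ne_top, lintegral_comp_inv_smul ha (f := fun z => ‖kernel s z‖ₑ)
    (kernel s).continuous.enorm.measurable, ← mul_assoc, ← ofReal_norm,
    ← ENNReal.ofReal_mul (norm_nonneg _), Complex.norm_real, Real.norm_of_nonneg (by positivity),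
    ← mul_pow, inv_mul_cancel₀ ha.ne']
  simp

theorem lintegral_kernel_dil_mul {a : ℝ} (ha : 0 < a) (s : SchwartzMap Plane ℂ) :
    ∫⁻ z, ‖kernel (dil a s) z‖ₑ * ‖z‖ₑ = ENNReal.ofReal a * ∫⁻ z, ‖kernel s z‖ₑ * ‖z‖ₑ := by
  have h1 : ∀ z : Plane, ‖kernel (dil a s) z‖ₑ * ‖z‖ₑ =
      (ENNReal.ofReal (a⁻¹ ^ 2) * ENNReal.ofReal a) * (‖kernel s (a⁻¹ • z)‖ₑ * ‖a⁻¹ • z‖ₑ) := by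
    intro z
    have h2 : ‖z‖ₑ = ENNReal.ofReal a * ‖a⁻¹ • z‖ₑ := by
      rw [enorm_smul, ← ofReal_norm (a⁻¹), norm_inv, Real.norm_of_nonneg ha.le, ← mul_assoc,
        ← ENNReal.ofReal_mul ha.le, mul_inv_cancel₀ ha.ne']
      simp
    rw [kernel_dil ha, enorm_mul, ← ofReal_norm ((a⁻¹ ^ 2 : ℝ) : ℂ), Complex.norm_real,
      Real.norm_of_nonneg (by positivity), h2]
    ring
  simp only [h1]
  rw [lintegral_const_mul' _ _ (by finiteness),
    lintegral_comp_inv_smul ha (f := fun z => ‖kernel s z‖ₑ * ‖z‖ₑ)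
    ((kernel s).continuous.enorm.measurable.mul (by fun_prop)), ← mul_assoc]
  congr 1
  rw [← ENNReal.ofReal_mul (by positivity), ← ENNReal.ofReal_mul (by positivity)]
  congr 1
  field_simp

/-! ### The commutator estimate for odd kernels -/

/-- Hölder's inequality for three functions. -/
theorem lintegral_mul_mul_le {u v w : Plane → ℂ} (hu : AEStronglyMeasurable u volume)
    (hv : AEStronglyMeasurable v volume) (hw : AEStronglyMeasurable w volume) {p r m : ℝ≥0∞}
    (h : p⁻¹ + r⁻¹ + m⁻¹ = 1) :
    ∫⁻ x, ‖u x * v x * w x‖ₑ ≤ eLpNorm u p volume * eLpNorm v r volume * eLpNorm w m volume := by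
  have h1 : ENNReal.HolderTriple p r (p⁻¹ + r⁻¹)⁻¹ := ⟨by rw [inv_inv]⟩
  have h2 : ENNReal.HolderTriple (p⁻¹ + r⁻¹)⁻¹ m 1 := ⟨by rw [inv_inv, h, inv_one]⟩
  calc ∫⁻ x, ‖u x * v x * w x‖ₑ = eLpNorm ((u • v) • w) 1 volume := by
        rw [eLpNorm_one_eq_lintegral_enorm]; rfl
    _ ≤ eLpNorm (u • v) (p⁻¹ + r⁻¹)⁻¹ volume * eLpNorm w m volume :=
        eLpNorm_smul_le_mul_eLpNorm hw (hu.smul hv)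
    _ ≤ _ := by gcongr; exact eLpNorm_smul_le_mul_eLpNorm hv hu

theorem enorm_triple_le (s : SchwartzMap Plane ℂ) (v u H : L2 ℂ) {p r m : ℝ≥0∞}
    (h : p⁻¹ + r⁻¹ + m⁻¹ = 1) :
    ‖triple (multTop s v) u H‖ₑ ≤
      eLpNorm (mult s v) p volume * eLpNorm u r volume * eLpNorm H m volume := by
  rw [triple_multTop]
  exact (enorm_integral_le_lintegral_enorm _).trans
    (lintegral_mul_mul_le (Lp.aestronglyMeasurable _) (Lp.aestronglyMeasurable _)
      (Lp.aestronglyMeasurable _) h)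

theorem lintegral_kernel_mul_le (k : SchwartzMap Plane ℂ) (v : L2 ℂ) (x : Plane) :
    ∫⁻ z, ‖k z * v (x - z)‖ₑ ≤ eLpNorm k 2 volume * eLpNorm v 2 volume := by
  have hv : AEStronglyMeasurable (fun z => v (x - z)) volume :=
    (Lp.aestronglyMeasurable v).comp_measurePreserving (measurePreserving_sub_left_plane x)
  have h := eLpNorm_smul_le_mul_eLpNorm (p := 2) (q := 2) (r := 1) hv
    (k.continuous.aestronglyMeasurable (μ := volume))
  rw [eLpNorm_one_eq_lintegral_enorm] at h
  refine h.trans_eq ?_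
  congr 1
  exact eLpNorm_comp_measurePreserving (Lp.aestronglyMeasurable v)
    (measurePreserving_sub_left_plane x)

theorem lintegral_kernel_triple_lt_top (k : SchwartzMap Plane ℂ) (v u H : L2 ℂ) :
    ∫⁻ x, ∫⁻ z, ‖k z * v (x - z) * u x * H x‖ₑ < ⊤ := by
  have huH : ∫⁻ x, ‖u x * H x‖ₑ ≠ ⊤ := (MemLp.integrable_mul (Lp.memLp u) (Lp.memLp H)).2.ne
  have hkv : eLpNorm k 2 volume * eLpNorm v 2 volume ≠ ⊤ :=
    ENNReal.mul_ne_top (k.memLp 2 volume).2.ne (Lp.memLp v).2.ne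
  have h1 : ∀ x, ∫⁻ z, ‖k z * v (x - z) * u x * H x‖ₑ ≤
      (eLpNorm k 2 volume * eLpNorm v 2 volume) * ‖u x * H x‖ₑ := by
    intro x
    simp only [mul_assoc (k _ * v _), enorm_mul (k _ * v _)]
    rw [lintegral_mul_const' _ _ enorm_ne_top]
    exact mul_le_mul_left (lintegral_kernel_mul_le k v x) _
  refine (lintegral_mono h1).trans_lt ?_
  rw [lintegral_const_mul' _ _ hkv]
  exact ENNReal.mul_lt_top hkv.lt_top huH.lt_top

theorem aestronglyMeasurable_kernel_triple (k : SchwartzMap Plane ℂ) (v u H : L2 ℂ) :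
    AEStronglyMeasurable (fun q : Plane × Plane => k q.2 * v (q.1 - q.2) * u q.1 * H q.1)
      (volume.prod volume) := by
  have hv : AEStronglyMeasurable (fun q : Plane × Plane => v (q.1 - q.2)) (volume.prod volume) :=
    (Lp.aestronglyMeasurable v).comp_quasiMeasurePreserving
      (quasiMeasurePreserving_sub_of_right_invariant (volume : Measure Plane) volume)
  have hk : AEStronglyMeasurable (fun q : Plane × Plane => k q.2) (volume.prod volume) :=
    (k.continuous.comp continuous_snd).aestronglyMeasurable
  have hu : AEStronglyMeasurable (fun q : Plane × Plane => u q.1) (volume.prod volume) :=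
    (Lp.aestronglyMeasurable u).comp_fst
  have hH : AEStronglyMeasurable (fun q : Plane × Plane => H q.1) (volume.prod volume) :=
    (Lp.aestronglyMeasurable H).comp_fst
  exact ((hk.mul hv).mul hu).mul hH

theorem integrable_kernel_triple (k : SchwartzMap Plane ℂ) (v u H : L2 ℂ) :
    Integrable (fun q : Plane × Plane => k q.2 * v (q.1 - q.2) * u q.1 * H q.1)
      (volume.prod volume) := by
  have hmeas := aestronglyMeasurable_kernel_triple k v u H
  refine ⟨hmeas, ?_⟩
  rw [hasFiniteIntegral_iff_enorm, lintegral_prod _ hmeas.enorm]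
  exact lintegral_kernel_triple_lt_top k v u H

theorem triple_multTop_eq_integral (s : SchwartzMap Plane ℂ) (v u H : L2 ℂ) :
    triple (multTop s v) u H = ∫ z, ∫ x, kernel s z * v (x - z) * u x * H x := by
  rw [triple_multTop, ← integral_integral_swap (integrable_kernel_triple (kernel s) v u H)]
  refine integral_congr_ae ?_
  filter_upwards [mult_eq_kernel s v] with x hx
  rw [hx, mul_assoc, ← integral_mul_const]
  simp only [mul_assoc]

/-- The commutator estimate: for an odd kernel, the symmetrised trilinear form only involves the
differences `H x - H (x - z)`. -/
theorem enorm_triple_add_triple_le (s : SchwartzMap Plane ℂ)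
    (hodd : ∀ z, kernel s (-z) = - kernel s z) (u v H : L2 ℂ) {p r m : ℝ≥0∞}
    (h : p⁻¹ + r⁻¹ + m⁻¹ = 1) :
    ‖triple (multTop s v) u H + triple (multTop s u) v H‖ₑ ≤
      (∫⁻ z, ‖kernel s z‖ₑ * ‖z‖ₑ) * (eLpNorm u p volume * eLpNorm v r volume * diffNorm H m) := by
  set k := kernel s with hk
  have hA := integrable_kernel_triple k v u H
  have hB := integrable_kernel_triple k u v H
  have hBneg := hB.swap.integral_prod_left.comp_neg
  have hBsub : ∀ᵐ z : Plane, Integrable (fun x => k (-z) * u (x - -z) * v x * H x) volume :=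
    (Measure.measurePreserving_neg (volume : Measure Plane)).quasiMeasurePreserving.ae
      hB.prod_left_ae
  have hsum : triple (multTop s v) u H + triple (multTop s u) v H =
      ∫ z, ((∫ x, k z * v (x - z) * u x * H x) + ∫ x, k (-z) * u (x - -z) * v x * H x) := by
    rw [triple_multTop_eq_integral, triple_multTop_eq_integral, integral_add]
    · congr 1
      exact (integral_neg_eq_self (fun z => ∫ x, k z * u (x - z) * v x * H x) volume).symm
    · exact hA.swap.integral_prod_left
    · exact hBneg
  rw [hsum]
  refine (enorm_integral_le_lintegral_enorm _).trans ?_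
  calc ∫⁻ z, ‖(∫ x, k z * v (x - z) * u x * H x) + ∫ x, k (-z) * u (x - -z) * v x * H x‖ₑ
      ≤ ∫⁻ z, (‖k z‖ₑ * ‖z‖ₑ) * (eLpNorm u p volume * eLpNorm v r volume * diffNorm H m) := by
        refine lintegral_mono_ae ?_
        filter_upwards [hA.prod_left_ae, hBsub] with z h1 h2
        have h3 : Integrable (fun x => k (-z) * u (x - z - -z) * v (x - z) * H (x - z)) volume :=
          (measurePreserving_sub_right_plane z).integrable_comp_of_integrable h2
        have h4 : ∫ x, k (-z) * u (x - -z) * v x * H x =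
            ∫ x, k (-z) * u (x - z - -z) * v (x - z) * H (x - z) :=
          (integral_sub_right_eq_self (fun x => k (-z) * u (x - -z) * v x * H x) z).symm
        rw [h4, ← integral_add h1 h3]
        have h5 : ∀ x, k z * v (x - z) * u x * H x +
            k (-z) * u (x - z - -z) * v (x - z) * H (x - z) =
            - k z * (u x * v (x - z) * (H (x - z) - H x)) := by
          intro x
          rw [hodd, sub_neg_eq_add, sub_add_cancel]
          ring
        simp only [h5]
        refine (enorm_integral_le_lintegral_enorm _).trans ?_
        simp only [enorm_mul (-k z), enorm_neg]
        rw [lintegral_const_mul' _ _ enorm_ne_top, mul_assoc]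
        gcongr
        have hv : AEStronglyMeasurable (fun x => v (x - z)) volume :=
          (Lp.aestronglyMeasurable v).comp_measurePreserving (measurePreserving_sub_right_plane z)
        have hH : AEStronglyMeasurable (fun x => H (x - z)) volume :=
          (Lp.aestronglyMeasurable H).comp_measurePreserving (measurePreserving_sub_right_plane z)
        refine (lintegral_mul_mul_le (Lp.aestronglyMeasurable u) hv
          (hH.sub (Lp.aestronglyMeasurable H)) h).trans ?_
        rw [eLpNorm_comp_sub (Lp.aestronglyMeasurable v)]
        calc eLpNorm u p volume * eLpNorm v r volume * eLpNorm (fun x => H (x - z) - H x) m volume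
            ≤ eLpNorm u p volume * eLpNorm v r volume * (‖z‖ₑ * diffNorm H m) := by
              gcongr; exact eLpNorm_diff_le _ _ _
          _ = _ := by ring
    _ = _ := by
        rw [lintegral_mul_const]
        exact k.continuous.enorm.measurable.mul (by fun_prop)

open LineDeriv

/-! ### Frequency supports and divergence free fields -/

/-- The `j`-th standard basis vector of the plane. -/
def basisVec (j : Fin 2) : Plane := EuclideanSpace.single j 1

theorem inner_basisVec (ξ : Plane) (j : Fin 2) : inner ℝ ξ (basisVec j) = ξ j := by
  rw [basisVec, EuclideanSpace.inner_single_right]; simp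

/-- The symbol `2πi ξⱼ s(ξ)` of `∂ⱼ s(D)`. -/
def derivSymbol (j : Fin 2) (s : SchwartzMap Plane ℂ) : SchwartzMap Plane ℂ :=
  (2 * Real.pi * Complex.I) • SchwartzMap.smulLeftCLM ℂ (fun ξ : Plane => inner ℝ ξ (basisVec j)) s

theorem derivSymbol_apply (j : Fin 2) (s : SchwartzMap Plane ℂ) (ξ : Plane) :
    derivSymbol j s ξ = 2 * Real.pi * Complex.I * ((ξ j : ℝ) : ℂ) * s ξ := by
  have h : (fun ξ : Plane => inner ℝ ξ (basisVec j)).HasTemperateGrowth := by fun_prop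
  rw [derivSymbol, _root_.smul_apply, SchwartzMap.smulLeftCLM_apply_apply h, inner_basisVec,
    Complex.real_smul, smul_eq_mul]
  ring

theorem schwartz_mult_toLp (s f : SchwartzMap Plane ℂ) :
    mult s (f.toLp 2 volume) = (SchwartzMap.fourierMultiplierCLM ℂ s f).toLp 2 volume :=
  mult_toLp (s.memLp_top volume) s.hasTemperateGrowth f

theorem fourierMultiplier_derivSymbol (j : Fin 2) (s f : SchwartzMap Plane ℂ) :
    SchwartzMap.fourierMultiplierCLM ℂ (derivSymbol j s) f =
      ∂_{basisVec j} (SchwartzMap.fourierMultiplierCLM ℂ s f) := by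
  have h : (fun ξ : Plane => inner ℝ ξ (basisVec j)).HasTemperateGrowth := by fun_prop
  rw [SchwartzMap.fourierMultiplierCLM_apply, SchwartzMap.fourierMultiplierCLM_apply,
    SchwartzMap.lineDerivOp_fourierInv_eq]
  congr 1
  ext ξ
  rw [SchwartzMap.smulLeftCLM_apply_apply (derivSymbol j s).hasTemperateGrowth,
    _root_.smul_apply, SchwartzMap.smulLeftCLM_apply_apply h,
    SchwartzMap.smulLeftCLM_apply_apply s.hasTemperateGrowth, derivSymbol_apply, inner_basisVec,
    Complex.real_smul]
  simp only [smul_eq_mul]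
  ring

/-- The product of two Schwartz functions. -/
def schwartzMul (f g : SchwartzMap Plane ℂ) : SchwartzMap Plane ℂ :=
  SchwartzMap.pairing (ContinuousLinearMap.mul ℂ ℂ) f g

theorem schwartzMul_apply (f g : SchwartzMap Plane ℂ) (x : Plane) :
    schwartzMul f g x = f x * g x := rfl

theorem triple_multTop_toLp (s t u v : SchwartzMap Plane ℂ) (w : L2 ℂ) :
    triple (multTop s (u.toLp 2 volume)) (mult t (v.toLp 2 volume)) w =
      pair ((schwartzMul (SchwartzMap.fourierMultiplierCLM ℂ s u)
        (SchwartzMap.fourierMultiplierCLM ℂ t v)).toLp 2 volume) w := by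
  rw [triple_multTop, pair_apply, schwartz_mult_toLp, schwartz_mult_toLp]
  refine integral_congr_ae ?_
  filter_upwards [(SchwartzMap.fourierMultiplierCLM ℂ s u).coeFn_toLp 2 volume,
    (SchwartzMap.fourierMultiplierCLM ℂ t v).coeFn_toLp 2 volume,
    (schwartzMul (SchwartzMap.fourierMultiplierCLM ℂ s u)
        (SchwartzMap.fourierMultiplierCLM ℂ t v)).coeFn_toLp 2 volume] with x h1 h2 h3
  rw [h1, h2, h3, schwartzMul_apply]

theorem pair_toLp_eq_fourier (f : SchwartzMap Plane ℂ) (w : L2 ℂ) :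
    pair (f.toLp 2 volume) w = ∫ ξ, (𝓕⁻ f) ξ * (𝓕 w : L2 ℂ) ξ := by
  have h1 : f.toLp 2 volume = 𝓕 ((𝓕⁻ f).toLp 2 volume) := by
    rw [SchwartzMap.toLp_fourier_eq, FourierTransform.fourier_fourierInv_eq]
  rw [h1, pair_fourier, pair_apply]
  refine integral_congr_ae ?_
  filter_upwards [(𝓕⁻ f).coeFn_toLp 2 volume] with ξ h
  rw [h]

theorem continuous_triple_multTop (s t : SchwartzMap Plane ℂ) (w : L2 ℂ) :
    Continuous fun q : L2 ℂ × L2 ℂ => triple (multTop s q.1) (mult t q.2) w :=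
  ((triple.continuous.comp ((multTop s).continuous.comp continuous_fst)).clm_apply
    ((mult t).continuous.comp continuous_snd)).clm_apply continuous_const

theorem continuous_triple_multTop_swap (s t : SchwartzMap Plane ℂ) (w : L2 ℂ) :
    Continuous fun q : L2 ℂ × L2 ℂ => triple (multTop s q.2) (mult t q.1) w :=
  ((triple.continuous.comp ((multTop s).continuous.comp continuous_snd)).clm_apply
    ((mult t).continuous.comp continuous_fst)).clm_apply continuous_const

/-- Frequency support: the integral of a product vanishes if the frequencies of the first two
factors cannot add up to a frequency of the third. -/
theorem triple_eq_zero_of_support {s t : SchwartzMap Plane ℂ} {A B : ℝ}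
    (hs : ∀ ξ, A < ‖ξ‖ → s ξ = 0) (ht : ∀ ξ, B < ‖ξ‖ → t ξ = 0) {w : L2 ℂ}
    (hw : ∀ᵐ ξ : Plane, ‖ξ‖ ≤ A + B → (𝓕 w : L2 ℂ) ξ = 0) (u v : L2 ℂ) :
    triple (multTop s u) (mult t v) w = 0 := by
  refine dense_schwartz.induction_on₂
    (p := fun u v => triple (multTop s u) (mult t v) w = 0) ?_ ?_ u v
  · exact isClosed_eq (continuous_triple_multTop s t w) continuous_const
  intro u v
  rw [triple_multTop_toLp, pair_toLp_eq_fourier]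
  set a := SchwartzMap.smulLeftCLM ℂ (s : Plane → ℂ) (𝓕 u) with ha
  set b := SchwartzMap.smulLeftCLM ℂ (t : Plane → ℂ) (𝓕 v) with hb
  have hneg : ∀ c : SchwartzMap Plane ℂ, ∀ x, (𝓕⁻ (𝓕⁻ c)) x = c (-x) := by
    intro c x
    rw [SchwartzMap.fourierInv_apply_eq, FourierTransform.fourier_fourierInv_eq]
    simp
  have hp : 𝓕⁻ (schwartzMul (𝓕⁻ a) (𝓕⁻ b)) =
      SchwartzMap.convolution (ContinuousLinearMap.mul ℂ ℂ) (𝓕⁻ (𝓕⁻ a)) (𝓕⁻ (𝓕⁻ b)) := by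
    have := SchwartzMap.fourier_convolution (ContinuousLinearMap.mul ℂ ℂ) (𝓕⁻ (𝓕⁻ a)) (𝓕⁻ (𝓕⁻ b))
    rw [FourierTransform.fourier_fourierInv_eq, FourierTransform.fourier_fourierInv_eq] at this
    rw [schwartzMul, ← this, FourierTransform.fourierInv_fourier_eq]
  have hzero : ∀ x : Plane, A + B < ‖x‖ → (𝓕⁻ (schwartzMul (𝓕⁻ a) (𝓕⁻ b))) x = 0 := by
    intro x hx
    rw [hp, SchwartzMap.convolution_apply, convolution_def]
    refine integral_eq_zero_of_ae (ae_of_all _ fun y => ?_)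
    simp only [ContinuousLinearMap.mul_apply', Pi.zero_apply, hneg]
    have : A < ‖-y‖ ∨ B < ‖-(x - y)‖ := by
      by_contra! hcon
      rw [norm_neg, norm_neg] at hcon
      have := norm_add_le y (x - y)
      rw [add_sub_cancel] at this
      linarith [hcon.1, hcon.2]
    rcases this with h | h
    · rw [ha, SchwartzMap.smulLeftCLM_apply_apply s.hasTemperateGrowth, hs _ h, zero_smul, zero_mul]
    · rw [hb, SchwartzMap.smulLeftCLM_apply_apply t.hasTemperateGrowth, ht _ h, zero_smul, mul_zero]
  refine integral_eq_zero_of_ae ?_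
  filter_upwards [hw] with ξ h
  rw [Pi.zero_apply]
  rcases le_or_gt ‖ξ‖ (A + B) with h' | h'
  · rw [h h', mul_zero]
  · have := hzero ξ h'
    rw [SchwartzMap.fourierMultiplierCLM_apply, SchwartzMap.fourierMultiplierCLM_apply, ← ha, ← hb,
      this, zero_mul]

/-- A square integrable vector field is divergence free, expressed on the Fourier side. -/
def FourierDivFree (H : Fin 2 → L2 ℂ) : Prop :=
  ∀ᵐ ξ : Plane, ∑ j, ((ξ j : ℝ) : ℂ) * (𝓕 (H j) : L2 ℂ) ξ = 0

theorem pair_lineDeriv_eq (f : SchwartzMap Plane ℂ) (j : Fin 2) (w : L2 ℂ) :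
    pair ((∂_{basisVec j} f).toLp 2 volume) w =
      -(2 * Real.pi * Complex.I) * ∫ ξ : Plane, (((ξ j : ℝ) : ℂ) * (𝓕 w : L2 ℂ) ξ) * (𝓕⁻ f) ξ := by
  have h : (fun ξ : Plane => inner ℝ ξ (basisVec j)).HasTemperateGrowth := by fun_prop
  rw [pair_toLp_eq_fourier, SchwartzMap.fourierInv_lineDerivOp_eq, ← integral_const_mul]
  congr 1
  ext ξ
  rw [_root_.smul_apply, SchwartzMap.smulLeftCLM_apply_apply h, inner_basisVec,
    Complex.real_smul, smul_eq_mul]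
  ring

theorem integrable_coord_fourier (f : SchwartzMap Plane ℂ) (j : Fin 2) (w : L2 ℂ) :
    Integrable (fun ξ : Plane => (((ξ j : ℝ) : ℂ) * (𝓕 w : L2 ℂ) ξ) * (𝓕⁻ f) ξ) volume := by
  have h : (fun ξ : Plane => inner ℝ ξ (basisVec j)).HasTemperateGrowth := by fun_prop
  have h2 : Integrable (fun ξ => (𝓕 w : L2 ℂ) ξ *
      SchwartzMap.smulLeftCLM ℂ (fun ξ : Plane => inner ℝ ξ (basisVec j)) (𝓕⁻ f) ξ) volume :=
    MemLp.integrable_mul (Lp.memLp (𝓕 w : L2 ℂ)) (SchwartzMap.memLp _ 2 volume)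
  refine h2.congr (ae_of_all _ fun ξ => ?_)
  simp only
  rw [SchwartzMap.smulLeftCLM_apply_apply h, inner_basisVec, Complex.real_smul]
  ring

theorem sum_pair_lineDeriv (H : Fin 2 → L2 ℂ) (f : SchwartzMap Plane ℂ) :
    ∑ j, pair ((∂_{basisVec j} f).toLp 2 volume) (H j) =
      -(2 * Real.pi * Complex.I) *
        ∫ ξ : Plane, (∑ j, ((ξ j : ℝ) : ℂ) * (𝓕 (H j) : L2 ℂ) ξ) * (𝓕⁻ f) ξ := by
  simp only [pair_lineDeriv_eq, Finset.sum_mul]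
  rw [← Finset.mul_sum, integral_finsetSum _ fun j _ => integrable_coord_fourier f j (H j)]

theorem FourierDivFree.sum_pair_eq_zero {H : Fin 2 → L2 ℂ} (hH : FourierDivFree H)
    (f : SchwartzMap Plane ℂ) : ∑ j, pair ((∂_{basisVec j} f).toLp 2 volume) (H j) = 0 := by
  rw [sum_pair_lineDeriv, integral_eq_zero_of_ae, mul_zero]
  filter_upwards [hH] with ξ h
  rw [h, zero_mul, Pi.zero_apply]

theorem fourierDivFree_of_sum_pair_eq_zero {H : Fin 2 → L2 ℂ}
    (h : ∀ f : SchwartzMap Plane ℂ, ∑ j, pair ((∂_{basisVec j} f).toLp 2 volume) (H j) = 0) :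
    FourierDivFree H := by
  have hloc : LocallyIntegrable
      (fun ξ : Plane => ∑ j, ((ξ j : ℝ) : ℂ) * (𝓕 (H j) : L2 ℂ) ξ) volume := by
    refine locallyIntegrable_finsetSum _ fun j _ => ?_
    have h1 : LocallyIntegrable (𝓕 (H j) : L2 ℂ) (volume : Measure Plane) :=
      (Lp.memLp (𝓕 (H j) : L2 ℂ)).locallyIntegrable (by norm_num)
    have h2 := h1.locallyIntegrableOn Set.univ |>.continuousOn_mul
      (g := fun ξ : Plane => ((ξ j : ℝ) : ℂ)) (Continuous.continuousOn (by fun_prop))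
      isOpen_univ.isLocallyClosed
    exact locallyIntegrableOn_univ.1 h2
  refine ae_eq_zero_of_integral_contDiff_smul_eq_zero hloc fun g hg hgc => ?_
  have hg' : ContDiff ℝ ∞ fun x => (g x : ℂ) := Complex.ofRealCLM.contDiff.comp hg
  have hgc' : HasCompactSupport fun x => (g x : ℂ) := hgc.comp_left (g := fun x : ℝ => (x : ℂ)) rfl
  have h1 := h (𝓕 (hgc'.toSchwartzMap hg'))
  rw [sum_pair_lineDeriv, FourierTransform.fourierInv_fourier_eq] at h1
  have h2 : (-(2 * Real.pi * Complex.I) : ℂ) ≠ 0 := by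
    simp [Real.pi_ne_zero]
  rw [← (mul_eq_zero.1 h1).resolve_left h2]
  congr 1
  ext ξ
  rw [Complex.real_smul, mul_comm]
  rfl

theorem FourierDivFree.mult {H : Fin 2 → L2 ℂ} (hH : FourierDivFree H) {s : Plane → ℂ}
    (hs : MemLp s ⊤ (volume : Measure Plane)) : FourierDivFree fun j => mult s (H j) := by
  have h : ∀ᵐ ξ : Plane, ∀ j, (𝓕 (_root_.mult s (H j)) : L2 ℂ) ξ = s ξ * (𝓕 (H j) : L2 ℂ) ξ :=
    ae_all_iff.2 fun j => fourier_mult hs (H j)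
  filter_upwards [hH, h] with ξ h1 h2
  simp only [h2, mul_left_comm _ (s ξ)]
  rw [← Finset.mul_sum, h1, mul_zero]

theorem lineDeriv_schwartzMul (f g : SchwartzMap Plane ℂ) (e : Plane) :
    ∂_{e} (schwartzMul f g) = schwartzMul (∂_{e} f) g + schwartzMul (∂_{e} g) f := by
  ext x
  have h : fderiv ℝ (schwartzMul f g) x = f x • fderiv ℝ g x + g x • fderiv ℝ f x :=
    fderiv_mul f.differentiableAt g.differentiableAt
  rw [_root_.add_apply, schwartzMul_apply, schwartzMul_apply,
    SchwartzMap.lineDerivOp_apply_eq_fderiv, SchwartzMap.lineDerivOp_apply_eq_fderiv,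
    SchwartzMap.lineDerivOp_apply_eq_fderiv, h]
  simp only [_root_.add_apply, _root_.smul_apply, smul_eq_mul]
  ring

theorem toLp_add (f g : SchwartzMap Plane ℂ) :
    (f + g).toLp 2 volume = f.toLp 2 volume + g.toLp 2 volume := rfl

/-- Integration by parts against a divergence free field. -/
theorem FourierDivFree.sum_triple_add {H : Fin 2 → L2 ℂ} (hH : FourierDivFree H)
    (s t : SchwartzMap Plane ℂ) (u v : L2 ℂ) :
    ∑ j, (triple (multTop (derivSymbol j s) u) (_root_.mult t v) (H j) +
      triple (multTop (derivSymbol j t) v) (_root_.mult s u) (H j)) = 0 := by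
  refine dense_schwartz.induction_on₂ (p := fun u v =>
    ∑ j, (triple (multTop (derivSymbol j s) u) (_root_.mult t v) (H j) +
      triple (multTop (derivSymbol j t) v) (_root_.mult s u) (H j)) = 0) ?_ ?_ u v
  · have hc : ∀ j, Continuous fun q : L2 ℂ × L2 ℂ =>
        triple (multTop (derivSymbol j s) q.1) (_root_.mult t q.2) (H j) +
          triple (multTop (derivSymbol j t) q.2) (_root_.mult s q.1) (H j) := fun j =>
      Continuous.add (continuous_triple_multTop (derivSymbol j s) t (H j))
        (continuous_triple_multTop_swap (derivSymbol j t) s (H j))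
    exact isClosed_eq (continuous_finsetSum _ fun j _ => hc j) continuous_const
  intro u v
  rw [← hH.sum_pair_eq_zero (schwartzMul (SchwartzMap.fourierMultiplierCLM ℂ s u)
        (SchwartzMap.fourierMultiplierCLM ℂ t v))]
  refine Finset.sum_congr rfl fun j _ => ?_
  rw [triple_multTop_toLp, triple_multTop_toLp, fourierMultiplier_derivSymbol,
    fourierMultiplier_derivSymbol]
  set f := SchwartzMap.fourierMultiplierCLM ℂ s u
  set g := SchwartzMap.fourierMultiplierCLM ℂ t v
  rw [lineDeriv_schwartzMul, toLp_add, map_add, _root_.add_apply]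

/-! ### The flux through a frequency threshold -/

/-- An even smooth frequency cutoff with values in `[0, 1]`, equal to `1` on the unit ball and
vanishing outside the ball of radius `4/3`. The multiplier `P_a` with the symbol `dil a χ = χ(a ·)`
keeps the frequencies below `1 / a`, so that larger values of `a` mean lower thresholds. -/
structure IsCutoff (χ : SchwartzMap Plane ℂ) : Prop where
  exists_real : ∀ ξ, ∃ r : ℝ, 0 ≤ r ∧ r ≤ 1 ∧ χ ξ = (r : ℂ)
  even : ∀ ξ, χ (-ξ) = χ ξ
  eq_one : ∀ ξ, ‖ξ‖ < 1 → χ ξ = 1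
  eq_zero : ∀ ξ, 4 / 3 < ‖ξ‖ → χ ξ = 0

theorem mult_mult_schwartz {s t r : SchwartzMap Plane ℂ} (h : ∀ ξ, s ξ * t ξ = r ξ) (f : L2 ℂ) :
    mult s (mult t f) = mult r f := by
  rw [mult_mult (s.memLp_top volume) (t.memLp_top volume)]
  congr 2
  exact funext h

theorem multTop_congr {s t : SchwartzMap Plane ℂ} {f g : L2 ℂ} (h : mult s f = mult t g) :
    multTop s f = multTop t g := by
  refine Lp.ext ?_
  filter_upwards [coeFn_multTop s f, coeFn_multTop t g] with x h1 h2
  rw [h1, h2, h]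

namespace IsCutoff

variable {χ : SchwartzMap Plane ℂ} (hχ : IsCutoff χ)
include hχ

theorem dil_eq_one {a : ℝ} (ha : 0 < a) {ξ : Plane} (h : a * ‖ξ‖ < 1) : dil a χ ξ = 1 := by
  rw [dil_apply ha.ne']
  refine hχ.eq_one _ ?_
  rwa [norm_smul, Real.norm_of_nonneg ha.le]

theorem dil_eq_zero {a : ℝ} (ha : 0 < a) {ξ : Plane} (h : 4 / 3 < a * ‖ξ‖) : dil a χ ξ = 0 := by
  rw [dil_apply ha.ne']
  refine hχ.eq_zero _ ?_
  rwa [norm_smul, Real.norm_of_nonneg ha.le]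

/-- `P_b` acts as the identity on the range of `P_a`, as `4 / (3 a) < 1 / b`; this is the source of
all the absorption rules below. -/
theorem dil_mul_dil {a b : ℝ} (ha : 0 < a) (hb : 0 < b) (h : 4 * b < 3 * a) (ξ : Plane) :
    dil b χ ξ * dil a χ ξ = dil a χ ξ := by
  rcases le_or_gt (a * ‖ξ‖) (4 / 3) with h1 | h1
  · rw [hχ.dil_eq_one hb, one_mul]
    have := norm_nonneg ξ
    by_contra! hcon
    nlinarith
  · rw [hχ.dil_eq_zero ha h1, mul_zero]

theorem low_low {a b : ℝ} (ha : 0 < a) (hb : 0 < b) (h : 4 * b < 3 * a) (f : L2 ℂ) :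
    mult (dil b χ) (mult (dil a χ) f) = mult (dil a χ) f :=
  mult_mult_schwartz (hχ.dil_mul_dil ha hb h) f

theorem low_low' {a b : ℝ} (ha : 0 < a) (hb : 0 < b) (h : 4 * b < 3 * a) (f : L2 ℂ) :
    mult (dil a χ) (mult (dil b χ) f) = mult (dil a χ) f :=
  mult_mult_schwartz (fun ξ => by rw [mul_comm, hχ.dil_mul_dil ha hb h]) f

theorem deriv_low {a b : ℝ} (ha : 0 < a) (hb : 0 < b) (h : 4 * b < 3 * a) (j : Fin 2) (f : L2 ℂ) :
    mult (derivSymbol j (dil b χ)) (mult (dil a χ) f) = mult (derivSymbol j (dil a χ)) f :=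
  mult_mult_schwartz (fun ξ => by
    rw [derivSymbol_apply, derivSymbol_apply, mul_assoc, hχ.dil_mul_dil ha hb h]) f

theorem deriv_low' {a b : ℝ} (ha : 0 < a) (hb : 0 < b) (h : 4 * b < 3 * a) (j : Fin 2) (f : L2 ℂ) :
    mult (derivSymbol j (dil a χ)) (mult (dil b χ) f) = mult (derivSymbol j (dil a χ)) f :=
  mult_mult_schwartz (fun ξ => by
    rw [derivSymbol_apply, mul_assoc, mul_comm (dil a χ ξ), hχ.dil_mul_dil ha hb h]) f

theorem low_deriv {a b : ℝ} (ha : 0 < a) (hb : 0 < b) (h : 4 * b < 3 * a) (j : Fin 2) (f : L2 ℂ) :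
    mult (dil a χ) (mult (derivSymbol j (dil b χ)) f) = mult (derivSymbol j (dil a χ)) f :=
  mult_mult_schwartz (fun ξ => by
    rw [derivSymbol_apply, derivSymbol_apply, mul_left_comm, mul_comm (dil a χ ξ),
      hχ.dil_mul_dil ha hb h]) f

end IsCutoff

theorem triple_comm (w : Lp ℂ ⊤ (volume : Measure Plane)) (u H : L2 ℂ) :
    triple w u H = triple w H u := by
  rw [triple_apply, triple_apply]
  congr 1; ext x; ring

theorem triple_multTop_rotate (s t : SchwartzMap Plane ℂ) (v u H : L2 ℂ) :
    triple (multTop s v) (mult t u) H = triple (multTop t u) H (mult s v) := by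
  rw [triple_multTop, triple_multTop]
  congr 1; ext x; ring

/-- The flux `∫ u H · ∇ P v`, where `P` is the multiplier with symbol `χ(a ·)`. -/
def flux (χ : SchwartzMap Plane ℂ) (a : ℝ) (H : Fin 2 → L2 ℂ) (v u : L2 ℂ) : ℂ :=
  ∑ j, triple (multTop (derivSymbol j (dil a χ)) v) u (H j)

section flux

variable (χ : SchwartzMap Plane ℂ) (a : ℝ) (H : Fin 2 → L2 ℂ)

theorem flux_add_left (v v' u : L2 ℂ) : flux χ a H (v + v') u = flux χ a H v u + flux χ a H v' u := by
  simp [flux, Finset.sum_add_distrib]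

theorem flux_add_right (v u u' : L2 ℂ) :
    flux χ a H v (u + u') = flux χ a H v u + flux χ a H v u' := by
  simp [flux, Finset.sum_add_distrib]

theorem flux_sub_left (v v' u : L2 ℂ) : flux χ a H (v - v') u = flux χ a H v u - flux χ a H v' u := by
  simp [flux, Finset.sum_sub_distrib]

theorem flux_sub_right (v u u' : L2 ℂ) :
    flux χ a H v (u - u') = flux χ a H v u - flux χ a H v u' := by
  simp [flux, Finset.sum_sub_distrib]

theorem flux_add_field (H' : Fin 2 → L2 ℂ) (v u : L2 ℂ) :
    flux χ a (fun j => H j + H' j) v u = flux χ a H v u + flux χ a H' v u := by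
  simp [flux, Finset.sum_add_distrib]

end flux

/-- Skew symmetry of the flux on functions that are not affected by the cutoff. -/
theorem FourierDivFree.flux_skew {χ : SchwartzMap Plane ℂ} {a : ℝ} {H : Fin 2 → L2 ℂ}
    (hH : FourierDivFree H) {u v : L2 ℂ} (hu : _root_.mult (dil a χ) u = u)
    (hv : _root_.mult (dil a χ) v = v) : flux χ a H u v = - flux χ a H v u := by
  have h := hH.sum_triple_add (dil a χ) (dil a χ) u v
  rw [hu, hv, Finset.sum_add_distrib] at h
  exact eq_neg_of_add_eq_zero_left h

theorem FourierDivFree.flux_self {χ : SchwartzMap Plane ℂ} {a : ℝ} {H : Fin 2 → L2 ℂ}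
    (hH : FourierDivFree H) {u : L2 ℂ} (hu : _root_.mult (dil a χ) u = u) :
    flux χ a H u u = 0 :=
  self_eq_neg.1 (hH.flux_skew hu hu)

namespace IsCutoff

variable {χ : SchwartzMap Plane ℂ} (hχ : IsCutoff χ)
include hχ

theorem flux_low {a b : ℝ} (ha : 0 < a) (hb : 0 < b) (h : 4 * b < 3 * a) (H : Fin 2 → L2 ℂ)
    (v u : L2 ℂ) : flux χ b H (mult (dil a χ) v) u = flux χ a H v u := by
  unfold flux
  refine Finset.sum_congr rfl fun j _ => ?_
  rw [multTop_congr (hχ.deriv_low ha hb h j v)]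

theorem flux_low' {a b : ℝ} (ha : 0 < a) (hb : 0 < b) (h : 4 * b < 3 * a) (H : Fin 2 → L2 ℂ)
    (v u : L2 ℂ) : flux χ a H (mult (dil b χ) v) u = flux χ a H v u := by
  unfold flux
  refine Finset.sum_congr rfl fun j _ => ?_
  rw [multTop_congr (hχ.deriv_low' ha hb h j v)]

/-- For a field with frequencies well below the threshold, only the part of `g` with frequencies
comparable to the threshold contributes to the flux through it. -/
theorem flux_localize {a : ℝ} (ha : 0 < a) {H : Fin 2 → L2 ℂ} (hH : FourierDivFree H)
    (hlow : ∀ j, mult (dil (8 * a) χ) (H j) = H j) (g : L2 ℂ) :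
    flux χ a H g g = flux χ a H (mult (dil (a / 2) χ) g - mult (dil (2 * a) χ) g)
      (mult (dil (a / 2) χ) g - mult (dil (2 * a) χ) g) := by
  have ha2 : 0 < a / 2 := by positivity
  have ha4 : 0 < a / 4 := by positivity
  have h2a : 0 < 2 * a := by positivity
  have h8a : 0 < 8 * a := by positivity
  have hsupp : ∀ {b : ℝ}, 0 < b → ∀ ξ : Plane, 4 / (3 * b) < ‖ξ‖ → dil b χ ξ = 0 := by
    intro b hb ξ h
    refine hχ.dil_eq_zero hb ?_
    rw [div_lt_iff₀ (by positivity)] at h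
    linarith
  set q := mult (dil (a / 2) χ) g with hq
  set r := mult (dil (2 * a) χ) g with hr
  have hqr : q = r + (q - r) := by abel
  set m := q - r with hm
  -- the frequencies of `g - q` are too high
  have hhigh : flux χ a H q (g - q) = 0 := by
    unfold flux
    refine Finset.sum_eq_zero fun j _ => ?_
    rw [multTop_congr (hχ.low_deriv ha ha2 (by linarith) j q).symm, triple_comm, ← hlow j]
    refine triple_eq_zero_of_support (hsupp ha) (hsupp h8a) ?_ _ _
    filter_upwards [fourier_sub_ae g q, fourier_mult ((dil (a / 2) χ).memLp_top volume) g]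
      with ξ h1 h2 h3
    have h4 : a / 2 * ‖ξ‖ < 1 := by
      have h5 : 4 / (3 * a) + 4 / (3 * (8 * a)) = 3 / 2 / a := by field_simp; norm_num
      rw [h5, le_div_iff₀ ha] at h3
      linarith
    rw [h1, hq, h2, hχ.dil_eq_one ha2 h4, one_mul, sub_self]
  have h1 : flux χ a H g g = flux χ a H q q := by
    rw [← hχ.flux_low' ha ha2 (by linarith) H g g, ← hq]
    have : flux χ a H q g = flux χ a H q (q + (g - q)) := by congr 1; abel
    rw [this, flux_add_right, hhigh, add_zero]
  have hlowr : mult (dil a χ) r = r := hχ.low_low h2a ha (by linarith) g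
  have hrr : flux χ a H r r = 0 := hH.flux_self hlowr
  have hr4 : mult (dil (a / 4) χ) r = r := hχ.low_low h2a ha4 (by linarith) g
  have hm4 : mult (dil (a / 4) χ) m = m := by
    rw [hm, map_sub, hr4, hq, hχ.low_low ha2 ha4 (by linarith)]
  have hrm : flux χ a H r m = - flux χ (a / 4) H m r := by
    rw [← hH.flux_skew hr4 hm4, hr, hχ.flux_low h2a ha (by linarith),
      hχ.flux_low h2a ha4 (by linarith)]
  -- `∇ (P_a - P_{a/4}) m` has no frequencies in the range of those of `r H`
  have hcross : flux χ a H m r - flux χ (a / 4) H m r = 0 := by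
    unfold flux
    rw [← Finset.sum_sub_distrib]
    refine Finset.sum_eq_zero fun j _ => ?_
    rw [hr, triple_multTop_rotate, triple_multTop_rotate, ← map_sub, ← hlow j]
    refine triple_eq_zero_of_support (hsupp h2a) (hsupp h8a) ?_ _ _
    filter_upwards [fourier_sub_ae (mult (derivSymbol j (dil a χ)) m)
      (mult (derivSymbol j (dil (a / 4) χ)) m),
      fourier_mult ((derivSymbol j (dil a χ)).memLp_top volume) m,
      fourier_mult ((derivSymbol j (dil (a / 4) χ)).memLp_top volume) m] with ξ h1 h2 h3 h4
    have h5 : a * ‖ξ‖ < 1 := by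
      have h6 : 4 / (3 * (2 * a)) + 4 / (3 * (8 * a)) = 5 / 6 / a := by field_simp; norm_num
      rw [h6, le_div_iff₀ ha] at h4
      linarith
    have h6 : a / 4 * ‖ξ‖ < 1 := by have := norm_nonneg ξ; nlinarith
    rw [h1, h2, h3, derivSymbol_apply, derivSymbol_apply, hχ.dil_eq_one ha h5,
      hχ.dil_eq_one ha4 h6, sub_self]
  rw [h1, hqr, flux_add_left, flux_add_right, flux_add_right, hrr, hrm]
  linear_combination hcross

end IsCutoff

/-! ### Estimates of the flux -/

theorem derivSymbol_dil {a : ℝ} (ha : 0 < a) (j : Fin 2) (s : SchwartzMap Plane ℂ) :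
    derivSymbol j (dil a s) = ((a⁻¹ : ℝ) : ℂ) • dil a (derivSymbol j s) := by
  ext ξ
  rw [derivSymbol_apply, _root_.smul_apply, dil_apply ha.ne', dil_apply ha.ne', derivSymbol_apply]
  have : (a : ℂ) ≠ 0 := by exact_mod_cast ha.ne'
  simp only [PiLp.smul_apply, smul_eq_mul]
  push_cast
  field_simp

theorem kernel_smul (c : ℂ) (s : SchwartzMap Plane ℂ) (z : Plane) :
    kernel (c • s) z = c * kernel s z := by
  have : kernel (c • s) = c • kernel s := by
    rw [kernel, kernel, FourierTransform.fourierInv_smul]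
  rw [this, _root_.smul_apply, smul_eq_mul]

theorem kernel_neg_of_odd {s : SchwartzMap Plane ℂ} (hs : ∀ ξ, s (-ξ) = - s ξ) (z : Plane) :
    kernel s (-z) = - kernel s z := by
  rw [kernel, SchwartzMap.fourierInv_coe, Real.fourierInv_eq, Real.fourierInv_eq,
    ← integral_neg_eq_self, ← integral_neg]
  congr 1
  ext v
  rw [inner_neg_neg, hs, smul_neg]

theorem lintegral_kernel_derivSymbol_dil {a : ℝ} (ha : 0 < a) (j : Fin 2)
    (s : SchwartzMap Plane ℂ) :
    ∫⁻ z, ‖kernel (derivSymbol j (dil a s)) z‖ₑ =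
      ENNReal.ofReal a⁻¹ * ∫⁻ z, ‖kernel (derivSymbol j s) z‖ₑ := by
  simp only [derivSymbol_dil ha, kernel_smul, enorm_mul]
  rw [lintegral_const_mul' _ _ enorm_ne_top, lintegral_kernel_dil ha, ← ofReal_norm,
    Complex.norm_real, Real.norm_of_nonneg (by positivity)]

theorem lintegral_kernel_derivSymbol_dil_mul {a : ℝ} (ha : 0 < a) (j : Fin 2)
    (s : SchwartzMap Plane ℂ) :
    ∫⁻ z, ‖kernel (derivSymbol j (dil a s)) z‖ₑ * ‖z‖ₑ =
      ∫⁻ z, ‖kernel (derivSymbol j s) z‖ₑ * ‖z‖ₑ := by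
  simp only [derivSymbol_dil ha, kernel_smul, enorm_mul, mul_assoc]
  rw [lintegral_const_mul' _ _ enorm_ne_top, lintegral_kernel_dil_mul ha, ← ofReal_norm,
    Complex.norm_real, Real.norm_of_nonneg (by positivity), ← mul_assoc,
    ← ENNReal.ofReal_mul (by positivity), inv_mul_cancel₀ ha.ne', ENNReal.ofReal_one, one_mul]

/-- A common bound for the `L¹` norms and the first moments of the convolution kernels of a cutoff
and of its derivatives. -/
def cutoffConst (χ : SchwartzMap Plane ℂ) : ℝ≥0∞ :=
  1 + ((∫⁻ z, ‖kernel χ z‖ₑ) + ∫⁻ z, ‖kernel χ z‖ₑ * ‖z‖ₑ) +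
    ∑ j, ((∫⁻ z, ‖kernel (derivSymbol j χ) z‖ₑ) + ∫⁻ z, ‖kernel (derivSymbol j χ) z‖ₑ * ‖z‖ₑ)

section bounds

variable (χ : SchwartzMap Plane ℂ)

theorem cutoffConst_ne_top : cutoffConst χ ≠ ⊤ := by
  simp only [cutoffConst, Ne, ENNReal.add_eq_top, ENNReal.sum_eq_top, not_or, not_exists, not_and]
  refine ⟨⟨ENNReal.one_ne_top, lintegral_schwartz_ne_top _, lintegral_schwartz_mul_ne_top _⟩, ?_⟩
  exact fun j _ => ⟨lintegral_schwartz_ne_top _, lintegral_schwartz_mul_ne_top _⟩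

theorem one_le_cutoffConst : 1 ≤ cutoffConst χ := by
  rw [cutoffConst, add_assoc]; exact le_self_add

theorem lintegral_kernel_le_cutoffConst : ∫⁻ z, ‖kernel χ z‖ₑ ≤ cutoffConst χ :=
  (le_self_add.trans le_add_self).trans le_self_add

theorem lintegral_kernel_mul_le_cutoffConst : ∫⁻ z, ‖kernel χ z‖ₑ * ‖z‖ₑ ≤ cutoffConst χ :=
  (le_add_self.trans le_add_self).trans le_self_add

theorem lintegral_kernel_deriv_le_cutoffConst (j : Fin 2) :
    ∫⁻ z, ‖kernel (derivSymbol j χ) z‖ₑ ≤ cutoffConst χ :=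
  (le_self_add.trans (Finset.single_le_sum (f := fun j => (∫⁻ z, ‖kernel (derivSymbol j χ) z‖ₑ) +
    ∫⁻ z, ‖kernel (derivSymbol j χ) z‖ₑ * ‖z‖ₑ) (fun _ _ => zero_le) (Finset.mem_univ j))).trans
    le_add_self

theorem lintegral_kernel_deriv_mul_le_cutoffConst (j : Fin 2) :
    ∫⁻ z, ‖kernel (derivSymbol j χ) z‖ₑ * ‖z‖ₑ ≤ cutoffConst χ :=
  (le_add_self.trans (Finset.single_le_sum (f := fun j => (∫⁻ z, ‖kernel (derivSymbol j χ) z‖ₑ) +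
    ∫⁻ z, ‖kernel (derivSymbol j χ) z‖ₑ * ‖z‖ₑ) (fun _ _ => zero_le) (Finset.mem_univ j))).trans
    le_add_self

theorem eLpNorm_low_le {a : ℝ} (ha : 0 < a) (f : L2 ℂ) {p : ℝ≥0∞} (hp : 1 ≤ p) :
    eLpNorm (mult (dil a χ) f) p volume ≤ cutoffConst χ * eLpNorm f p volume := by
  refine (eLpNorm_mult_le _ f hp).trans (mul_le_mul_left ?_ _)
  rw [lintegral_kernel_dil ha]
  exact lintegral_kernel_le_cutoffConst χ

/-- Bernstein's inequality. -/
theorem eLpNorm_deriv_low_le {a : ℝ} (ha : 0 < a) (j : Fin 2) (f : L2 ℂ) {p : ℝ≥0∞}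
    (hp : 1 ≤ p) :
    eLpNorm (mult (derivSymbol j (dil a χ)) f) p volume ≤
      ENNReal.ofReal a⁻¹ * cutoffConst χ * eLpNorm f p volume := by
  refine (eLpNorm_mult_le _ f hp).trans (mul_le_mul_left ?_ _)
  rw [lintegral_kernel_derivSymbol_dil ha]
  exact mul_le_mul_right (lintegral_kernel_deriv_le_cutoffConst χ j) _

variable {χ}

namespace IsCutoff

theorem apply_zero (hχ : IsCutoff χ) : χ 0 = 1 := hχ.eq_one 0 (by simp)

/-- A field without low frequencies is controlled by its difference quotients, with a factor
proportional to its smallest wave length. -/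
theorem eLpNorm_high_le (hχ : IsCutoff χ) {a : ℝ} (ha : 0 < a) {H : L2 ℂ}
    (hH : mult (dil a χ) H = 0) {p : ℝ≥0∞} (hp : 1 ≤ p) :
    eLpNorm H p volume ≤ ENNReal.ofReal a * cutoffConst χ * diffNorm H p := by
  refine (eLpNorm_le_diffNorm (dil a χ) ?_ H hH hp).trans (mul_le_mul_left ?_ _)
  · rw [dil_apply ha.ne', smul_zero, hχ.apply_zero]
  · rw [lintegral_kernel_dil_mul ha]
    exact mul_le_mul_right (lintegral_kernel_mul_le_cutoffConst χ) _

theorem kernel_derivSymbol_neg (hχ : IsCutoff χ) {a : ℝ} (ha : 0 < a) (j : Fin 2) (z : Plane) :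
    kernel (derivSymbol j (dil a χ)) (-z) = - kernel (derivSymbol j (dil a χ)) z := by
  refine kernel_neg_of_odd (fun ξ => ?_) z
  rw [derivSymbol_apply, derivSymbol_apply, dil_apply ha.ne', dil_apply ha.ne', smul_neg, hχ.even]
  simp

/-- The commutator estimate for the flux: the symmetrised flux costs one derivative of the field and
none of the two functions, uniformly in the threshold. -/
theorem enorm_flux_add_flux_le (hχ : IsCutoff χ) {a : ℝ} (ha : 0 < a) (H : Fin 2 → L2 ℂ)
    (u v : L2 ℂ) {p r m : ℝ≥0∞} (h : p⁻¹ + r⁻¹ + m⁻¹ = 1) :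
    ‖flux χ a H v u + flux χ a H u v‖ₑ ≤
      cutoffConst χ * (∑ j, diffNorm (H j) m) * (eLpNorm u p volume * eLpNorm v r volume) := by
  rw [flux, flux, ← Finset.sum_add_distrib, Finset.mul_sum, Finset.sum_mul]
  refine (enorm_sum_le _ _).trans (Finset.sum_le_sum fun j _ => ?_)
  refine (enorm_triple_add_triple_le _ (hχ.kernel_derivSymbol_neg ha j) u v (H j) h).trans ?_
  rw [lintegral_kernel_derivSymbol_dil_mul ha]
  calc _ ≤ cutoffConst χ * (eLpNorm u p volume * eLpNorm v r volume * diffNorm (H j) m) :=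
        mul_le_mul_left (lintegral_kernel_deriv_mul_le_cutoffConst χ j) _
    _ = _ := by ring

/-- The commutator estimate for the quadratic flux. -/
theorem enorm_flux_self_le (hχ : IsCutoff χ) {a : ℝ} (ha : 0 < a) (H : Fin 2 → L2 ℂ)
    (u : L2 ℂ) {p m : ℝ≥0∞} (h : p⁻¹ + p⁻¹ + m⁻¹ = 1) :
    ‖flux χ a H u u‖ₑ ≤
      cutoffConst χ * (∑ j, diffNorm (H j) m) * eLpNorm u p volume ^ 2 := by
  have h1 := hχ.enorm_flux_add_flux_le ha H u u h
  rw [← sq] at h1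
  refine le_trans ?_ h1
  rw [← two_mul, enorm_mul]
  refine le_mul_of_one_le_left zero_le ?_
  rw [← ofReal_norm, Complex.norm_ofNat]
  norm_num

/-- For a field without low frequencies, the quadratic flux is controlled by the part of the
function above the threshold: `∇ P_a u` paired with `P_a u` gives nothing, as `P_a` may there be
replaced by `P_{a/2}`, which does not affect `P_a u`. -/
theorem enorm_flux_self_le_of_high (hχ : IsCutoff χ) {a : ℝ} (ha : 0 < a) {H : Fin 2 → L2 ℂ}
    (hH : FourierDivFree H) (hhigh : ∀ j, mult (dil (16 * a) χ) (H j) = 0)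
    (u : L2 ℂ) {p m : ℝ≥0∞} (hp : 1 ≤ p) (hm : 1 ≤ m) (h : p⁻¹ + 2⁻¹ + m⁻¹ = 1) :
    ‖flux χ a H u u‖ₑ ≤ 16 * cutoffConst χ ^ 2 * (∑ j, diffNorm (H j) m) *
      (eLpNorm u p volume * eLpNorm (u - mult (dil a χ) u : L2 ℂ) 2 volume) := by
  set l := mult (dil a χ) u with hl
  set w := u - l with hw
  have ha2 : 0 < a / 2 := by positivity
  have h0 : flux χ a H u l = 0 := by
    rw [← hχ.flux_low ha ha2 (by linarith) H u l, ← hl]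
    exact hH.flux_self (hχ.low_low ha ha2 (by linarith) u)
  have h1 : flux χ a H u u = flux χ a H u w := by
    have : flux χ a H u u = flux χ a H u (l + w) := by congr 1; rw [hw]; abel
    rw [this, flux_add_right, h0, zero_add]
  rw [h1, flux, Finset.mul_sum, Finset.sum_mul]
  refine (enorm_sum_le _ _).trans (Finset.sum_le_sum fun j _ => ?_)
  refine (enorm_triple_le _ u w (H j) h).trans ?_
  have h16 : ENNReal.ofReal a⁻¹ * ENNReal.ofReal (16 * a) = 16 := by
    rw [← ENNReal.ofReal_mul (by positivity)]
    have : a⁻¹ * (16 * a) = 16 := by field_simp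
    rw [this]; norm_num
  calc _ ≤ (ENNReal.ofReal a⁻¹ * cutoffConst χ * eLpNorm u p volume) * eLpNorm w 2 volume *
        (ENNReal.ofReal (16 * a) * cutoffConst χ * diffNorm (H j) m) := by
        gcongr
        · exact eLpNorm_deriv_low_le χ ha j u hp
        · exact hχ.eLpNorm_high_le (by positivity) (hhigh j) hm
    _ = (ENNReal.ofReal a⁻¹ * ENNReal.ofReal (16 * a)) * cutoffConst χ ^ 2 * diffNorm (H j) m *
        (eLpNorm u p volume * eLpNorm w 2 volume) := by ring
    _ = _ := by rw [h16]

end IsCutoff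

end bounds

theorem eLpNorm_two_eq {V : Type*} [NormedAddCommGroup V] (f : L2 V) :
    eLpNorm f 2 volume = ‖f‖ₑ := by
  rw [Lp.enorm_def]

namespace IsCutoff

variable {χ : SchwartzMap Plane ℂ}

theorem norm_le_one (hχ : IsCutoff χ) (ξ : Plane) : ‖χ ξ‖ ≤ 1 := by
  obtain ⟨r, h0, h1, h2⟩ := hχ.exists_real ξ
  rw [h2, Complex.norm_real, Real.norm_of_nonneg h0]
  exact h1

theorem dil_norm_le_one (hχ : IsCutoff χ) {a : ℝ} (ha : 0 < a) (ξ : Plane) :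
    ‖dil a χ ξ‖ ≤ 1 := by
  rw [dil_apply ha.ne']; exact hχ.norm_le_one _

theorem norm_low_le (hχ : IsCutoff χ) {a : ℝ} (ha : 0 < a) (f : L2 ℂ) :
    ‖mult (dil a χ) f‖ ≤ ‖f‖ := by
  simpa using norm_mult_le ((dil a χ).memLp_top volume) (hχ.dil_norm_le_one ha) f

end IsCutoff

theorem low_comm (χ : SchwartzMap Plane ℂ) (a b : ℝ) (f : L2 ℂ) :
    mult (dil a χ) (mult (dil b χ) f) = mult (dil b χ) (mult (dil a χ) f) := by
  rw [mult_mult ((dil a χ).memLp_top volume) ((dil b χ).memLp_top volume),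
    mult_mult ((dil b χ).memLp_top volume) ((dil a χ).memLp_top volume)]
  congr 2; ext ξ; exact mul_comm _ _

namespace IsCutoff

variable {χ : SchwartzMap Plane ℂ}

/-- The flux estimate, for a field that is split at a frequency slightly below the threshold. The
flux of the low part of the field is localised to the annulus around the threshold before the commutator
estimate is applied; to have the whole field appear in that estimate, the localised flux of the high
part is added and subtracted. -/
theorem enorm_flux_self_le_total (hχ : IsCutoff χ) {a : ℝ} (ha : 0 < a) {H' H'' : Fin 2 → L2 ℂ}
    (hH' : FourierDivFree H') (hH'' : FourierDivFree H'')
    (hlow : ∀ j, mult (dil (8 * a) χ) (H'' j) = H'' j)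
    (hhigh : ∀ j, mult (dil (16 * a) χ) (H' j) = 0)
    (g : L2 ℂ) {p r m q : ℝ≥0∞} (hp : 1 ≤ p) (hm : 1 ≤ m) (h : p⁻¹ + 2⁻¹ + m⁻¹ = 1)
    (h' : r⁻¹ + r⁻¹ + q⁻¹ = 1) :
    ‖flux χ a (fun j => H' j + H'' j) g g‖ₑ ≤
      cutoffConst χ * (∑ j, diffNorm (H' j + H'' j : L2 ℂ) q) *
        eLpNorm (mult (dil (a / 2) χ) g - mult (dil (2 * a) χ) g : L2 ℂ) r volume ^ 2 +
      80 * cutoffConst χ ^ 3 * (∑ j, diffNorm (H' j) m) *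
        (eLpNorm g p volume * eLpNorm (g - mult (dil a χ) g : L2 ℂ) 2 volume) := by
  set K := cutoffConst χ
  set u := mult (dil (a / 2) χ) g - mult (dil (2 * a) χ) g with hu
  set w := g - mult (dil a χ) g with hw
  set D := ∑ j, diffNorm (H' j) m
  have ha2 : 0 < a / 2 := by positivity
  have h2a : 0 < 2 * a := by positivity
  have hsplit : flux χ a (fun j => H' j + H'' j) g g =
      flux χ a (fun j => H' j + H'' j) u u - flux χ a H' u u + flux χ a H' g g := by
    rw [flux_add_field, flux_add_field, hχ.flux_localize ha hH'' hlow g]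
    ring
  have huw : u - mult (dil a χ) u = mult (dil (a / 2) χ) w - mult (dil (2 * a) χ) w := by
    rw [hu, hw]
    simp only [map_sub, low_comm χ a (a / 2), low_comm χ a (2 * a)]
    abel
  have hu2 : eLpNorm (u - mult (dil a χ) u : L2 ℂ) 2 volume ≤ 2 * eLpNorm w 2 volume := by
    rw [eLpNorm_two_eq, eLpNorm_two_eq, huw, two_mul (‖w‖ₑ)]
    refine (enorm_sub_le).trans ?_
    rw [← ofReal_norm, ← ofReal_norm, ← ofReal_norm w]
    exact add_le_add (ENNReal.ofReal_le_ofReal (hχ.norm_low_le ha2 w))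
      (ENNReal.ofReal_le_ofReal (hχ.norm_low_le h2a w))
  have hup : eLpNorm u p volume ≤ 2 * K * eLpNorm g p volume := by
    rw [eLpNorm_congr_ae (Lp.coeFn_sub (mult (dil (a / 2) χ) g) (mult (dil (2 * a) χ) g))]
    refine (eLpNorm_sub_le (Lp.aestronglyMeasurable _) (Lp.aestronglyMeasurable _) hp).trans ?_
    rw [mul_assoc, two_mul (K * _)]
    exact add_le_add (eLpNorm_low_le χ ha2 g hp) (eLpNorm_low_le χ h2a g hp)
  have e1 := hχ.enorm_flux_self_le ha (fun j => H' j + H'' j) u h'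
  have e2 := hχ.enorm_flux_self_le_of_high ha hH' hhigh u hp hm h
  have e3 := hχ.enorm_flux_self_le_of_high ha hH' hhigh g hp hm h
  rw [hsplit]
  refine (enorm_add_le _ _).trans ((add_le_add ((enorm_sub_le).trans (add_le_add e1 e2)) e3).trans ?_)
  rw [add_assoc]
  refine add_le_add le_rfl ?_
  have hK : 1 ≤ K := one_le_cutoffConst χ
  calc _ ≤ 16 * K ^ 2 * D * (2 * K * eLpNorm g p volume * (2 * eLpNorm w 2 volume)) +
        16 * (K ^ 2 * K) * D * (eLpNorm g p volume * eLpNorm w 2 volume) := by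
        gcongr
        exact le_mul_of_one_le_right zero_le hK
    _ = _ := by ring

end IsCutoff

/-! ### Weak gradients and difference quotients -/

section translation

variable {V W : Type*} [NormedAddCommGroup V] [NormedAddCommGroup W]

theorem measurePreserving_shear (ν : Measure ℝ) [SFinite ν] (z : Plane) :
    MeasurePreserving (fun q : ℝ × Plane => (q.1, q.2 - q.1 • z)) (ν.prod volume)
      (ν.prod volume) := by
  have hm : Measurable (Function.uncurry fun (s : ℝ) (x : Plane) => x - s • z) :=
    (show Continuous fun q : ℝ × Plane => q.2 - q.1 • z by fun_prop).measurable
  exact (MeasurePreserving.id ν).skew_product (g := fun (s : ℝ) (x : Plane) => x - s • z) hm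
    (ae_of_all _ fun s => (measurePreserving_sub_right_plane (s • z)).map_eq)

/-- A function whose increments along a segment are controlled by the integral of `‖G‖` along that
segment has difference quotients controlled by `G`. -/
theorem diffNorm_le_of_enorm_sub_le {f : Plane → V} {G : Plane → W}
    (hG : AEStronglyMeasurable G volume)
    (h : ∀ z, ∀ᵐ x : Plane, ‖f (x - z) - f x‖ₑ ≤
      ∫⁻ s in Set.Icc (0 : ℝ) 1, ‖G (x - s • z)‖ₑ * ‖z‖ₑ) {p : ℝ≥0∞} (hp : 1 ≤ p) :
    diffNorm f p ≤ eLpNorm G p volume := by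
  refine iSup_le fun z => ?_
  rcases eq_or_ne z 0 with rfl | hz
  · simp
  rw [ENNReal.div_le_iff (by simpa using hz) enorm_ne_top]
  have hmono : eLpNorm (fun x => f (x - z) - f x) p volume ≤
      eLpNorm (fun x => ∫⁻ s in Set.Icc (0 : ℝ) 1, ‖G (x - s • z)‖ₑ * ‖z‖ₑ) p volume :=
    eLpNorm_mono_enorm_ae (by simpa only [enorm_eq_self] using h z)
  refine hmono.trans ?_
  have hmeas : AEMeasurable (Function.uncurry fun (s : ℝ) (x : Plane) =>
      ‖G (x - s • z)‖ₑ * ‖z‖ₑ) ((volume.restrict (Set.Icc (0 : ℝ) 1)).prod volume) := by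
    have h1 : AEStronglyMeasurable (fun q : ℝ × Plane => G (q.2 - q.1 • z))
        ((volume.restrict (Set.Icc (0 : ℝ) 1)).prod volume) :=
      hG.comp_snd.comp_measurePreserving (measurePreserving_shear _ z)
    exact h1.enorm.mul_const _
  refine (eLpNorm_lintegral_le (volume.restrict (Set.Icc (0 : ℝ) 1)) volume hmeas hp
    (M := eLpNorm G p volume * ‖z‖ₑ) (ae_of_all _ fun s => ?_)).trans ?_
  · have h2 : eLpNorm (fun x => ‖G (x - s • z)‖ₑ * ‖z‖ₑ) p volume =
        eLpNorm (fun x => ‖z‖ • ‖G (x - s • z)‖) p volume := by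
      refine eLpNorm_congr_enorm_ae (ae_of_all _ fun x => ?_)
      rw [enorm_smul, enorm_norm, enorm_norm, enorm_eq_self, mul_comm]
    rw [h2]
    refine (eLpNorm_const_smul_le (c := ‖z‖) (f := fun x => ‖G (x - s • z)‖)).trans ?_
    rw [enorm_norm, eLpNorm_norm (fun x => G (x - s • z)), eLpNorm_comp_sub hG, mul_comm]
  · simp

end translation

section weakGradient

variable {V : Type*} [NormedAddCommGroup V] [NormedSpace ℝ V]

theorem IsTestFunction.comp_add {φ : Plane → ℝ} (hφ : IsTestFunction φ) (z : Plane) :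
    IsTestFunction fun x => φ (x + z) :=
  ⟨hφ.1.comp (by fun_prop), hφ.2.comp_homeomorph (Homeomorph.addRight z)⟩

theorem sub_eq_setIntegral_fderiv [CompleteSpace V] {f : Plane → V} (hf : ContDiff ℝ 1 f)
    (x z : Plane) : f (x + z) - f x = ∫ s in Set.Icc (0 : ℝ) 1, fderiv ℝ f (x + s • z) z := by
  have hd : Continuous (fderiv ℝ f) := hf.continuous_fderiv (by simp)
  have hder : ∀ s : ℝ, HasDerivAt (fun s : ℝ => f (x + s • z)) (fderiv ℝ f (x + s • z) z) s := by
    intro s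
    have h1 : HasDerivAt (fun s : ℝ => x + s • z) z s := by
      simpa using ((hasDerivAt_id s).smul_const z).const_add x
    exact ((hf.differentiable (by simp)).differentiableAt.hasFDerivAt).comp_hasDerivAt s h1
  have h2 : Continuous fun s : ℝ => fderiv ℝ f (x + s • z) z := by fun_prop
  have h3 := intervalIntegral.integral_eq_sub_of_hasDerivAt (a := 0) (b := 1)
    (fun s _ => hder s) (h2.intervalIntegrable 0 1)
  rw [integral_Icc_eq_integral_Ioc, ← intervalIntegral.integral_of_le zero_le_one, h3]
  simp

omit [NormedSpace ℝ V] in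
theorem integrable_shear {G : Plane → V} (hG : LocallyIntegrable G volume) (z : Plane)
    {K : Set Plane} (hK : IsCompact K) :
    Integrable (fun q : ℝ × Plane => G (q.2 - q.1 • z))
      ((volume.restrict (Set.Icc (0 : ℝ) 1)).prod (volume.restrict K)) := by
  set K' : Set Plane := (fun q : ℝ × Plane => q.2 - q.1 • z) '' (Set.Icc (0 : ℝ) 1 ×ˢ K)
  have hK' : IsCompact K' := (isCompact_Icc.prod hK).image (by fun_prop)
  have h1 : Integrable (K'.indicator G) volume :=
    (integrable_indicator_iff hK'.measurableSet).2 (hG.integrableOn_isCompact hK')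
  have h2 : Integrable (fun q : ℝ × Plane => K'.indicator G (q.2 - q.1 • z))
      ((volume.restrict (Set.Icc (0 : ℝ) 1)).prod volume) :=
    (measurePreserving_shear _ z).integrable_comp_of_integrable
      (h1.comp_snd (volume.restrict (Set.Icc (0 : ℝ) 1)))
  have h3 : (volume.restrict (Set.Icc (0 : ℝ) 1)).prod (volume.restrict K) =
      (volume.prod volume).restrict (Set.Icc (0 : ℝ) 1 ×ˢ K) := Measure.prod_restrict _ _
  have h4 : (volume.restrict (Set.Icc (0 : ℝ) 1)).prod (volume : Measure Plane) =
      (volume.prod volume).restrict (Set.Icc (0 : ℝ) 1 ×ˢ Set.univ) := by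
    rw [← Measure.prod_restrict, Measure.restrict_univ]
  rw [h3]
  rw [h4] at h2
  have h5 := h2.mono_measure (Measure.restrict_mono
    (Set.prod_mono (subset_refl (Set.Icc (0 : ℝ) 1)) (Set.subset_univ K)) le_rfl)
  refine h5.congr ?_
  filter_upwards [ae_restrict_mem (measurableSet_Icc.prod hK.measurableSet)] with q hq
  exact Set.indicator_of_mem (Set.mem_image_of_mem _ hq) G

theorem integral_test_smul_eq_setIntegral (φ : Plane → ℝ) (f : Plane → V) :
    ∫ x, φ x • f x = ∫ x in tsupport φ, φ x • f x := by
  rw [setIntegral_eq_integral_of_forall_compl_eq_zero]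
  intro x hx
  rw [image_eq_zero_of_notMem_tsupport hx, zero_smul]

variable [CompleteSpace V]

/-- The fundamental theorem of calculus for a function with a weak gradient. -/
theorem HasWeakGradient.ae_sub_eq {f : Plane → V} {G : Plane → Plane →L[ℝ] V}
    (h : HasWeakGradient f G) (hf : LocallyIntegrable f volume) (z : Plane) :
    ∀ᵐ x : Plane, f (x - z) - f x = - ∫ s in Set.Icc (0 : ℝ) 1, G (x - s • z) z := by
  obtain ⟨hG, hweak⟩ := h
  set ν := volume.restrict (Set.Icc (0 : ℝ) 1) with hν
  have hGz : LocallyIntegrable (fun x => G x z) volume := by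
    intro x
    obtain ⟨u, hu, hi⟩ := hG x
    exact ⟨u, hu, hi.apply_continuousLinearMap z⟩
  have hfz : LocallyIntegrable (fun x => f (x - z)) volume := by
    intro x
    obtain ⟨u, hu, hi⟩ := hf (x - z)
    refine ⟨(fun x => x - z) ⁻¹' u, (continuous_id.sub continuous_const).continuousAt hu, ?_⟩
    exact ((measurePreserving_sub_right_plane z).integrableOn_comp_preimage
      (Homeomorph.subRight z).measurableEmbedding).2 hi
  have hJ : ∀ K : Set Plane, IsCompact K →
      IntegrableOn (fun x => ∫ s, G (x - s • z) z ∂ν) K volume := fun K hK =>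
    (integrable_shear hGz z hK).integral_prod_right
  have hJloc : LocallyIntegrable (fun x => - ∫ s, G (x - s • z) z ∂ν) volume :=
    LocallyIntegrable.neg ((locallyIntegrable_iff).2 hJ)
  refine ae_eq_of_integral_contDiff_smul_eq (hfz.sub hf) hJloc fun φ hφ hφc => ?_
  have htest : IsTestFunction φ := ⟨hφ, hφc⟩
  have hcont : Continuous φ := hφ.continuous
  have hd : Continuous (fderiv ℝ φ) := hφ.continuous_fderiv (by simp)
  -- the right-hand side
  have hright : ∫ x, φ x • (- ∫ s, G (x - s • z) z ∂ν) =
      - ∫ s, (∫ x, φ (x + s • z) • G x z) ∂ν := by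
    simp only [smul_neg, integral_neg]
    congr 1
    rw [integral_test_smul_eq_setIntegral]
    simp only [← integral_smul]
    have hint : Integrable (fun q : ℝ × Plane => φ q.2 • G (q.2 - q.1 • z) z)
        (ν.prod (volume.restrict (tsupport φ))) := by
      obtain ⟨C, hC⟩ := hφc.exists_bound_of_continuous hcont
      exact (integrable_shear hGz z hφc).bdd_smul C
        (hcont.comp continuous_snd).aestronglyMeasurable (ae_of_all _ fun q => hC q.2)
    rw [integral_integral_swap (f := fun x s => φ x • G (x - s • z) z) hint.swap]
    refine integral_congr_ae (ae_of_all _ fun s => ?_)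
    change ∫ x in tsupport φ, φ x • G (x - s • z) z = _
    rw [← integral_test_smul_eq_setIntegral]
    beta_reduce
    rw [← integral_sub_right_eq_self (fun x => φ (x + s • z) • G x z) (s • z)]
    simp
  have hleft : ∫ x, φ x • (f (x - z) - f x) = ∫ s, (∫ x, fderiv ℝ φ (x + s • z) z • f x) ∂ν := by
    have e1 : ∫ x, φ x • (f (x - z) - f x) = ∫ x, (φ (x + z) - φ x) • f x := by
      have i1 : Integrable (fun x => φ x • f (x - z)) volume :=
        hfz.integrable_smul_left_of_hasCompactSupport hcont hφc
      have i2 : Integrable (fun x => φ x • f x) volume :=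
        hf.integrable_smul_left_of_hasCompactSupport hcont hφc
      have i3 : Integrable (fun x => φ (x + z) • f x) volume :=
        hf.integrable_smul_left_of_hasCompactSupport (htest.comp_add z).1.continuous
          (htest.comp_add z).2
      simp only [smul_sub, sub_smul]
      rw [integral_sub i1 i2, integral_sub i3 i2]
      congr 1
      rw [← integral_sub_right_eq_self (fun x => φ (x + z) • f x) z]
      simp
    have e2 : ∀ x, φ (x + z) - φ x = ∫ s, fderiv ℝ φ (x + s • z) z ∂ν :=
      fun x => sub_eq_setIntegral_fderiv (hφ.of_le (by simp)) x z
    rw [e1]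
    simp only [e2, ← integral_smul_const]
    set K : Set Plane := (fun q : ℝ × Plane => q.2 - q.1 • z) '' (Set.Icc (0 : ℝ) 1 ×ˢ tsupport φ)
      with hKdef
    have hK : IsCompact K := (isCompact_Icc.prod hφc).image (by fun_prop)
    have hfK : Integrable (K.indicator f) volume :=
      (integrable_indicator_iff hK.measurableSet).2 (hf.integrableOn_isCompact hK)
    obtain ⟨C, hC⟩ := (hφc.fderiv (𝕜 := ℝ)).exists_bound_of_continuous hd
    have hint : Integrable (fun q : ℝ × Plane => fderiv ℝ φ (q.2 + q.1 • z) z • K.indicator f q.2)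
        (ν.prod volume) := by
      refine (hfK.comp_snd ν).bdd_smul (C * ‖z‖) ?_ (ae_of_all _ fun q => ?_)
      · exact (show Continuous fun q : ℝ × Plane => fderiv ℝ φ (q.2 + q.1 • z) z by
          fun_prop).aestronglyMeasurable
      · exact (ContinuousLinearMap.le_opNorm _ _).trans
          (mul_le_mul_of_nonneg_right (hC _) (norm_nonneg _))
    have hint' : Integrable (fun q : ℝ × Plane => fderiv ℝ φ (q.2 + q.1 • z) z • f q.2)
        (ν.prod volume) := by
      refine hint.congr ?_
      have h4 : ∀ᵐ q : ℝ × Plane ∂(ν.prod volume), q.1 ∈ Set.Icc (0 : ℝ) 1 :=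
        Measure.quasiMeasurePreserving_fst.ae (ae_restrict_mem measurableSet_Icc)
      filter_upwards [h4] with q hq
      by_cases hx : q.2 ∈ K
      · rw [Set.indicator_of_mem hx]
      · have h5 : q.2 + q.1 • z ∉ tsupport φ := fun hmem => hx
          ⟨(q.1, q.2 + q.1 • z), ⟨hq, hmem⟩, by simp⟩
        have h6 : fderiv ℝ φ (q.2 + q.1 • z) = 0 :=
          image_eq_zero_of_notMem_tsupport fun hmem => h5 (tsupport_fderiv_subset ℝ hmem)
        simp [h6]
    rw [integral_integral_swap (f := fun x s => fderiv ℝ φ (x + s • z) z • f x) hint'.swap]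
  change ∫ x, φ x • (f (x - z) - f x) = _
  rw [hleft, hright, ← integral_neg]
  refine integral_congr_ae (ae_of_all _ fun s => ?_)
  have h7 := hweak _ (htest.comp_add (s • z)) z
  simpa only [fderiv_comp_add_right] using h7

theorem diffNorm_le_gradNorm {f : Plane → V} (hf : LocallyIntegrable f volume) {p : ℝ≥0∞}
    (hp : 1 ≤ p) : diffNorm f p ≤ gradNorm f p := by
  refine le_iInf₂ fun G hG => ?_
  refine diffNorm_le_of_enorm_sub_le hG.1.aestronglyMeasurable (fun z => ?_) hp
  filter_upwards [hG.ae_sub_eq hf z] with x hx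
  rw [hx, enorm_neg]
  refine (enorm_integral_le_lintegral_enorm _).trans (lintegral_mono fun s => ?_)
  exact ContinuousLinearMap.le_opENorm _ _

end weakGradient

/-- Bernstein's inequality: functions with frequencies in a bounded set are Lipschitz. -/
theorem diffNorm_mult_top_le (s : SchwartzMap Plane ℂ) :
    ∃ C : ℝ≥0, ∀ f : L2 ℂ, diffNorm (mult s f) ⊤ ≤ C * eLpNorm f 2 volume := by
  set k := kernel s
  have hk : diffNorm k 2 ≤ eLpNorm (fun x => fderiv ℝ k x) 2 volume := by
    refine diffNorm_le_of_enorm_sub_le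
      (k.smooth ⊤ |>.continuous_fderiv (by simp)).aestronglyMeasurable (fun z => ?_) one_le_two
    refine ae_of_all _ fun x => ?_
    have h1 := sub_eq_setIntegral_fderiv (k.smooth 1) x (-z)
    rw [← sub_eq_add_neg] at h1
    rw [h1]
    refine (enorm_integral_le_lintegral_enorm _).trans (lintegral_mono fun s => ?_)
    have h2 := ContinuousLinearMap.le_opENorm (fderiv ℝ k (x + s • -z)) (-z)
    have h3 : x + s • -z = x - s • z := by rw [smul_neg, sub_eq_add_neg]
    rw [enorm_neg z] at h2
    rwa [h3] at h2 ⊢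
  have hk2 : eLpNorm (fun x => fderiv ℝ k x) 2 volume ≠ ⊤ :=
    ((SchwartzMap.fderivCLM ℝ Plane ℂ k).memLp 2 volume).2.ne
  -- with `‖τ_z k - k‖_2 ≤ ‖z‖ ‖∇k‖_2`, Cauchy-Schwarz bounds the increments of `k * f`
  refine ⟨(eLpNorm (fun x => fderiv ℝ k x) 2 volume).toNNReal, fun f => iSup_le fun z => ?_⟩
  rw [ENNReal.coe_toNNReal hk2]
  rcases eq_or_ne z 0 with rfl | hz
  · simp only [sub_zero, sub_self, eLpNorm_zero', ENNReal.zero_div, zero_le]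
  rw [ENNReal.div_le_iff (by simpa using hz) enorm_ne_top, eLpNorm_exponent_top]
  refine essSup_le_of_ae_le _ ?_
  have h1 : ∀ᵐ x, mult s f (x - z) = ∫ y, k y * f (x - z - y) :=
    (measurePreserving_sub_right_plane z).quasiMeasurePreserving.ae (mult_eq_kernel s f)
  filter_upwards [h1, mult_eq_kernel s f] with x hx1 hx2
  have h2 : ∫ y, k y * f (x - z - y) = ∫ y, k (y - z) * f (x - y) := by
    rw [← integral_sub_right_eq_self (fun y => k y * f (x - z - y)) z]
    congr 1; ext y; congr 2; abel
  have hfx : MemLp (fun y => f (x - y)) 2 volume :=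
    (Lp.memLp f).comp_measurePreserving (measurePreserving_sub_left_plane x)
  have hkz : MemLp (fun y => k (y - z)) 2 volume :=
    (k.memLp 2 volume).comp_measurePreserving (measurePreserving_sub_right_plane z)
  have i1 : Integrable (fun y => k (y - z) * f (x - y)) volume := MemLp.integrable_mul hkz hfx
  rw [hx1, hx2, h2, ← integral_sub i1 (integrable_schwartz_mul k f x)]
  simp only [← sub_mul]
  refine (enorm_integral_le_lintegral_enorm _).trans ?_
  have h3 := eLpNorm_smul_le_mul_eLpNorm (p := 2) (q := 2) (r := 1) hfx.1
    (hkz.1.sub (k.memLp 2 volume).1)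
  rw [eLpNorm_one_eq_lintegral_enorm] at h3
  have h4 : eLpNorm (fun y => f (x - y)) 2 volume = eLpNorm f 2 volume :=
    eLpNorm_comp_measurePreserving (Lp.aestronglyMeasurable f) (measurePreserving_sub_left_plane x)
  refine h3.trans ?_
  rw [h4, mul_right_comm]
  refine mul_le_mul_left ?_ _
  rw [mul_comm]
  exact (eLpNorm_diff_le k 2 z).trans (mul_le_mul_right hk _)

open Filter Topology

/-! ### Vanishing of the flux at infinite frequency -/

theorem norm_sq_eq_integral (f : L2 ℂ) : ‖f‖ ^ 2 = ∫ x, ‖f x‖ ^ 2 := by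
  have h : (inner ℂ f f : ℂ) = ((∫ x, ‖f x‖ ^ 2 : ℝ) : ℂ) := by
    rw [L2.inner_def, ← integral_complex_ofReal]
    refine integral_congr_ae (ae_of_all _ fun x => ?_)
    simp [inner_self_eq_norm_sq_to_K]
  refine Complex.ofReal_injective ?_
  rw [← h, inner_self_eq_norm_sq_to_K]
  simp

/-- Multipliers with uniformly bounded symbols that converge pointwise converge strongly. -/
theorem tendsto_mult {s : ℕ → Plane → ℂ} (hs : ∀ n, MemLp (s n) ⊤ volume) {B : ℝ}
    (hB : ∀ n ξ, ‖s n ξ‖ ≤ B) {t : Plane → ℂ} (ht : MemLp t ⊤ volume)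
    (h : ∀ ξ, Tendsto (fun n => s n ξ) atTop (𝓝 (t ξ))) (f : L2 ℂ) :
    Tendsto (fun n => mult (s n) f) atTop (𝓝 (mult t f)) := by
  have hBt : ∀ ξ, ‖t ξ‖ ≤ B := fun ξ =>
    le_of_tendsto ((h ξ).norm) (Eventually.of_forall fun n => hB n ξ)
  set G := (𝓕 f : L2 ℂ)
  have h1 : ∀ n, ‖mult (s n) f - mult t f‖ ^ 2 = ∫ ξ, ‖(s n ξ - t ξ) * G ξ‖ ^ 2 := by
    intro n
    rw [← mult_sub_symbol (hs n) ht, ← Lp.norm_fourier_eq, norm_sq_eq_integral]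
    refine integral_congr_ae ?_
    filter_upwards [fourier_mult ((hs n).sub ht) f] with ξ hξ
    exact congrArg (fun z : ℂ => ‖z‖ ^ 2) hξ
  have hG : Integrable (fun ξ => ‖G ξ‖ ^ 2) volume := (Lp.memLp G).integrable_norm_pow two_ne_zero
  have h2 : Tendsto (fun n => ∫ ξ, ‖(s n ξ - t ξ) * G ξ‖ ^ 2) atTop (𝓝 (∫ _ : Plane, (0 : ℝ))) := by
    refine tendsto_integral_of_dominated_convergence (fun ξ => (2 * B) ^ 2 * ‖G ξ‖ ^ 2)
      (fun n => ?_) (hG.const_mul _) (fun n => ae_of_all _ fun ξ => ?_)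
      (ae_of_all _ fun ξ => ?_)
    · exact ((((hs n).1.sub ht.1).mul (Lp.aestronglyMeasurable G)).norm.pow 2)
    · rw [Real.norm_of_nonneg (by positivity), norm_mul, mul_pow]
      gcongr
      rw [two_mul]
      exact (norm_sub_le _ _).trans (add_le_add (hB n ξ) (hBt ξ))
    · have h3 := ((((h ξ).sub_const (t ξ)).mul_const (G ξ)).norm).pow 2
      simpa using h3
  rw [integral_zero] at h2
  simp only [← h1] at h2
  rw [tendsto_iff_norm_sub_tendsto_zero]
  have h4 := h2.sqrt
  simpa using h4

namespace IsCutoff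

variable {χ : SchwartzMap Plane ℂ}

theorem tendsto_low (hχ : IsCutoff χ) {a : ℝ} (ha : 0 < a) (f : L2 ℂ) :
    Tendsto (fun n : ℕ => mult (dil (a / 2 ^ n) χ) f) atTop (𝓝 f) := by
  have h := tendsto_mult (s := fun n : ℕ => dil (a / 2 ^ n) χ) (t := fun _ => 1)
    (fun n => (dil _ χ).memLp_top volume) (B := 1)
    (fun n ξ => hχ.dil_norm_le_one (by positivity) ξ) (memLp_top_const 1) (fun ξ => ?_) f
  · rwa [mult_one] at h
  · have h1 : Tendsto (fun n : ℕ => a / 2 ^ n) atTop (𝓝 0) := by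
      have := (tendsto_pow_atTop_nhds_zero_of_lt_one (r := (2⁻¹ : ℝ)) (by norm_num)
        (by norm_num)).const_mul a
      simpa [div_eq_mul_inv] using this
    have h2 : Tendsto (fun n : ℕ => χ ((a / 2 ^ n) • ξ)) atTop (𝓝 (χ ((0 : ℝ) • ξ))) :=
      ((χ.continuous.tendsto _).comp (h1.smul_const ξ))
    rw [zero_smul, hχ.apply_zero] at h2
    refine h2.congr fun n => ?_
    rw [dil_apply (by positivity)]

/-- If the symmetrised flux is bounded uniformly in the threshold, it vanishes as the threshold
tends to infinity. -/
theorem tendsto_flux_symm (hχ : IsCutoff χ) {a : ℝ} (ha : 0 < a) {H : Fin 2 → L2 ℂ}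
    (hH : FourierDivFree H) {u : L2 ℂ} {B : ℝ}
    (hB : ∀ (n : ℕ) (v : L2 ℂ),
      ‖flux χ (a / 2 ^ n) H v u + flux χ (a / 2 ^ n) H u v‖ ≤ B * ‖v‖) (w : L2 ℂ) :
    Tendsto (fun n : ℕ => flux χ (a / 2 ^ n) H w u + flux χ (a / 2 ^ n) H u w) atTop (𝓝 0) := by
  set S : ℕ → L2 ℂ → ℂ := fun n v => flux χ (a / 2 ^ n) H v u + flux χ (a / 2 ^ n) H u v with hS
  have hpos : ∀ n : ℕ, 0 < a / 2 ^ n := fun n => by positivity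
  have hlt : ∀ {n k : ℕ}, n < k → 4 * (a / 2 ^ k) < 3 * (a / 2 ^ n) := by
    intro n k hnk
    have h1 : (2 : ℝ) ^ (n + 1) ≤ 2 ^ k := pow_le_pow_right₀ (by norm_num) hnk
    have h2 : a / 2 ^ k ≤ a / 2 ^ (n + 1) := by gcongr
    have h3 : a / 2 ^ (n + 1) = a / 2 ^ n / 2 := by rw [pow_succ]; field_simp
    have := hpos n
    linarith
  -- the claim for a band-limited function
  have hband : ∀ M : ℕ, Tendsto (fun n => S n (mult (dil (a / 2 ^ M) χ) w)) atTop (𝓝 0) := by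
    intro M
    set v := mult (dil (a / 2 ^ M) χ) w with hv
    have h1 : ∀ n, M + 1 < n → S n v =
        ∑ j, triple (multTop (derivSymbol j (dil (a / 2 ^ (M + 1)) χ)) v)
          (u - mult (dil (a / 2 ^ n) χ) u) (H j) := by
      intro n hn
      have h2 := hH.sum_triple_add (dil (a / 2 ^ n) χ) (dil (a / 2 ^ n) χ) u v
      have h3 : mult (dil (a / 2 ^ n) χ) v = v :=
        hχ.low_low (hpos M) (hpos n) (hlt (by lia)) w
      have h4 : ∀ j, multTop (derivSymbol j (dil (a / 2 ^ n) χ)) v =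
          multTop (derivSymbol j (dil (a / 2 ^ (M + 1)) χ)) v := fun j => by
        refine multTop_congr ?_
        rw [hv, hχ.deriv_low (hpos M) (hpos n) (hlt (by lia)),
          hχ.deriv_low (hpos M) (hpos (M + 1)) (hlt (by lia))]
      simp only [h3, h4, Finset.sum_add_distrib] at h2
      simp only [hS, flux, h4, map_sub, _root_.sub_apply, Finset.sum_sub_distrib]
      linear_combination h2
    have h5 : Tendsto (fun n : ℕ => u - mult (dil (a / 2 ^ n) χ) u) atTop (𝓝 0) := by
      simpa using (tendsto_const_nhds (x := u)).sub (hχ.tendsto_low ha u)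
    have h6 : Tendsto (fun n : ℕ => ∑ j,
        triple (multTop (derivSymbol j (dil (a / 2 ^ (M + 1)) χ)) v)
          (u - mult (dil (a / 2 ^ n) χ) u) (H j)) atTop (𝓝 0) := by
      have : Continuous fun x : L2 ℂ => ∑ j,
          triple (multTop (derivSymbol j (dil (a / 2 ^ (M + 1)) χ)) v) x (H j) :=
        continuous_finsetSum _ fun j _ => ((triple _).continuous.clm_apply continuous_const)
      have h7 := (this.tendsto 0).comp h5
      simp only [map_zero, _root_.zero_apply, Finset.sum_const_zero] at h7
      exact h7
    refine h6.congr' ?_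
    filter_upwards [eventually_gt_atTop (M + 1)] with n hn
    exact (h1 n hn).symm
  have hsplit : ∀ (n : ℕ) (v : L2 ℂ), S n w = S n (w - v) + S n v := by
    intro n v
    simp only [hS, flux_sub_left, flux_sub_right]; ring
  rw [Metric.tendsto_atTop]
  intro ε hε
  have hw0 : Tendsto (fun M : ℕ => B * ‖w - mult (dil (a / 2 ^ M) χ) w‖) atTop (𝓝 0) := by
    have h5 : Tendsto (fun n : ℕ => w - mult (dil (a / 2 ^ n) χ) w) atTop (𝓝 0) := by
      simpa using (tendsto_const_nhds (x := w)).sub (hχ.tendsto_low ha w)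
    simpa using h5.norm.const_mul B
  obtain ⟨M, hM⟩ := (hw0.eventually (gt_mem_nhds (half_pos hε))).exists
  obtain ⟨N, hN⟩ := (Metric.tendsto_atTop.1 (hband M)) (ε / 2) (half_pos hε)
  refine ⟨N, fun n hn => ?_⟩
  have h1 := hN n hn
  rw [dist_zero_right] at h1 ⊢
  change ‖S n w‖ < ε
  rw [hsplit n (mult (dil (a / 2 ^ M) χ) w)]
  exact (norm_add_le _ _).trans_lt (by linarith [hB n (w - mult (dil (a / 2 ^ M) χ) w)])

/-- The fluxes through thresholds beyond `1 / a` are controlled by the part of `g` above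
`1 / a`. -/
theorem two_mul_flux_eq (hχ : IsCutoff χ) {a b : ℝ} (ha : 0 < a) (hb : 0 < b)
    (hab : 4 * b < 3 * a) {H : Fin 2 → L2 ℂ} (hH : FourierDivFree H) (g : L2 ℂ) :
    2 * flux χ b H g g =
      flux χ b H (g - mult (dil a χ) g) (mult (dil a χ) g + g) +
      flux χ b H (mult (dil a χ) g + g) (g - mult (dil a χ) g) := by
  have h0 : flux χ b H (mult (dil a χ) g) (mult (dil a χ) g) = 0 :=
    hH.flux_self (hχ.low_low ha hb hab g)
  simp only [flux_sub_left, flux_sub_right, flux_add_left, flux_add_right, h0]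
  ring

/-- A bound, uniform in the threshold, for the symmetrised flux of a field that is the sum of a
rough and a smooth part. -/
theorem enorm_flux_symm_le (hχ : IsCutoff χ) {b : ℝ} (hb : 0 < b) (H' H'' : Fin 2 → L2 ℂ)
    (u v : L2 ℂ) {p m : ℝ≥0∞} (h : p⁻¹ + 2⁻¹ + m⁻¹ = 1) :
    ‖flux χ b (fun j => H' j + H'' j) v u + flux χ b (fun j => H' j + H'' j) u v‖ₑ ≤
      cutoffConst χ * ((∑ j, diffNorm (H' j) m) * eLpNorm u p volume +
        (∑ j, diffNorm (H'' j) ⊤) * eLpNorm u 2 volume) * eLpNorm v 2 volume := by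
  have h1 := hχ.enorm_flux_add_flux_le hb H' u v h
  have h2 := hχ.enorm_flux_add_flux_le hb H'' u v (p := 2) (r := 2) (m := ⊤) (by
    rw [ENNReal.inv_top, add_zero, ENNReal.inv_two_add_inv_two])
  have h3 : flux χ b (fun j => H' j + H'' j) v u + flux χ b (fun j => H' j + H'' j) u v =
      (flux χ b H' v u + flux χ b H' u v) + (flux χ b H'' v u + flux χ b H'' u v) := by
    rw [flux_add_field, flux_add_field]; ring
  rw [h3]
  refine (enorm_add_le _ _).trans ((add_le_add h1 h2).trans_eq ?_)
  ring

/-- The flux of a fixed function vanishes as the threshold tends to infinity. The upper bound in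
`hfin` only serves to express that the norms in it are finite. -/
theorem tendsto_flux_self (hχ : IsCutoff χ) {a : ℝ} (ha : 0 < a) {H' H'' : Fin 2 → L2 ℂ}
    (hH : FourierDivFree fun j => H' j + H'' j) (g : L2 ℂ) {p m : ℝ≥0∞}
    (h : p⁻¹ + 2⁻¹ + m⁻¹ = 1)
    (hfin : cutoffConst χ * ((∑ j, diffNorm (H' j) m) *
          eLpNorm (mult (dil a χ) g + g : L2 ℂ) p volume +
        (∑ j, diffNorm (H'' j) ⊤) * eLpNorm (mult (dil a χ) g + g : L2 ℂ) 2 volume) ≠ ⊤) :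
    Tendsto (fun n : ℕ => flux χ (a / 2 ^ n) (fun j => H' j + H'' j) g g) atTop (𝓝 0) := by
  set X := cutoffConst χ * ((∑ j, diffNorm (H' j) m) *
      eLpNorm (mult (dil a χ) g + g : L2 ℂ) p volume +
    (∑ j, diffNorm (H'' j) ⊤) * eLpNorm (mult (dil a χ) g + g : L2 ℂ) 2 volume)
  have h1 := hχ.tendsto_flux_symm ha hH (u := mult (dil a χ) g + g) (B := ENNReal.toReal X)
    (fun n v => ?_) (g - mult (dil a χ) g)
  rotate_left
  · have h2 := hχ.enorm_flux_symm_le (b := a / 2 ^ n) (by positivity) H' H''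
      (mult (dil a χ) g + g) v h
    rw [eLpNorm_two_eq v] at h2
    have h3 := ENNReal.toReal_mono (ENNReal.mul_ne_top hfin enorm_ne_top) h2
    rwa [toReal_enorm, ENNReal.toReal_mul, toReal_enorm] at h3
  have h4 := h1.const_mul (2⁻¹ : ℂ)
  rw [mul_zero] at h4
  refine h4.congr' ?_
  filter_upwards [eventually_gt_atTop 0] with n hn
  have h5 : (2 : ℝ) ≤ 2 ^ n := by
    calc (2 : ℝ) = 2 ^ 1 := by norm_num
      _ ≤ 2 ^ n := pow_le_pow_right₀ (by norm_num) hn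
  have h6 : a / 2 ^ n ≤ a / 2 := by gcongr
  rw [← hχ.two_mul_flux_eq ha (by positivity) (by linarith) hH g]
  ring

end IsCutoff

/-! ### The product rule for primitives of integrable functions -/

section productRule

variable {E : Type*} [NormedAddCommGroup E] [NormedSpace ℝ E]

theorem absolutelyContinuousOnInterval_of_dist_le {X : Type*} [PseudoMetricSpace X] {f : ℝ → X}
    {R : ℝ → ℝ} {a b C : ℝ} (hR : AbsolutelyContinuousOnInterval R a b)
    (h : ∀ s t, dist (f s) (f t) ≤ C * dist (R s) (R t)) :
    AbsolutelyContinuousOnInterval f a b := by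
  have h1 := Tendsto.const_mul C hR
  rw [mul_zero] at h1
  refine squeeze_zero (fun E => Finset.sum_nonneg fun _ _ => dist_nonneg) (fun E => ?_) h1
  rw [Finset.mul_sum]
  exact Finset.sum_le_sum fun i _ => h _ _

/-- The product rule for the primitive of a Bochner integrable function. -/
theorem bilin_primitive_eq [CompleteSpace E] {r : ℝ → E} (hr : Integrable r volume) (v₀ : E)
    (B : E →L[ℝ] E →L[ℝ] ℝ) (hB : ∀ x y, B x y = B y x) {v : ℝ → E}
    (hv : ∀ t, v t = v₀ + ∫ τ in (0 : ℝ)..t, r τ) (t : ℝ) :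
    B (v t) (v t) = B v₀ v₀ + ∫ τ in (0 : ℝ)..t, 2 * B (r τ) (v τ) := by
  have hsub : ∀ s t, v t - v s = ∫ τ in s..t, r τ := by
    intro s t
    rw [hv, hv, add_sub_add_left_eq_sub,
      intervalIntegral.integral_interval_sub_left hr.intervalIntegrable hr.intervalIntegrable]
  set M := ‖v₀‖ + ∫ τ, ‖r τ‖ with hM
  have hM0 : 0 ≤ M := by positivity
  have hvM : ∀ t, ‖v t‖ ≤ M := by
    intro t
    rw [hv]
    refine (norm_add_le _ _).trans (add_le_add le_rfl ?_)
    refine (intervalIntegral.norm_integral_le_integral_norm_uIoc).trans ?_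
    exact setIntegral_le_integral hr.norm (ae_of_all _ fun _ => norm_nonneg _)
  have hder : ∀ᵐ t, HasDerivAt v (r t) t := by
    filter_upwards [LocallyIntegrable.ae_hasDerivAt_integral hr.locallyIntegrable] with t ht
    have h1 := (ht 0).const_add v₀
    have h2 : v = fun t => v₀ + ∫ τ in (0 : ℝ)..t, r τ := funext hv
    rwa [h2]
  have hcont : Continuous v := by
    have h2 : v = fun t => v₀ + ∫ τ in (0 : ℝ)..t, r τ := funext hv
    rw [h2]
    exact continuous_const.add (intervalIntegral.continuous_primitive
      (fun a b => hr.intervalIntegrable) 0)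
  set q : ℝ → ℝ := fun τ => 2 * B (r τ) (v τ) with hq
  have hqint : Integrable q volume := by
    refine Integrable.mono' (hr.norm.const_mul (2 * ‖B‖ * M)) ?_ (ae_of_all _ fun τ => ?_)
    · have h1 : AEStronglyMeasurable (fun τ => B (r τ)) volume :=
        B.continuous.comp_aestronglyMeasurable hr.1
      have h2 : AEStronglyMeasurable (fun τ => B (r τ) (v τ)) volume :=
        (ContinuousLinearMap.apply ℝ ℝ (E := E)).flip.aestronglyMeasurable_comp₂
          h1 hcont.aestronglyMeasurable
      exact h2.const_mul 2
    · rw [hq, norm_mul, Real.norm_ofNat]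
      have h1 := B.le_opNorm₂ (r τ) (v τ)
      have h2 : ‖B‖ * ‖r τ‖ * ‖v τ‖ ≤ ‖B‖ * ‖r τ‖ * M := by gcongr; exact hvM τ
      linarith
  set Φ : ℝ → ℝ := fun t => B (v t) (v t) - ∫ τ in (0 : ℝ)..t, q τ with hΦ
  have hac : AbsolutelyContinuousOnInterval Φ 0 t := by
    have hRac := (hr.norm.intervalIntegrable (a := 0) (b := t)
      ).absolutelyContinuousOnInterval_intervalIntegral (c := 0) (by simp)
    refine absolutelyContinuousOnInterval_of_dist_le (C := 4 * ‖B‖ * M) hRac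
      fun s t => ?_
    have hRst : dist (∫ τ in (0 : ℝ)..s, ‖r τ‖) (∫ τ in (0 : ℝ)..t, ‖r τ‖) =
        |∫ τ in t..s, ‖r τ‖| := by
      rw [Real.dist_eq, intervalIntegral.integral_interval_sub_left hr.norm.intervalIntegrable
        hr.norm.intervalIntegrable]
    rw [hRst, Real.dist_eq, hΦ]
    have h1 : B (v s) (v s) - (∫ τ in (0 : ℝ)..s, q τ) -
        (B (v t) (v t) - ∫ τ in (0 : ℝ)..t, q τ) =
        B (v s - v t) (v s + v t) - ∫ τ in t..s, q τ := by
      rw [← intervalIntegral.integral_interval_sub_left (a := 0) (b := s) (c := t)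
        hqint.intervalIntegrable hqint.intervalIntegrable]
      simp only [map_sub, map_add, _root_.sub_apply]
      rw [hB (v t) (v s)]
      ring
    rw [h1]
    have h2 : ‖v s - v t‖ ≤ |∫ τ in t..s, ‖r τ‖| := by
      rw [hsub]; exact intervalIntegral.norm_integral_le_abs_integral_norm
    have h3 : |B (v s - v t) (v s + v t)| ≤ ‖B‖ * |∫ τ in t..s, ‖r τ‖| * (M + M) := by
      refine (B.le_opNorm₂ _ _).trans ?_
      gcongr
      exact (norm_add_le _ _).trans (add_le_add (hvM s) (hvM t))
    have h4 : |∫ τ in t..s, q τ| ≤ 2 * ‖B‖ * M * |∫ τ in t..s, ‖r τ‖| := by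
      have h5 := intervalIntegral.norm_integral_le_abs_of_norm_le (a := t) (b := s)
        (μ := volume) (f := q) (g := fun τ => 2 * ‖B‖ * M * ‖r τ‖) (ae_of_all _ fun τ => ?_)
        (hr.norm.const_mul _).intervalIntegrable
      · rw [intervalIntegral.integral_const_mul (2 * ‖B‖ * M), abs_mul,
          abs_of_nonneg (a := 2 * ‖B‖ * M) (by positivity)] at h5
        exact h5
      · rw [hq, norm_mul, Real.norm_ofNat]
        have h1 := B.le_opNorm₂ (r τ) (v τ)
        have h2 : ‖B‖ * ‖r τ‖ * ‖v τ‖ ≤ ‖B‖ * ‖r τ‖ * M := by gcongr; exact hvM τ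
        linarith
    refine (abs_sub _ _).trans ?_
    linarith
  have hΦ' : ∀ᵐ x, HasDerivAt Φ 0 x := by
    filter_upwards [hder, LocallyIntegrable.ae_hasDerivAt_integral hqint.locallyIntegrable] with x h1 h2
    have h3 : HasDerivAt (fun x => B (v x) (v x)) (B (v x) (r x) + B (r x) (v x)) x :=
      B.hasDerivAt_of_bilinear (fun _ => h1) fun _ => h1
    have h4 := h3.sub (h2 0)
    have h5 : B (v x) (r x) + B (r x) (v x) - q x = 0 := by
      rw [hB (v x) (r x), hq]; ring
    rwa [h5] at h4
  obtain ⟨C, hC⟩ := hac.const_of_ae_hasDerivAt_zero (hΦ'.mono fun x hx _ => hx)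
  have h0 : Φ 0 = C := hC 0 (by simp)
  have ht' : Φ t = C := hC t (by simp)
  have hv0 : v 0 = v₀ := by rw [hv]; simp
  have h6 : Φ t = Φ 0 := ht'.trans h0.symm
  simp only [hΦ, intervalIntegral.integral_same, sub_zero, hv0] at h6
  linarith

end productRule

/-! ### Lower semicontinuity of norms -/

section semicontinuity

variable {V : Type*} [NormedAddCommGroup V]

theorem exists_subseq_ae_tendsto {f : ℕ → L2 V} {g : L2 V} (h : Tendsto f atTop (𝓝 g)) :
    ∃ ns : ℕ → ℕ, StrictMono ns ∧
      ∀ᵐ x, Tendsto (fun i => f (ns i) x) atTop (𝓝 (g x)) := by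
  have h1 := tendstoInMeasure_of_tendsto_Lp h
  exact h1.exists_seq_tendsto_ae

/-- Convergent sequences in `L²` have subsequences that converge almost everywhere, so that
functionals obeying Fatou's lemma are lower semicontinuous. -/
theorem lowerSemicontinuous_of_ae_subseq {Φ : L2 V → ℝ≥0∞}
    (h : ∀ (f : ℕ → L2 V) (g : L2 V) (c : ℝ≥0∞), (∀ n, Φ (f n) ≤ c) →
      (∀ᵐ x, Tendsto (fun i => f i x) atTop (𝓝 (g x))) → Φ g ≤ c) :
    LowerSemicontinuous Φ := by
  rw [lowerSemicontinuous_iff_isClosed_preimage]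
  intro c
  refine IsSeqClosed.isClosed fun f g hf hg => ?_
  obtain ⟨ns, -, hns⟩ := exists_subseq_ae_tendsto hg
  exact h (fun i => f (ns i)) g c (fun n => hf (ns n)) hns

theorem lowerSemicontinuous_eLpNorm (p : ℝ≥0∞) :
    LowerSemicontinuous fun f : L2 V => eLpNorm f p volume := by
  refine lowerSemicontinuous_of_ae_subseq fun f g c hf hg => ?_
  refine (Lp.eLpNorm_lim_le_liminf_eLpNorm (fun n => Lp.aestronglyMeasurable (f n)) g hg).trans ?_
  exact (liminf_le_liminf (Eventually.of_forall hf)).trans (by simp)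

theorem lowerSemicontinuous_diffNorm (p : ℝ≥0∞) :
    LowerSemicontinuous fun f : L2 V => diffNorm f p := by
  refine lowerSemicontinuous_of_ae_subseq fun f g c hf hg => iSup_le fun z => ?_
  rcases eq_or_ne z 0 with rfl | hz
  · have : (fun x : Plane => g (x - 0) - g x) = fun _ => 0 := by ext x; simp
    rw [this, eLpNorm_zero', ENNReal.zero_div]
    exact zero_le
  rw [ENNReal.div_le_iff (by simpa using hz) enorm_ne_top]
  have hgz : ∀ᵐ x, Tendsto (fun i => f i (x - z)) atTop (𝓝 (g (x - z))) :=
    (measurePreserving_sub_right_plane z).quasiMeasurePreserving.ae hg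
  refine (Lp.eLpNorm_lim_le_liminf_eLpNorm (f := fun n x => f n (x - z) - f n x)
    (fun n => ((Lp.aestronglyMeasurable (f n)).comp_measurePreserving
      (measurePreserving_sub_right_plane z)).sub (Lp.aestronglyMeasurable (f n)))
    (fun x => g (x - z) - g x) (hg.mp (hgz.mono fun x h1 h2 => h1.sub h2))).trans ?_
  refine (liminf_le_liminf (v := fun _ => c * ‖z‖ₑ) (Eventually.of_forall fun n => ?_)).trans
    (by simp)
  refine (eLpNorm_diff_le (f n) p z).trans ?_
  rw [mul_comm]
  exact mul_le_mul_left (hf n) _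

theorem AEMeasurable.of_lowerSemicontinuous {α : Type*} [MeasurableSpace α] {μ : Measure α}
    {Φ : L2 V → ℝ≥0∞} (hΦ : LowerSemicontinuous Φ) {f : α → L2 V} (hf : AEStronglyMeasurable f μ) :
    AEMeasurable (fun τ => Φ (f τ)) μ := by
  borelize (L2 V)
  exact hΦ.measurable.comp_aemeasurable hf.aemeasurable

end semicontinuity

/-! ### Components of real and complex fields -/

/-- The inclusion of the real into the complex square integrable functions. -/
def toComplex : L2 ℝ →L[ℝ] L2 ℂ := Complex.ofRealCLM.compLpL 2 volume

/-- The `j`-th component of a real vector field, as a complex valued function. -/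
def fieldComp (j : Fin 2) : L2 Plane →L[ℝ] L2 ℂ :=
  (Complex.ofRealCLM ∘L (EuclideanSpace.proj j : Plane →L[ℝ] ℝ)).compLpL 2 volume

/-- The `j`-th component of a complex vector field. -/
def complexComp (j : Fin 2) : L2 CPlane →L[ℂ] L2 ℂ :=
  (EuclideanSpace.proj j : CPlane →L[ℂ] ℂ).compLpL 2 volume

theorem coeFn_toComplex (f : L2 ℝ) : toComplex f =ᵐ[volume] fun x => ((f x : ℝ) : ℂ) :=
  ContinuousLinearMap.coeFn_compLpL _ f

theorem coeFn_fieldComp (j : Fin 2) (h : L2 Plane) :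
    fieldComp j h =ᵐ[volume] fun x => ((h x j : ℝ) : ℂ) :=
  ContinuousLinearMap.coeFn_compLpL _ h

theorem coeFn_complexComp (j : Fin 2) (H : L2 CPlane) :
    complexComp j H =ᵐ[volume] fun x => H x j :=
  ContinuousLinearMap.coeFn_compLpL _ H

theorem complexComp_complexifyField (j : Fin 2) (h : L2 Plane) :
    complexComp j (complexifyField h) = fieldComp j h := by
  refine Lp.ext ?_
  have h1 : complexifyField h =ᵐ[volume] fun x => planeToComplex (h x) :=
    ContinuousLinearMap.coeFn_compLp _ h
  filter_upwards [coeFn_complexComp j (complexifyField h), coeFn_fieldComp j h, h1] with x h2 h3 h4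
  rw [h2, h3, h4]; rfl

theorem eLpNorm_toComplex (f : L2 ℝ) (p : ℝ≥0∞) :
    eLpNorm (toComplex f) p volume = eLpNorm f p volume := by
  rw [eLpNorm_congr_ae (coeFn_toComplex f)]
  exact eLpNorm_congr_norm_ae (ae_of_all _ fun x => Complex.norm_real _)

theorem fourier_complexComp (j : Fin 2) (H : L2 CPlane) :
    (𝓕 (complexComp j H) : L2 ℂ) = complexComp j (𝓕 H) := by
  have cF : Continuous fun f : L2 ℂ => (𝓕 f : L2 ℂ) := (Lp.fourierTransformₗᵢ Plane ℂ).continuous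
  have cG : Continuous fun f : L2 CPlane => (𝓕 f : L2 CPlane) :=
    (Lp.fourierTransformₗᵢ Plane CPlane).continuous
  have hd : DenseRange (fun f : SchwartzMap Plane CPlane => f.toLp 2 volume) :=
    SchwartzMap.denseRange_toLpCLM (p := 2) ENNReal.ofNat_ne_top
  refine hd.induction_on (p := fun H : L2 CPlane =>
    (𝓕 (complexComp j H) : L2 ℂ) = complexComp j (𝓕 H)) H ?_ fun f => ?_
  · exact isClosed_eq (cF.comp (complexComp j).continuous) ((complexComp j).continuous.comp cG)
  set L : CPlane →L[ℂ] ℂ := EuclideanSpace.proj j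
  have hcomp : ∀ f : SchwartzMap Plane CPlane,
      complexComp j (f.toLp 2 volume) = (f.postcompCLM L).toLp 2 volume := by
    intro f
    refine Lp.ext ?_
    filter_upwards [coeFn_complexComp j (f.toLp 2 volume), f.coeFn_toLp 2 volume,
      (f.postcompCLM L).coeFn_toLp 2 volume] with x h1 h2 h3
    rw [h1, h2, h3]; rfl
  rw [hcomp, SchwartzMap.toLp_fourier_eq, SchwartzMap.toLp_fourier_eq, hcomp]
  congr 1
  ext ξ
  rw [SchwartzMap.postcompCLM_apply, SchwartzMap.fourier_coe, SchwartzMap.fourier_coe,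
    Real.fourier_eq, Real.fourier_eq, ← ContinuousLinearMap.integral_comp_comm]
  · refine integral_congr_ae (ae_of_all _ fun x => ?_)
    simp only [SchwartzMap.postcompCLM_apply, Circle.smul_def, map_smul]
  · simpa using (Real.fourierIntegral_convergent_iff ξ).2 (f.integrable (μ := volume))

/-- Pointwise form of the definition of `fourierMul`, for bounded symbols. -/
theorem fourier_fourierMul {V : Type*} [NormedAddCommGroup V] [InnerProductSpace ℂ V]
    [CompleteSpace V] {σ : Plane → ℝ} (hσ : Measurable σ) {B : ℝ} (hB : ∀ ξ, |σ ξ| ≤ B) (f : L2 V) :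
    (𝓕 (fourierMul σ f) : L2 V) =ᵐ[volume]
      fun ξ => ((σ ((2 * Real.pi) • ξ) : ℝ) : ℂ) • (𝓕 f : L2 V) ξ := by
  have hf := memLp_symbol_smul hσ hB f
  have h1 : (𝓕 (fourierMul σ f) : L2 V) = hf.toLp _ := by
    rw [fourierMul, dif_pos hf]
    exact (Lp.fourierTransformₗᵢ Plane V).apply_symm_apply _
  rw [h1]
  exact hf.coeFn_toLp

theorem memLp_top_symbol {σ : Plane → ℝ} (hσ : Measurable σ) {B : ℝ} (hB : ∀ ξ, |σ ξ| ≤ B) :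
    MemLp (fun ξ : Plane => ((σ ((2 * Real.pi) • ξ) : ℝ) : ℂ)) ⊤ volume := by
  have h1 : Measurable fun ξ : Plane => ((σ ((2 * Real.pi) • ξ) : ℝ) : ℂ) := by fun_prop
  refine memLp_top_of_bound h1.aestronglyMeasurable B (ae_of_all _ fun ξ => ?_)
  rw [Complex.norm_real, Real.norm_eq_abs]
  exact hB _

theorem fourierMul_eq_mult {σ : Plane → ℝ} (hσ : Measurable σ) {B : ℝ} (hB : ∀ ξ, |σ ξ| ≤ B)
    (f : L2 ℂ) : fourierMul σ f = mult (fun ξ => ((σ ((2 * Real.pi) • ξ) : ℝ) : ℂ)) f :=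
  (mult_eq_of_fourier (memLp_top_symbol hσ hB) (fourier_fourierMul hσ hB f)).symm

theorem complexComp_fourierMul {σ : Plane → ℝ} (hσ : Measurable σ) {B : ℝ} (hB : ∀ ξ, |σ ξ| ≤ B)
    (j : Fin 2) (H : L2 CPlane) : complexComp j (fourierMul σ H) =
      mult (fun ξ => ((σ ((2 * Real.pi) • ξ) : ℝ) : ℂ)) (complexComp j H) := by
  refine (mult_eq_of_fourier (memLp_top_symbol hσ hB) ?_).symm
  rw [fourier_complexComp, fourier_complexComp]
  filter_upwards [fourier_fourierMul hσ hB H, coeFn_complexComp j (𝓕 (fourierMul σ H)),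
    coeFn_complexComp j (𝓕 H)] with ξ h1 h2 h3
  rw [h2, h1, h3]; rfl

theorem diffNorm_mono {V W : Type*} [NormedAddCommGroup V] [NormedAddCommGroup W] {f : Plane → V}
    {g : Plane → W} (h : ∀ z, ∀ᵐ x, ‖f (x - z) - f x‖ ≤ ‖g (x - z) - g x‖) (p : ℝ≥0∞) :
    diffNorm f p ≤ diffNorm g p :=
  iSup_mono fun z => ENNReal.div_le_div_right (eLpNorm_mono_ae (h z)) _

theorem diffNorm_fieldComp_le (j : Fin 2) (h : L2 Plane) (p : ℝ≥0∞) :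
    diffNorm (fieldComp j h) p ≤ diffNorm h p := by
  refine diffNorm_mono (fun z => ?_) p
  filter_upwards [coeFn_fieldComp j h, (measurePreserving_sub_right_plane
    z).quasiMeasurePreserving.ae (coeFn_fieldComp j h)] with x h1 h2
  rw [h1, h2, ← Complex.ofReal_sub, Complex.norm_real, ← PiLp.sub_apply]
  exact PiLp.norm_apply_le _ j

theorem diffNorm_complexComp_le (j : Fin 2) (H : L2 CPlane) (p : ℝ≥0∞) :
    diffNorm (complexComp j H) p ≤ diffNorm H p := by
  refine diffNorm_mono (fun z => ?_) p
  filter_upwards [coeFn_complexComp j H, (measurePreserving_sub_right_plane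
    z).quasiMeasurePreserving.ae (coeFn_complexComp j H)] with x h1 h2
  rw [h1, h2, ← PiLp.sub_apply]
  exact PiLp.norm_apply_le _ j

theorem diffNorm_fieldComp_le_gradNorm (j : Fin 2) (h : L2 Plane) {p : ℝ≥0∞} (hp : 1 ≤ p) :
    diffNorm (fieldComp j h) p ≤ gradNorm h p :=
  (diffNorm_fieldComp_le j h p).trans
    (diffNorm_le_gradNorm ((Lp.memLp h).locallyIntegrable one_le_two) hp)

theorem diffNorm_complexComp_le_gradNorm (j : Fin 2) (H : L2 CPlane) {p : ℝ≥0∞} (hp : 1 ≤ p) :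
    diffNorm (complexComp j H) p ≤ gradNorm H p :=
  (diffNorm_complexComp_le j H p).trans
    (diffNorm_le_gradNorm ((Lp.memLp H).locallyIntegrable one_le_two) hp)

/-! ### Weak solutions tested with Schwartz functions -/

/-- A real smooth compactly supported function, as a complex valued Schwartz function. -/
def IsTestFunction.toSchwartz {φ : Plane → ℝ} (hφ : IsTestFunction φ) : SchwartzMap Plane ℂ :=
  (hφ.2.comp_left (g := fun x : ℝ => (x : ℂ)) rfl).toSchwartzMap
    (Complex.ofRealCLM.contDiff.comp hφ.1)

theorem IsTestFunction.toSchwartz_apply {φ : Plane → ℝ} (hφ : IsTestFunction φ) (x : Plane) :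
    hφ.toSchwartz x = φ x := rfl

theorem IsTestFunction.lineDeriv_toSchwartz {φ : Plane → ℝ} (hφ : IsTestFunction φ) (e x : Plane) :
    (∂_{e} hφ.toSchwartz : SchwartzMap Plane ℂ) x = (fderiv ℝ φ x e : ℝ) := by
  rw [SchwartzMap.lineDerivOp_apply_eq_fderiv]
  have h1 : HasFDerivAt φ (fderiv ℝ φ x) x :=
    (hφ.1.differentiable (by simp)).differentiableAt.hasFDerivAt
  have h2 : HasFDerivAt hφ.toSchwartz (Complex.ofRealCLM ∘L fderiv ℝ φ x) x :=
    Complex.ofRealCLM.hasFDerivAt.comp x h1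
  rw [h2.fderiv]; rfl

theorem fderiv_apply_eq_sum (φ : Plane → ℝ) (x v : Plane) :
    fderiv ℝ φ x v = ∑ j, fderiv ℝ φ x (basisVec j) * v j := by
  have h : v = ∑ j, v j • basisVec j := by
    ext i
    fin_cases i <;> simp [basisVec]
  conv_lhs => rw [h]
  simp only [map_sum, map_smul, smul_eq_mul, mul_comm]

section cutoff

variable {χ : SchwartzMap Plane ℂ}

/-- The cutoff at spatial scale `n + 1`. -/
def spatialCutoff (χ : SchwartzMap Plane ℂ) (n : ℕ) : SchwartzMap Plane ℂ := dil (1 / ((n : ℝ) + 1)) χ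

theorem IsCutoff.hasCompactSupport_spatialCutoff_mul (hχ : IsCutoff χ) (n : ℕ)
    (f : SchwartzMap Plane ℂ) : HasCompactSupport (schwartzMul (spatialCutoff χ n) f) := by
  refine HasCompactSupport.intro (isCompact_closedBall (0 : Plane) (4 / 3 * (n + 1))) fun x hx => ?_
  rw [schwartzMul_apply, spatialCutoff, hχ.dil_eq_zero (by positivity), zero_mul]
  rw [mem_closedBall_zero_iff, not_le] at hx
  rw [one_div, ← div_eq_inv_mul, lt_div_iff₀ (by positivity)]
  exact hx

theorem tendsto_one_div_smul (x : Plane) :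
    Tendsto (fun n : ℕ => (1 / ((n : ℝ) + 1)) • x) atTop (𝓝 0) := by
  simpa using (tendsto_one_div_add_atTop_nhds_zero_nat (𝕜 := ℝ)).smul_const x

theorem IsCutoff.tendsto_spatialCutoff (hχ : IsCutoff χ) (x : Plane) :
    Tendsto (fun n => spatialCutoff χ n x) atTop (𝓝 1) := by
  have h := (χ.continuous.tendsto 0).comp (tendsto_one_div_smul x)
  rw [hχ.apply_zero] at h
  refine h.congr fun n => ?_
  rw [spatialCutoff, dil_apply (by positivity)]; rfl

theorem lineDeriv_dil {a : ℝ} (ha : a ≠ 0) (s : SchwartzMap Plane ℂ) (e x : Plane) :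
    (∂_{e} (dil a s) : SchwartzMap Plane ℂ) x = a • (∂_{e} s : SchwartzMap Plane ℂ) (a • x) := by
  rw [SchwartzMap.lineDerivOp_apply_eq_fderiv, SchwartzMap.lineDerivOp_apply_eq_fderiv]
  have h : (dil a s : Plane → ℂ) = fun x => s (a • x) := funext (dil_apply ha s)
  rw [h, fderiv_comp_smul]; rfl

theorem exists_norm_le (f : SchwartzMap Plane ℂ) : ∃ C, 0 ≤ C ∧ ∀ x, ‖f x‖ ≤ C :=
  ⟨SchwartzMap.seminorm ℝ 0 0 f, apply_nonneg _ _, fun x => f.norm_le_seminorm ℝ x⟩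

theorem norm_lineDeriv_spatialCutoff_le (n : ℕ) (e x : Plane) {C : ℝ}
    (hC : ∀ x, ‖(∂_{e} χ : SchwartzMap Plane ℂ) x‖ ≤ C) :
    ‖(∂_{e} (spatialCutoff χ n) : SchwartzMap Plane ℂ) x‖ ≤ 1 / ((n : ℝ) + 1) * C := by
  rw [spatialCutoff, lineDeriv_dil (by positivity), norm_smul, Real.norm_of_nonneg (by positivity)]
  exact mul_le_mul_of_nonneg_left (hC _) (by positivity)

theorem tendsto_lineDeriv_spatialCutoff (e x : Plane) :
    Tendsto (fun n => (∂_{e} (spatialCutoff χ n) : SchwartzMap Plane ℂ) x) atTop (𝓝 0) := by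
  obtain ⟨C, -, hC⟩ := exists_norm_le (∂_{e} χ)
  refine squeeze_zero_norm (fun n => norm_lineDeriv_spatialCutoff_le n e x hC) ?_
  simpa using (tendsto_one_div_add_atTop_nhds_zero_nat (𝕜 := ℝ)).mul_const C

theorem IsCutoff.norm_spatialCutoff_le (hχ : IsCutoff χ) (n : ℕ) (x : Plane) :
    ‖spatialCutoff χ n x‖ ≤ 1 := hχ.dil_norm_le_one (by positivity) x

theorem IsCutoff.tendsto_lineDeriv_cutoff_mul (hχ : IsCutoff χ) (f : SchwartzMap Plane ℂ)
    (e x : Plane) :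
    Tendsto (fun n => (∂_{e} (schwartzMul (spatialCutoff χ n) f) : SchwartzMap Plane ℂ) x) atTop
      (𝓝 ((∂_{e} f : SchwartzMap Plane ℂ) x)) := by
  have h := ((tendsto_lineDeriv_spatialCutoff (χ := χ) e x).mul_const (f x)).add
    ((hχ.tendsto_spatialCutoff x).const_mul ((∂_{e} f : SchwartzMap Plane ℂ) x))
  rw [zero_mul, mul_one, zero_add] at h
  refine h.congr fun n => ?_
  rw [lineDeriv_schwartzMul, _root_.add_apply, schwartzMul_apply, schwartzMul_apply]

theorem IsCutoff.norm_lineDeriv_cutoff_mul_le (hχ : IsCutoff χ) (f : SchwartzMap Plane ℂ)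
    (e : Plane) : ∃ C, 0 ≤ C ∧ ∀ n x,
      ‖(∂_{e} (schwartzMul (spatialCutoff χ n) f) : SchwartzMap Plane ℂ) x‖ ≤
        C * ‖f x‖ + ‖(∂_{e} f : SchwartzMap Plane ℂ) x‖ := by
  obtain ⟨C, hC0, hC⟩ := exists_norm_le (∂_{e} χ)
  refine ⟨C, hC0, fun n x => ?_⟩
  rw [lineDeriv_schwartzMul, _root_.add_apply, schwartzMul_apply, schwartzMul_apply]
  refine (norm_add_le _ _).trans ?_
  rw [norm_mul, norm_mul]
  refine add_le_add ?_ ?_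
  · refine mul_le_mul_of_nonneg_right ?_ (norm_nonneg _)
    refine (norm_lineDeriv_spatialCutoff_le n e x hC).trans (mul_le_of_le_one_left hC0 ?_)
    rw [div_le_one (by positivity)]
    linarith [(Nat.cast_nonneg n : (0 : ℝ) ≤ n)]
  · exact mul_le_of_le_one_right (norm_nonneg _) (hχ.norm_spatialCutoff_le n x)

theorem pair_toLp_eq (f : SchwartzMap Plane ℂ) (G : L2 ℂ) :
    pair (f.toLp 2 volume) G = ∫ x, f x * G x := by
  rw [pair_apply]
  exact integral_congr_ae ((f.coeFn_toLp 2 volume).mono fun x hx => by simp only [hx])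

theorem IsCutoff.tendsto_pair_cutoff_mul (hχ : IsCutoff χ) (f : SchwartzMap Plane ℂ) (G : L2 ℂ) :
    Tendsto (fun n => pair ((schwartzMul (spatialCutoff χ n) f).toLp 2 volume) G) atTop
      (𝓝 (pair (f.toLp 2 volume) G)) := by
  simp only [pair_toLp_eq]
  have hint : Integrable (fun x => f x * G x) volume :=
    MemLp.integrable_mul (f.memLp 2 volume) (Lp.memLp G)
  refine tendsto_integral_of_dominated_convergence (fun x => ‖f x * G x‖) (fun n => ?_) hint.norm
    (fun n => ae_of_all _ fun x => ?_) (ae_of_all _ fun x => ?_)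
  · exact (SchwartzMap.continuous _).aestronglyMeasurable.mul (Lp.aestronglyMeasurable G)
  · rw [schwartzMul_apply, mul_assoc, norm_mul]
    exact mul_le_of_le_one_left (norm_nonneg _) (hχ.norm_spatialCutoff_le n x)
  · have h2 := ((hχ.tendsto_spatialCutoff x).mul_const (f x)).mul_const (G x)
    rw [one_mul] at h2
    exact h2

/-- A linear functional on Schwartz functions that vanishes on real test functions and is compatible
with spatial truncations vanishes. -/
theorem IsCutoff.eq_zero_of_test (hχ : IsCutoff χ) (Λ : SchwartzMap Plane ℂ →ₗ[ℂ] ℂ)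
    (hΛ : ∀ (φ : Plane → ℝ) (hφ : IsTestFunction φ), Λ hφ.toSchwartz = 0)
    (hlim : ∀ f, Tendsto (fun n => Λ (schwartzMul (spatialCutoff χ n) f)) atTop (𝓝 (Λ f)))
    (f : SchwartzMap Plane ℂ) : Λ f = 0 := by
  have hcpt : ∀ f : SchwartzMap Plane ℂ, HasCompactSupport f → Λ f = 0 := by
    intro f hf
    have h1 : IsTestFunction fun x => (f x).re :=
      ⟨Complex.reCLM.contDiff.comp (f.smooth ⊤), hf.comp_left (g := Complex.re) rfl⟩
    have h2 : IsTestFunction fun x => (f x).im :=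
      ⟨Complex.imCLM.contDiff.comp (f.smooth ⊤), hf.comp_left (g := Complex.im) rfl⟩
    have h3 : f = h1.toSchwartz + Complex.I • h2.toSchwartz := by
      ext x
      rw [_root_.add_apply, _root_.smul_apply, h1.toSchwartz_apply, h2.toSchwartz_apply,
        smul_eq_mul, mul_comm, Complex.re_add_im]
    rw [h3, map_add, map_smul, hΛ _ h1, hΛ _ h2, smul_zero, add_zero]
  refine tendsto_nhds_unique (hlim f) ?_
  simp only [fun n => hcpt _ (hχ.hasCompactSupport_spatialCutoff_mul n f)]
  exact tendsto_const_nhds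

end cutoff

section weakForm

variable {χ : SchwartzMap Plane ℂ}

theorem triple_toLp_eq (f : SchwartzMap Plane ℂ) (G H : L2 ℂ) :
    triple (f.toLp ⊤ volume) G H = ∫ x, f x * G x * H x := by
  rw [triple_apply]
  exact integral_congr_ae ((f.coeFn_toLp ⊤ volume).mono fun x hx => by simp only [hx])

theorem integrable_schwartz_mul_mul (f : SchwartzMap Plane ℂ) (G H : L2 ℂ) :
    Integrable (fun x => f x * G x * H x) volume := by
  obtain ⟨C, -, hC⟩ := exists_norm_le f
  have h : Integrable (fun x => G x * H x) volume := MemLp.integrable_mul (Lp.memLp G) (Lp.memLp H)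
  simp only [mul_assoc]
  exact h.bdd_mul (c := C) f.continuous.aestronglyMeasurable (ae_of_all _ hC)

/-- A weakly divergence free field is divergence free on the Fourier side. The cutoff `χ` only
serves to truncate Schwartz functions in space. -/
theorem IsDivergenceFree.fourierDivFree (hχ : IsCutoff χ) {h : L2 Plane}
    (hh : IsDivergenceFree h) : FourierDivFree fun j => fieldComp j h := by
  refine fourierDivFree_of_sum_pair_eq_zero fun f => ?_
  have hadd : ∀ j (f g : SchwartzMap Plane ℂ), pair ((∂_{basisVec j} (f + g)).toLp 2 volume)
      (fieldComp j h) = pair ((∂_{basisVec j} f).toLp 2 volume) (fieldComp j h) +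
        pair ((∂_{basisVec j} g).toLp 2 volume) (fieldComp j h) := by
    intro j f g
    rw [lineDerivOp_add, toLp_add, map_add]; rfl
  have hsmul : ∀ j (c : ℂ) (f : SchwartzMap Plane ℂ), pair ((∂_{basisVec j} (c • f)).toLp 2 volume)
      (fieldComp j h) = c * pair ((∂_{basisVec j} f).toLp 2 volume) (fieldComp j h) := by
    intro j c f
    have h1 : (∂_{basisVec j} (c • f) : SchwartzMap Plane ℂ) = c • ∂_{basisVec j} f :=
      lineDerivOp_smul _ _ _
    have h2 : (c • (∂_{basisVec j} f : SchwartzMap Plane ℂ)).toLp 2 volume =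
      c • (∂_{basisVec j} f : SchwartzMap Plane ℂ).toLp 2 volume := rfl
    rw [h1, h2, map_smul, _root_.smul_apply, smul_eq_mul]
  let Λ : SchwartzMap Plane ℂ →ₗ[ℂ] ℂ :=
    { toFun := fun f => ∑ j, pair ((∂_{basisVec j} f).toLp 2 volume) (fieldComp j h)
      map_add' := fun f g => by simp only [hadd, Finset.sum_add_distrib]
      map_smul' := fun c f => by
        simp only [hsmul, ← Finset.mul_sum, RingHom.id_apply, smul_eq_mul] }
  have hΛ : ∀ f, Λ f = ∑ j, ∫ x, (∂_{basisVec j} f : SchwartzMap Plane ℂ) x * fieldComp j h x := by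
    intro f
    simp only [Λ, LinearMap.coe_mk, AddHom.coe_mk, pair_toLp_eq]
  suffices key : Λ f = 0 from key
  refine hχ.eq_zero_of_test Λ (fun φ hφ => ?_) (fun f => ?_) f
  · rw [hΛ]
    rw [← integral_finsetSum]
    · have h2 := congrArg (fun r : ℝ => (r : ℂ)) (hh φ hφ)
      simp only [← integral_complex_ofReal, Complex.ofReal_zero] at h2
      rw [← h2]
      refine integral_congr_ae ?_
      filter_upwards [ae_all_iff.2 fun j => coeFn_fieldComp j h] with x hx
      rw [fderiv_apply_eq_sum]
      simp only [hφ.lineDeriv_toSchwartz, hx]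
      push_cast
      rfl
    · intro j _
      exact MemLp.integrable_mul (SchwartzMap.memLp _ 2 volume) (Lp.memLp _)
  · simp only [hΛ]
    refine tendsto_finsetSum _ fun j _ => ?_
    obtain ⟨C, hC0, hC⟩ := hχ.norm_lineDeriv_cutoff_mul_le f (basisVec j)
    have i1 : Integrable (fun x => f x * fieldComp j h x) volume :=
      MemLp.integrable_mul (SchwartzMap.memLp _ 2 volume) (Lp.memLp _)
    have i2 : Integrable (fun x => (∂_{basisVec j} f : SchwartzMap Plane ℂ) x * fieldComp j h x)
        volume := MemLp.integrable_mul (SchwartzMap.memLp _ 2 volume) (Lp.memLp _)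
    refine tendsto_integral_of_dominated_convergence (fun x => C * ‖f x * fieldComp j h x‖ +
      ‖(∂_{basisVec j} f : SchwartzMap Plane ℂ) x * fieldComp j h x‖) (fun n => ?_)
      ((i1.norm.const_mul C).add i2.norm) (fun n => ae_of_all _ fun x => ?_)
      (ae_of_all _ fun x => ?_)
    · exact (SchwartzMap.continuous _).aestronglyMeasurable.mul (Lp.aestronglyMeasurable _)
    · rw [norm_mul, norm_mul, norm_mul, ← mul_assoc, ← add_mul]
      exact mul_le_mul_of_nonneg_right (hC n x) (norm_nonneg _)
    · exact (hχ.tendsto_lineDeriv_cutoff_mul f _ x).mul_const _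

/-- The action `∫ (G H · ∇f + F f)` of the right-hand side of the transport equation on `f`. -/
def transportForm (H : Fin 2 → L2 ℂ) (G F : L2 ℂ) (f : SchwartzMap Plane ℂ) : ℂ :=
  ∑ j, triple ((∂_{basisVec j} f).toLp ⊤ volume) G (H j) + pair (f.toLp 2 volume) F

theorem transportForm_add (H : Fin 2 → L2 ℂ) (G F : L2 ℂ) (f f' : SchwartzMap Plane ℂ) :
    transportForm H G F (f + f') = transportForm H G F f + transportForm H G F f' := by
  have h1 : ∀ j, triple ((∂_{basisVec j} (f + f')).toLp ⊤ volume) G (H j) =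
      triple ((∂_{basisVec j} f).toLp ⊤ volume) G (H j) +
        triple ((∂_{basisVec j} f').toLp ⊤ volume) G (H j) := by
    intro j
    have h2 : ((∂_{basisVec j} f : SchwartzMap Plane ℂ) + ∂_{basisVec j} f').toLp ⊤ volume =
      (∂_{basisVec j} f : SchwartzMap Plane ℂ).toLp ⊤ volume +
        (∂_{basisVec j} f' : SchwartzMap Plane ℂ).toLp ⊤ volume := rfl
    rw [lineDerivOp_add, h2, map_add]; rfl
  simp only [transportForm, h1, toLp_add, map_add, Finset.sum_add_distrib, _root_.add_apply]
  ring

theorem transportForm_smul (H : Fin 2 → L2 ℂ) (G F : L2 ℂ) (c : ℂ) (f : SchwartzMap Plane ℂ) :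
    transportForm H G F (c • f) = c * transportForm H G F f := by
  have h1 : ∀ j, triple ((∂_{basisVec j} (c • f)).toLp ⊤ volume) G (H j) =
      c * triple ((∂_{basisVec j} f).toLp ⊤ volume) G (H j) := by
    intro j
    have h3 : (∂_{basisVec j} (c • f) : SchwartzMap Plane ℂ) = c • ∂_{basisVec j} f :=
      lineDerivOp_smul _ _ _
    have h2 : (c • (∂_{basisVec j} f : SchwartzMap Plane ℂ)).toLp ⊤ volume =
      c • (∂_{basisVec j} f : SchwartzMap Plane ℂ).toLp ⊤ volume := rfl
    rw [h3, h2, map_smul]; rfl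
  have h4 : (c • f).toLp 2 volume = c • f.toLp 2 volume := rfl
  simp only [transportForm, h1, h4, map_smul, _root_.smul_apply, smul_eq_mul, mul_add,
    Finset.mul_sum]

theorem transportForm_test (h : L2 Plane) (g F : L2 ℝ) {φ : Plane → ℝ} (hφ : IsTestFunction φ) :
    transportForm (fun j => fieldComp j h) (toComplex g) (toComplex F) hφ.toSchwartz =
      ((∫ x, (g x * fderiv ℝ φ x (h x) + F x * φ x) : ℝ) : ℂ) := by
  have i1 := fun j => integrable_schwartz_mul_mul (∂_{basisVec j} hφ.toSchwartz) (toComplex g)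
    (fieldComp j h)
  have i2 : Integrable (fun x => hφ.toSchwartz x * toComplex F x) volume :=
    MemLp.integrable_mul (SchwartzMap.memLp _ 2 volume) (Lp.memLp _)
  simp only [transportForm, triple_toLp_eq, pair_toLp_eq]
  rw [← integral_finsetSum _ fun j _ => i1 j, ← integral_add (integrable_finsetSum _ fun j _ => i1 j)
    i2, ← integral_complex_ofReal]
  refine integral_congr_ae ?_
  filter_upwards [ae_all_iff.2 fun j => coeFn_fieldComp j h, coeFn_toComplex g, coeFn_toComplex F]
    with x h1 h2 h3
  rw [fderiv_apply_eq_sum]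
  simp only [hφ.lineDeriv_toSchwartz, h1, h2, h3, hφ.toSchwartz_apply]
  push_cast
  rw [Finset.mul_sum, mul_comm (φ x : ℂ)]
  congr 1
  exact Finset.sum_congr rfl fun j _ => by ring

theorem norm_triple_le (w : Lp ℂ ⊤ (volume : Measure Plane)) (G H : L2 ℂ) :
    ‖triple w G H‖ ≤ ‖w‖ * ‖G‖ * ‖H‖ := by
  have h2 : ‖triple w G H‖ₑ ≤ ‖w‖ₑ * ‖G‖ₑ * ‖H‖ₑ := by
    rw [triple_apply]
    refine (enorm_integral_le_lintegral_enorm _).trans ?_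
    refine (lintegral_mul_mul_le (p := ⊤) (r := 2) (m := 2) (Lp.aestronglyMeasurable w)
      (Lp.aestronglyMeasurable G) (Lp.aestronglyMeasurable H) ?_).trans_eq ?_
    · rw [ENNReal.inv_top, zero_add, ENNReal.inv_two_add_inv_two]
    · rw [eLpNorm_two_eq, eLpNorm_two_eq, Lp.enorm_def w]
  have h3 := ENNReal.toReal_mono (ENNReal.mul_ne_top (ENNReal.mul_ne_top enorm_ne_top enorm_ne_top)
    enorm_ne_top) h2
  simpa only [toReal_enorm, ENNReal.toReal_mul] using h3

theorem norm_toLp_top_le {f : SchwartzMap Plane ℂ} {C : ℝ} (hC0 : 0 ≤ C) (hC : ∀ x, ‖f x‖ ≤ C) :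
    ‖f.toLp ⊤ volume‖ ≤ C := by
  rw [SchwartzMap.norm_toLp, eLpNorm_exponent_top]
  exact ENNReal.toReal_le_of_le_ofReal hC0 (eLpNormEssSup_le_of_ae_bound (ae_of_all _ hC))

theorem norm_transportForm_le (H : Fin 2 → L2 ℂ) (G F : L2 ℂ) {f : SchwartzMap Plane ℂ} {C : ℝ}
    (hC0 : 0 ≤ C) (hC : ∀ j x, ‖(∂_{basisVec j} f : SchwartzMap Plane ℂ) x‖ ≤ C) :
    ‖transportForm H G F f‖ ≤ C * ∑ j, ‖G‖ * ‖H j‖ + ‖f.toLp 2 volume‖ * ‖F‖ := by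
  refine (norm_add_le _ _).trans (add_le_add ?_ (norm_pair_le _ _))
  rw [Finset.mul_sum]
  refine (norm_sum_le _ _).trans (Finset.sum_le_sum fun j _ => ?_)
  rw [← mul_assoc]
  refine (norm_triple_le _ _ _).trans ?_
  gcongr
  exact norm_toLp_top_le hC0 (hC j)

theorem IsCutoff.tendsto_transportForm (hχ : IsCutoff χ) (H : Fin 2 → L2 ℂ) (G F : L2 ℂ)
    (f : SchwartzMap Plane ℂ) :
    Tendsto (fun n => transportForm H G F (schwartzMul (spatialCutoff χ n) f)) atTop
      (𝓝 (transportForm H G F f)) := by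
  refine Tendsto.add (tendsto_finsetSum _ fun j _ => ?_) (hχ.tendsto_pair_cutoff_mul f F)
  simp only [triple_toLp_eq]
  obtain ⟨C, hC0, hC⟩ := hχ.norm_lineDeriv_cutoff_mul_le f (basisVec j)
  have i1 := integrable_schwartz_mul_mul f G (H j)
  have i2 := integrable_schwartz_mul_mul (∂_{basisVec j} f) G (H j)
  refine tendsto_integral_of_dominated_convergence (fun x => C * ‖f x * G x * H j x‖ +
    ‖(∂_{basisVec j} f : SchwartzMap Plane ℂ) x * G x * H j x‖) (fun n => ?_)
    ((i1.norm.const_mul C).add i2.norm) (fun n => ae_of_all _ fun x => ?_)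
    (ae_of_all _ fun x => ?_)
  · exact ((SchwartzMap.continuous _).aestronglyMeasurable.mul (Lp.aestronglyMeasurable _)).mul
      (Lp.aestronglyMeasurable _)
  · simp only [norm_mul, ← mul_assoc, ← add_mul]
    gcongr
    exact hC n x
  · exact ((hχ.tendsto_lineDeriv_cutoff_mul f _ x).mul_const _).mul_const _

theorem aestronglyMeasurable_transportForm {μ : Measure ℝ} {H : Fin 2 → ℝ → L2 ℂ} {G F : ℝ → L2 ℂ}
    (hG : AEStronglyMeasurable G μ) (hH : ∀ j, AEStronglyMeasurable (H j) μ)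
    (hF : AEStronglyMeasurable F μ) (f : SchwartzMap Plane ℂ) :
    AEStronglyMeasurable (fun τ => transportForm (fun j => H j τ) (G τ) (F τ) f) μ := by
  refine AEStronglyMeasurable.add ?_ ((pair _).continuous.comp_aestronglyMeasurable hF)
  exact Finset.aestronglyMeasurable_fun_sum _ fun j _ =>
    (triple _).aestronglyMeasurable_comp₂ hG (hH j)

/-- The weak formulation of the transport equation, with Schwartz test functions. -/
theorem IsWeakTransportSolution.schwartz (hχ : IsCutoff χ) {T : ℝ} {h : ℝ → L2 Plane}
    {F g : ℝ → L2 ℝ} {g₀ : L2 ℝ} (hsol : IsWeakTransportSolution T h F g g₀)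
    (hG : AEStronglyMeasurable (fun τ => toComplex (g τ)) (volume.restrict (Set.Icc 0 T)))
    (hH : ∀ j, AEStronglyMeasurable (fun τ => fieldComp j (h τ)) (volume.restrict (Set.Icc 0 T)))
    (hGH : ∀ j, IntegrableOn (fun τ => ‖toComplex (g τ)‖ * ‖fieldComp j (h τ)‖) (Set.Icc 0 T) volume)
    (hF : IntegrableOn (fun τ => toComplex (F τ)) (Set.Icc 0 T) volume)
    {t : ℝ} (ht : t ∈ Set.Icc 0 T) (f : SchwartzMap Plane ℂ) :
    pair (f.toLp 2 volume) (toComplex (g t)) = pair (f.toLp 2 volume) (toComplex g₀) +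
      ∫ τ in Set.Icc 0 t,
        transportForm (fun j => fieldComp j (h τ)) (toComplex (g τ)) (toComplex (F τ)) f := by
  set L : ℝ → SchwartzMap Plane ℂ → ℂ := fun τ f =>
    transportForm (fun j => fieldComp j (h τ)) (toComplex (g τ)) (toComplex (F τ)) f with hL
  have hsub : volume.restrict (Set.Icc 0 t) ≤ volume.restrict (Set.Icc 0 T) :=
    Measure.restrict_mono (Set.Icc_subset_Icc_right ht.2) le_rfl
  have hmeas : ∀ f, AEStronglyMeasurable (fun τ => L τ f) (volume.restrict (Set.Icc 0 t)) :=
    fun f => (aestronglyMeasurable_transportForm hG hH hF.1 f).mono_measure hsub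
  have hdom : ∀ c d : ℝ, Integrable (fun τ =>
      c * ∑ j, ‖toComplex (g τ)‖ * ‖fieldComp j (h τ)‖ + d * ‖toComplex (F τ)‖)
      (volume.restrict (Set.Icc 0 t)) := fun c d =>
    (((integrable_finsetSum _ fun j _ => hGH j).const_mul c).add
      (hF.norm.const_mul d)).mono_measure hsub
  have hint : ∀ f, Integrable (fun τ => L τ f) (volume.restrict (Set.Icc 0 t)) := by
    intro f
    choose C hC0 hC using fun j => exists_norm_le (∂_{basisVec j} f)
    refine Integrable.mono' (hdom (∑ j, C j) ‖f.toLp 2 volume‖) (hmeas f)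
      (ae_of_all _ fun τ => ?_)
    exact norm_transportForm_le _ _ _ (Finset.sum_nonneg fun j _ => hC0 j) fun j x =>
      (hC j x).trans (Finset.single_le_sum (fun i _ => hC0 i) (Finset.mem_univ j))
  have key := hχ.eq_zero_of_test
    { toFun := fun f => pair (f.toLp 2 volume) (toComplex (g t)) -
        pair (f.toLp 2 volume) (toComplex g₀) - ∫ τ in Set.Icc 0 t, L τ f
      map_add' := fun f f' => by
        have h1 : ∀ τ, L τ (f + f') = L τ f + L τ f' := fun τ => transportForm_add _ _ _ f f'
        simp only [h1, toLp_add, map_add, _root_.add_apply]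
        rw [integral_add (hint f) (hint f')]
        ring
      map_smul' := fun c f => by
        have h1 : ∀ τ, L τ (c • f) = c * L τ f := fun τ => transportForm_smul _ _ _ c f
        have h4 : (c • f).toLp 2 volume = c • f.toLp 2 volume := rfl
        simp only [h1, h4, map_smul, _root_.smul_apply, smul_eq_mul, RingHom.id_apply]
        rw [integral_const_mul]
        ring } (fun φ hφ => ?_) (fun f => ?_) f
  · simp only [LinearMap.coe_mk, AddHom.coe_mk] at key
    linear_combination key
  · have h1 : ∀ u : L2 ℝ, pair (hφ.toSchwartz.toLp 2 volume) (toComplex u) =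
        ((∫ x, u x * φ x : ℝ) : ℂ) := by
      intro u
      rw [pair_toLp_eq, ← integral_complex_ofReal]
      refine integral_congr_ae ?_
      filter_upwards [coeFn_toComplex u] with x hx
      rw [hx, hφ.toSchwartz_apply]; push_cast; ring
    have h2 := hsol φ hφ t ht
    rw [intervalIntegral.integral_of_le ht.1, ← integral_Icc_eq_integral_Ioc] at h2
    simp only [LinearMap.coe_mk, AddHom.coe_mk, h1, hL, transportForm_test]
    rw [integral_complex_ofReal, h2]
    push_cast
    ring
  · simp only [LinearMap.coe_mk, AddHom.coe_mk]
    refine ((hχ.tendsto_pair_cutoff_mul f _).sub (hχ.tendsto_pair_cutoff_mul f _)).sub ?_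
    choose C hC0 hC using fun j => hχ.norm_lineDeriv_cutoff_mul_le f (basisVec j)
    obtain ⟨D, hD0, hD⟩ := exists_norm_le f
    choose D' hD0' hD' using fun j => exists_norm_le (∂_{basisVec j} f)
    set B := ∑ j, (C j * D + D' j)
    have hB0 : 0 ≤ B := Finset.sum_nonneg fun j _ => by
      have := hC0 j; have := hD0' j; positivity
    have hB : ∀ n j x, ‖(∂_{basisVec j} (schwartzMul (spatialCutoff χ n) f) :
        SchwartzMap Plane ℂ) x‖ ≤ B := by
      intro n j x
      have h1 : C j * ‖f x‖ + ‖(∂_{basisVec j} f : SchwartzMap Plane ℂ) x‖ ≤ C j * D + D' j := by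
        have := hC0 j
        gcongr
        · exact hD x
        · exact hD' j x
      refine ((hC j n x).trans h1).trans (Finset.single_le_sum (f := fun j => C j * D + D' j)
        (fun i _ => ?_) (Finset.mem_univ j))
      have := hC0 i; have := hD0' i; positivity
    have hnorm : ∀ n, ‖(schwartzMul (spatialCutoff χ n) f).toLp 2 volume‖ ≤ ‖f.toLp 2 volume‖ := by
      intro n
      refine Lp.norm_le_norm_of_ae_le ?_
      filter_upwards [(schwartzMul (spatialCutoff χ n) f).coeFn_toLp 2 volume,
        f.coeFn_toLp 2 volume] with x h1 h2
      rw [h1, h2, schwartzMul_apply, norm_mul]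
      exact mul_le_of_le_one_left (norm_nonneg _) (hχ.norm_spatialCutoff_le n x)
    refine tendsto_integral_of_dominated_convergence _ (fun n => hmeas _)
      (hdom B ‖f.toLp 2 volume‖) (fun n => ae_of_all _ fun τ => ?_)
      (ae_of_all _ fun τ => hχ.tendsto_transportForm _ _ _ f)
    refine (norm_transportForm_le _ _ _ hB0 (hB n)).trans ?_
    gcongr
    exact hnorm n

end weakForm

/-! ### The energy balance for the low frequencies -/

theorem toLp_lineDeriv_fourierMultiplier (j : Fin 2) (s k : SchwartzMap Plane ℂ) :
    (∂_{basisVec j} (SchwartzMap.fourierMultiplierCLM ℂ s k) : SchwartzMap Plane ℂ).toLp ⊤ volume =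
      multTop (derivSymbol j s) (k.toLp 2 volume) := by
  refine Lp.ext ?_
  have h1 := coeFn_multTop (derivSymbol j s) (k.toLp 2 volume)
  rw [schwartz_mult_toLp, fourierMultiplier_derivSymbol] at h1
  filter_upwards [h1, (∂_{basisVec j} (SchwartzMap.fourierMultiplierCLM ℂ s k) :
    SchwartzMap Plane ℂ).coeFn_toLp ⊤ volume, (∂_{basisVec j} (SchwartzMap.fourierMultiplierCLM ℂ s k) :
    SchwartzMap Plane ℂ).coeFn_toLp 2 volume] with x h2 h3 h4
  rw [h2, h3, h4]

set_option synthInstance.maxHeartbeats 200000 in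
/-- The functional `k ↦ ∫ s(D)k G H`, as a bounded bilinear function of `G` and `H`. -/
def tripleFunctional (s : SchwartzMap Plane ℂ) : L2 ℂ →L[ℂ] L2 ℂ →L[ℂ] L2 ℂ →L[ℂ] ℂ :=
  (ContinuousLinearMap.flipₗᵢ ℂ (L2 ℂ) (L2 ℂ) ℂ).toContinuousLinearEquiv.toContinuousLinearMap ∘L
    (triple ∘L multTop s).flip

set_option synthInstance.maxHeartbeats 200000 in
theorem tripleFunctional_apply (s : SchwartzMap Plane ℂ) (G H k : L2 ℂ) :
    tripleFunctional s G H k = triple (multTop s k) G H := rfl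

/-- The functional `k ↦ ∫ (G H · ∇ s(D)k + F s(D)k)`. -/
def transportFunctional (s : SchwartzMap Plane ℂ) (H : Fin 2 → L2 ℂ) (G F : L2 ℂ) :
    L2 ℂ →L[ℂ] ℂ :=
  ∑ j, tripleFunctional (derivSymbol j s) G (H j) + (pair ∘L mult s).flip F

theorem transportFunctional_apply (s : SchwartzMap Plane ℂ) (H : Fin 2 → L2 ℂ) (G F k : L2 ℂ) :
    transportFunctional s H G F k =
      ∑ j, triple (multTop (derivSymbol j s) k) G (H j) + pair (mult s k) F := by
  rw [transportFunctional, _root_.add_apply, _root_.sum_apply]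
  rfl

theorem transportForm_fourierMultiplier (s : SchwartzMap Plane ℂ) (H : Fin 2 → L2 ℂ) (G F : L2 ℂ)
    (k : SchwartzMap Plane ℂ) :
    transportForm H G F (SchwartzMap.fourierMultiplierCLM ℂ s k) =
      transportFunctional s H G F (k.toLp 2 volume) := by
  rw [transportFunctional_apply, transportForm, schwartz_mult_toLp]
  simp only [toLp_lineDeriv_fourierMultiplier]

set_option synthInstance.maxHeartbeats 200000 in
theorem integrable_transportFunctional (s : SchwartzMap Plane ℂ) {μ : Measure ℝ}
    {H : Fin 2 → ℝ → L2 ℂ} {G F : ℝ → L2 ℂ}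
    (hG : AEStronglyMeasurable G μ) (hH : ∀ j, AEStronglyMeasurable (H j) μ)
    (hGH : ∀ j, Integrable (fun τ => ‖G τ‖ * ‖H j τ‖) μ) (hF : Integrable F μ) :
    Integrable (fun τ => transportFunctional s (fun j => H j τ) (G τ) (F τ)) μ := by
  refine Integrable.add (integrable_finsetSum _ fun j _ => ?_)
    ((pair ∘L mult s).flip.integrable_comp hF)
  refine Integrable.mono' ((hGH j).const_mul ‖multTop (derivSymbol j s)‖)
    ((tripleFunctional (derivSymbol j s)).aestronglyMeasurable_comp₂ hG (hH j))
    (ae_of_all _ fun τ => ?_)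
  refine ContinuousLinearMap.opNorm_le_bound _ (by positivity) fun k => ?_
  rw [tripleFunctional_apply]
  refine (norm_triple_le _ _ _).trans ?_
  calc _ ≤ (‖multTop (derivSymbol j s)‖ * ‖k‖) * ‖G τ‖ * ‖H j τ‖ := by
        gcongr
        exact (multTop (derivSymbol j s)).le_opNorm k
    _ = _ := by ring

/-- The real bilinear form `Re ⟨x, A y⟩`. -/
def reForm (A : L2 ℂ →L[ℂ] L2 ℂ) : L2 ℂ →L[ℝ] L2 ℂ →L[ℝ] ℝ :=
  LinearMap.mkContinuous₂ (LinearMap.mk₂ ℝ (fun x y : L2 ℂ => (inner ℂ x (A y)).re)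
    (fun x x' y => by rw [inner_add_left, Complex.add_re])
    (fun c x y => by
      rw [RCLike.real_smul_eq_coe_smul (K := ℂ) c x, inner_smul_left]; simp)
    (fun x y y' => by rw [map_add, inner_add_right, Complex.add_re])
    (fun c x y => by
      rw [RCLike.real_smul_eq_coe_smul (K := ℂ) c y, map_smul, inner_smul_right]; simp)) ‖A‖ (fun x y => by
      rw [LinearMap.mk₂_apply, Real.norm_eq_abs]
      refine (Complex.abs_re_le_norm _).trans ((norm_inner_le_norm _ _).trans ?_)
      calc ‖x‖ * ‖A y‖ ≤ ‖x‖ * (‖A‖ * ‖y‖) := by gcongr; exact A.le_opNorm y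
        _ = _ := by ring)

theorem reForm_apply (A : L2 ℂ →L[ℂ] L2 ℂ) (x y : L2 ℂ) : reForm A x y = (inner ℂ x (A y)).re := rfl

theorem inner_toComplex_left (g : L2 ℝ) (k : L2 ℂ) :
    inner ℂ (toComplex g) k = pair k (toComplex g) := by
  rw [L2.inner_def, pair_apply]
  refine integral_congr_ae ?_
  filter_upwards [coeFn_toComplex g] with x hx
  rw [hx, RCLike.inner_apply, Complex.conj_ofReal]

namespace IsCutoff

variable {χ : SchwartzMap Plane ℂ}

theorem conj_apply (hχ : IsCutoff χ) (ξ : Plane) : (starRingEnd ℂ) (χ ξ) = χ ξ := by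
  obtain ⟨r, -, -, h⟩ := hχ.exists_real ξ
  rw [h, Complex.conj_ofReal]

theorem inner_low (hχ : IsCutoff χ) {a : ℝ} (ha : 0 < a) (f g : L2 ℂ) :
    inner ℂ (mult (dil a χ) f) g = inner ℂ f (mult (dil a χ) g) :=
  inner_mult ((dil a χ).memLp_top volume)
    (fun ξ => by rw [dil_apply ha.ne']; exact hχ.conj_apply _) f g

/-- The evolution of the low frequencies of a weak solution. -/
theorem low_eq_add_integral (hχ : IsCutoff χ) {b : ℝ} (hb : 0 < b) {T : ℝ} {h : ℝ → L2 Plane}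
    {F g : ℝ → L2 ℝ} {g₀ : L2 ℝ} (hsol : IsWeakTransportSolution T h F g g₀)
    (hG : AEStronglyMeasurable (fun τ => toComplex (g τ)) (volume.restrict (Set.Icc 0 T)))
    (hH : ∀ j, AEStronglyMeasurable (fun τ => fieldComp j (h τ)) (volume.restrict (Set.Icc 0 T)))
    (hGH : ∀ j, IntegrableOn (fun τ => ‖toComplex (g τ)‖ * ‖fieldComp j (h τ)‖) (Set.Icc 0 T) volume)
    (hF : IntegrableOn (fun τ => toComplex (F τ)) (Set.Icc 0 T) volume)
    {t : ℝ} (ht : t ∈ Set.Icc 0 T) :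
    mult (dil b χ) (toComplex (g t)) = mult (dil b χ) (toComplex g₀) +
      ∫ τ in Set.Icc 0 t, (InnerProductSpace.toDual ℂ (L2 ℂ)).symm (transportFunctional (dil b χ)
        (fun j => fieldComp j (h τ)) (toComplex (g τ)) (toComplex (F τ))) := by
  set R := (InnerProductSpace.toDual ℂ (L2 ℂ)).symm
  set L : ℝ → L2 ℂ →L[ℂ] ℂ := fun τ => transportFunctional (dil b χ)
        (fun j => fieldComp j (h τ)) (toComplex (g τ)) (toComplex (F τ)) with hL
  have hsub : volume.restrict (Set.Icc 0 t) ≤ volume.restrict (Set.Icc 0 T) :=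
    Measure.restrict_mono (Set.Icc_subset_Icc_right ht.2) le_rfl
  have hLint : Integrable L (volume.restrict (Set.Icc 0 t)) :=
    (integrable_transportFunctional (dil b χ) hG hH hGH hF).mono_measure hsub
  have hRint : Integrable (fun τ => R (L τ)) (volume.restrict (Set.Icc 0 t)) := by
    refine Integrable.mono' hLint.norm (R.continuous.comp_aestronglyMeasurable hLint.1)
      (ae_of_all _ fun τ => ?_)
    rw [R.norm_map]
  refine dense_schwartz.eq_of_inner_right (𝕜 := ℂ) fun k => ?_
  set K : L2 ℂ := k.toLp 2 volume with hK
  have h1 := hsol.schwartz hχ hG hH hGH hF ht (SchwartzMap.fourierMultiplierCLM ℂ (dil b χ) k)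
  rw [← schwartz_mult_toLp, ← inner_toComplex_left, ← inner_toComplex_left, ← hχ.inner_low hb,
    ← hχ.inner_low hb] at h1
  simp only [transportForm_fourierMultiplier] at h1
  have h2 : inner ℂ K (∫ τ in Set.Icc 0 t, R (L τ)) = ∫ τ in Set.Icc 0 t, inner ℂ K (R (L τ)) :=
    ((innerSL ℂ K).integral_comp_comm hRint).symm
  have h3 : ∀ τ, inner ℂ K (R (L τ)) = (starRingEnd ℂ) (L τ K) := by
    intro τ
    rw [← inner_conj_symm, InnerProductSpace.toDual_symm_apply]
  rw [inner_add_right, h2]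
  simp only [h3]
  rw [integral_conj, ← inner_conj_symm K, ← inner_conj_symm K (mult (dil b χ) (toComplex g₀)), h1,
    map_add]

/-- The energy balance for the low frequencies of a weak solution. The energy `⟨g, P_a g⟩` is a
quadratic form in `P_b g` with `b = a / 2`, and `P_b g`, in contrast to `g`, has an integrable time
derivative with values in `L²`. -/
theorem energy_identity (hχ : IsCutoff χ) {a : ℝ} (ha : 0 < a) {T : ℝ} {h : ℝ → L2 Plane}
    {F g : ℝ → L2 ℝ} {g₀ : L2 ℝ} (hsol : IsWeakTransportSolution T h F g g₀)
    (hG : AEStronglyMeasurable (fun τ => toComplex (g τ)) (volume.restrict (Set.Icc 0 T)))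
    (hH : ∀ j, AEStronglyMeasurable (fun τ => fieldComp j (h τ)) (volume.restrict (Set.Icc 0 T)))
    (hGH : ∀ j, IntegrableOn (fun τ => ‖toComplex (g τ)‖ * ‖fieldComp j (h τ)‖) (Set.Icc 0 T) volume)
    (hF : IntegrableOn (fun τ => toComplex (F τ)) (Set.Icc 0 T) volume)
    {t : ℝ} (ht : t ∈ Set.Icc 0 T) :
    (inner ℂ (toComplex (g t)) (mult (dil a χ) (toComplex (g t)))).re =
      (inner ℂ (toComplex g₀) (mult (dil a χ) (toComplex g₀))).re +
      ∫ τ in Set.Icc 0 t, 2 * (flux χ a (fun j => fieldComp j (h τ)) (toComplex (g τ))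
        (toComplex (g τ)) + inner ℂ (toComplex (F τ)) (mult (dil a χ) (toComplex (g τ)))).re := by
  set b := a / 2 with hbdef
  have hb : 0 < b := by positivity
  have hab : 4 * b < 3 * a := by linarith
  set R := (InnerProductSpace.toDual ℂ (L2 ℂ)).symm
  set L : ℝ → L2 ℂ →L[ℂ] ℂ := fun τ => transportFunctional (dil b χ)
        (fun j => fieldComp j (h τ)) (toComplex (g τ)) (toComplex (F τ)) with hL
  have hLint : Integrable L (volume.restrict (Set.Icc 0 T)) :=
    integrable_transportFunctional (dil b χ) hG hH hGH hF
  have hRint : IntegrableOn (fun τ => R (L τ)) (Set.Icc 0 T) volume := by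
    refine Integrable.mono' hLint.norm (R.continuous.comp_aestronglyMeasurable hLint.1)
      (ae_of_all _ fun τ => ?_)
    rw [R.norm_map]
  -- the primitive, extended to all times
  set r : ℝ → L2 ℂ := (Set.Icc 0 T).indicator fun τ => R (L τ) with hr
  have hrint : Integrable r volume := (integrable_indicator_iff measurableSet_Icc).2 hRint
  set v₀ := mult (dil b χ) (toComplex g₀)
  set v : ℝ → L2 ℂ := fun t => v₀ + ∫ τ in (0 : ℝ)..t, r τ with hv
  have hvt : ∀ t ∈ Set.Icc 0 T, v t = mult (dil b χ) (toComplex (g t)) := by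
    intro t ht
    rw [hχ.low_eq_add_integral hb hsol hG hH hGH hF ht, hv]
    beta_reduce
    rw [intervalIntegral.integral_of_le ht.1, ← integral_Icc_eq_integral_Ioc]
    congr 1
    refine setIntegral_congr_fun measurableSet_Icc fun τ hτ => ?_
    exact (Set.indicator_of_mem (s := Set.Icc 0 T) ⟨hτ.1, hτ.2.trans ht.2⟩
      (fun τ => R (L τ)))
  have hsymm : ∀ x y, reForm (mult (dil a χ)) x y = reForm (mult (dil a χ)) y x := by
    intro x y
    rw [reForm_apply, reForm_apply, ← hχ.inner_low ha, ← inner_conj_symm, Complex.conj_re]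
  have hPP : ∀ f, mult (dil a χ) (mult (dil b χ) f) = mult (dil a χ) f :=
    fun f => hχ.low_low' ha hb hab f
  have hform : ∀ f, reForm (mult (dil a χ)) (mult (dil b χ) f) (mult (dil b χ) f) =
      (inner ℂ f (mult (dil a χ) f)).re := by
    intro f
    rw [reForm_apply, hPP, hχ.inner_low hb, hχ.low_low ha hb hab]
  have key := bilin_primitive_eq hrint v₀ (reForm (mult (dil a χ))) hsymm (v := v) (fun _ => rfl) t
  rw [hvt t ht, hform, hform] at key
  rw [key, intervalIntegral.integral_of_le ht.1, ← integral_Icc_eq_integral_Ioc]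
  congr 1
  refine setIntegral_congr_fun measurableSet_Icc fun τ hτ => ?_
  have hτT : τ ∈ Set.Icc 0 T := ⟨hτ.1, hτ.2.trans ht.2⟩
  beta_reduce
  rw [hvt τ hτT, reForm_apply, hPP, hr, Set.indicator_of_mem hτT, InnerProductSpace.toDual_symm_apply,
    hL]
  beta_reduce
  rw [transportFunctional_apply, hχ.low_low ha hb hab, inner_toComplex_left]
  congr 3
  refine Finset.sum_congr rfl fun j _ => ?_
  rw [multTop_congr (hχ.deriv_low ha hb hab j _)]

end IsCutoff

/-! ### Dyadic blocks and sharp projections -/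

namespace IsLittlewoodPaleyPair

variable {ψ φ : Plane → ℝ}

theorem low_le_one (h : IsLittlewoodPaleyPair ψ φ) (ξ : Plane) : ψ ξ ≤ 1 :=
  sub_nonneg.1 ((h.partition ξ).nonneg fun _ => h.nonneg_annulus _)

theorem low_eq_zero (h : IsLittlewoodPaleyPair ψ φ) {ξ : Plane} (hξ : 4 / 3 < ‖ξ‖) : ψ ξ = 0 :=
  image_eq_zero_of_notMem_tsupport fun hmem => not_lt.2 (h.tsupport_low hmem) hξ

theorem isTestFunction_low (h : IsLittlewoodPaleyPair ψ φ) : IsTestFunction ψ :=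
  ⟨h.contDiff_low, HasCompactSupport.intro (isCompact_closedBall (0 : Plane) (4 / 3)) fun ξ hξ =>
    h.low_eq_zero (by rwa [mem_closedBall_zero_iff, not_le] at hξ)⟩

/-- The low frequency cutoff `ψ` as a Schwartz function. -/
def cutoff (h : IsLittlewoodPaleyPair ψ φ) : SchwartzMap Plane ℂ := h.isTestFunction_low.toSchwartz

theorem cutoff_apply (h : IsLittlewoodPaleyPair ψ φ) (ξ : Plane) : h.cutoff ξ = ψ ξ := rfl

theorem isCutoff (h : IsLittlewoodPaleyPair ψ φ) : IsCutoff h.cutoff where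
  exists_real ξ := ⟨ψ ξ, h.nonneg_low ξ, h.low_le_one ξ, rfl⟩
  even ξ := by rw [cutoff_apply, cutoff_apply, h.radial_low (-ξ) ξ (norm_neg ξ)]
  eq_one ξ hξ := by
    rw [cutoff_apply, h.low_eq_one ξ (by rwa [mem_ball_zero_iff]), Complex.ofReal_one]
  eq_zero ξ hξ := by rw [cutoff_apply, h.low_eq_zero hξ, Complex.ofReal_zero]

/-- Comparing the partition of unity at `ξ` and at `ξ / 2`. -/
theorem annulus_eq (h : IsLittlewoodPaleyPair ψ φ) (ξ : Plane) :
    φ ξ = ψ ((2⁻¹ : ℝ) • ξ) - ψ ξ := by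
  have h1 := (hasSum_nat_add_iff' 1).2 (h.partition ξ)
  have h2 := h.partition ((2⁻¹ : ℝ) • ξ)
  have h3 : (fun k : ℕ => φ ((2 : ℝ) ^ (-((k + 1 : ℕ) : ℤ)) • ξ)) =
      fun k : ℕ => φ ((2 : ℝ) ^ (-(k : ℤ)) • (2⁻¹ : ℝ) • ξ) := by
    ext k
    rw [smul_smul]
    congr 2
    rw [Nat.cast_add, Nat.cast_one, neg_add, zpow_add₀ two_ne_zero, zpow_neg_one]
  rw [h3] at h1
  have h4 := h1.unique h2
  simp only [Finset.range_one, Finset.sum_singleton, Nat.cast_zero, neg_zero, zpow_zero,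
    one_smul] at h4
  linarith

theorem abs_annulus_le (h : IsLittlewoodPaleyPair ψ φ) (ξ : Plane) : |φ ξ| ≤ 1 := by
  rw [abs_of_nonneg (h.nonneg_annulus ξ), h.annulus_eq]
  linarith [h.low_le_one ((2⁻¹ : ℝ) • ξ), h.nonneg_low ξ]

theorem two_pi_smul {Θ : ℝ} (ξ : Plane) : Θ⁻¹ • (2 * Real.pi) • ξ = (2 * Real.pi / Θ) • ξ := by
  rw [smul_smul, div_eq_inv_mul]

/-- The symbol of `√(Id - S̃₀)`, with `a = 2π / Θ`. -/
def highSymbol (ψ : Plane → ℝ) (a : ℝ) (ξ : Plane) : ℂ := (√(1 - ψ (a • ξ)) : ℝ)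

theorem measurable_sqrt (h : IsLittlewoodPaleyPair ψ φ) (c : ℝ) :
    Measurable fun ξ : Plane => √(1 - ψ (c • ξ)) := by
  have := h.contDiff_low.continuous
  exact (by fun_prop : Continuous fun ξ : Plane => √(1 - ψ (c • ξ))).measurable

theorem abs_sqrt_le (h : IsLittlewoodPaleyPair ψ φ) (ξ : Plane) : |√(1 - ψ ξ)| ≤ 1 := by
  rw [abs_of_nonneg (Real.sqrt_nonneg _)]
  exact Real.sqrt_le_one.2 (by linarith [h.nonneg_low ξ])

theorem memLp_highSymbol (h : IsLittlewoodPaleyPair ψ φ) (a : ℝ) :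
    MemLp (highSymbol ψ a) ⊤ volume := by
  refine memLp_top_of_bound (Complex.measurable_ofReal.comp
    (h.measurable_sqrt a)).aestronglyMeasurable 1 (ae_of_all _ fun ξ => ?_)
  rw [highSymbol, Complex.norm_real]
  exact h.abs_sqrt_le _

theorem sqrtHigh_eq (h : IsLittlewoodPaleyPair ψ φ) (Θ : ℝ) (f : L2 ℝ) :
    sqrtHigh ψ Θ f = mult (highSymbol ψ (2 * Real.pi / Θ)) (toComplex f) := by
  rw [sqrtHigh, fourierMul_eq_mult (h.measurable_sqrt Θ⁻¹) (B := 1) (fun ξ => h.abs_sqrt_le _)]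
  simp only [two_pi_smul]
  rfl

theorem highSymbol_mul_self (h : IsLittlewoodPaleyPair ψ φ) {a : ℝ} (ha : 0 < a) (ξ : Plane) :
    highSymbol ψ a ξ * highSymbol ψ a ξ = 1 - dil a h.cutoff ξ := by
  rw [highSymbol, ← Complex.ofReal_mul, Real.mul_self_sqrt (sub_nonneg.2 (h.low_le_one _)),
    dil_apply ha.ne', cutoff_apply]
  push_cast; rfl

theorem mult_highSymbol_mult (h : IsLittlewoodPaleyPair ψ φ) {a : ℝ} (ha : 0 < a) (f : L2 ℂ) :
    mult (highSymbol ψ a) (mult (highSymbol ψ a) f) = f - mult (dil a h.cutoff) f := by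
  rw [mult_mult (h.memLp_highSymbol a) (h.memLp_highSymbol a)]
  have h1 := mult_sub_symbol (memLp_top_const (1 : ℂ)) ((dil a h.cutoff).memLp_top volume) f
  rw [mult_one] at h1
  rw [← h1]
  congr 2
  exact funext (h.highSymbol_mul_self ha)

/-- The energy above the threshold is the difference of the total and the low frequency energy. -/
theorem inner_high (h : IsLittlewoodPaleyPair ψ φ) {a : ℝ} (ha : 0 < a) (f g : L2 ℂ) :
    inner ℂ (mult (highSymbol ψ a) f) (mult (highSymbol ψ a) g) =
      inner ℂ f (g - mult (dil a h.cutoff) g) := by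
  rw [inner_mult (h.memLp_highSymbol a) (fun ξ => Complex.conj_ofReal _), h.mult_highSymbol_mult ha]

theorem norm_highSymbol_le (h : IsLittlewoodPaleyPair ψ φ) (a : ℝ) (ξ : Plane) :
    ‖highSymbol ψ a ξ‖ ≤ 1 := by
  rw [highSymbol, Complex.norm_real]; exact h.abs_sqrt_le _

theorem norm_high_le (h : IsLittlewoodPaleyPair ψ φ) (a : ℝ) (f : L2 ℂ) :
    ‖mult (highSymbol ψ a) f‖ ≤ ‖f‖ := by
  simpa using norm_mult_le (h.memLp_highSymbol a) (h.norm_highSymbol_le a) f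

theorem norm_sub_low_le (h : IsLittlewoodPaleyPair ψ φ) {a : ℝ} (ha : 0 < a) (f : L2 ℂ) :
    ‖f - mult (dil a h.cutoff) f‖ ≤ ‖mult (highSymbol ψ a) f‖ := by
  rw [← h.mult_highSymbol_mult ha]
  exact h.norm_high_le a _

/-- The dyadic blocks are differences of two low frequency cutoffs. -/
theorem dyadicBlock_eq (h : IsLittlewoodPaleyPair ψ φ) {Θ : ℝ} (hΘ : 0 < Θ) (j : ℤ) (f : L2 ℝ) :
    dyadicBlock φ Θ j f =
      mult (dil (2 ^ (-j) * (2 * Real.pi / Θ) / 2) h.cutoff) (toComplex f) -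
        mult (dil (2 ^ (-j) * (2 * Real.pi / Θ)) h.cutoff) (toComplex f) := by
  have hφ := h.contDiff_annulus.continuous
  have hmeas : Measurable fun ξ : Plane => φ ((2 : ℝ) ^ (-j) • Θ⁻¹ • ξ) :=
    (by fun_prop : Continuous fun ξ : Plane => φ ((2 : ℝ) ^ (-j) • Θ⁻¹ • ξ)).measurable
  have hpos : 0 < (2 : ℝ) ^ (-j) * (2 * Real.pi / Θ) := by positivity
  rw [dyadicBlock, fourierMul_eq_mult hmeas (B := 1) (fun ξ => h.abs_annulus_le _),
    ← mult_sub_symbol (SchwartzMap.memLp_top _ volume) (SchwartzMap.memLp_top _ volume)]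
  congr 2
  ext ξ
  rw [h.annulus_eq, dil_apply (half_pos hpos).ne', dil_apply hpos.ne', cutoff_apply, cutoff_apply,
    two_pi_smul, div_eq_inv_mul _ (2 : ℝ), mul_smul (2⁻¹ : ℝ), mul_smul ((2 : ℝ) ^ (-j)),
    Complex.ofReal_sub]

end IsLittlewoodPaleyPair

/-- The symbol of the sharp projection onto the frequencies `|D| ≥ Θ / 12`, with `a = 2π / Θ`. -/
def sharpSymbol (a : ℝ) : Plane → ℂ := {ξ : Plane | 1 / 12 ≤ a * ‖ξ‖}.indicator fun _ => 1

theorem memLp_sharpSymbol (a : ℝ) : MemLp (sharpSymbol a) ⊤ volume := by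
  have hm : MeasurableSet {ξ : Plane | 1 / 12 ≤ a * ‖ξ‖} :=
    measurableSet_le measurable_const (by fun_prop)
  exact (memLp_top_const (1 : ℂ)).indicator hm

theorem norm_sharpSymbol_le (a : ℝ) (ξ : Plane) : ‖sharpSymbol a ξ‖ ≤ 1 := by
  rw [sharpSymbol, Set.indicator_apply]
  split_ifs <;> simp

theorem complexComp_sharpHigh {Θ : ℝ} (hΘ : 0 < Θ) (j : Fin 2) (h : L2 Plane) :
    complexComp j (sharpHigh (Θ / 12) h) =
      mult (sharpSymbol (2 * Real.pi / Θ)) (fieldComp j h) := by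
  have hm : MeasurableSet {ξ : Plane | Θ / 12 ≤ ‖ξ‖} := measurableSet_le measurable_const (by fun_prop)
  rw [sharpHigh, complexComp_fourierMul ((measurable_const).indicator hm) (B := 1) (fun ξ => ?_),
    complexComp_complexifyField]
  · congr 2
    ext ξ
    have h1 : Θ / 12 ≤ ‖(2 * Real.pi) • ξ‖ ↔ 1 / 12 ≤ 2 * Real.pi / Θ * ‖ξ‖ := by
      rw [norm_smul, Real.norm_of_nonneg (by positivity), div_mul_eq_mul_div, le_div_iff₀ hΘ]
      constructor <;> intro h <;> linarith
    rw [sharpSymbol, Set.indicator_apply, Set.indicator_apply]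
    simp only [Set.mem_ofPred_eq, h1]
    split_ifs <;> simp
  · rw [Set.indicator_apply]
    split_ifs <;> simp

section sharp

variable {χ : SchwartzMap Plane ℂ}

/-- By continuity, a cutoff also vanishes on the sphere of radius `4/3`, which the sharp projection
may meet. -/
theorem IsCutoff.eq_zero_of_le (hχ : IsCutoff χ) {ξ : Plane} (hξ : 4 / 3 ≤ ‖ξ‖) : χ ξ = 0 := by
  have h1 : Tendsto (fun n : ℕ => χ ((1 + 1 / ((n : ℝ) + 1)) • ξ)) atTop (𝓝 (χ ξ)) := by
    have h2 : Tendsto (fun n : ℕ => (1 + 1 / ((n : ℝ) + 1)) • ξ) atTop (𝓝 ((1 + 0 : ℝ) • ξ)) :=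
      ((tendsto_one_div_add_atTop_nhds_zero_nat (𝕜 := ℝ)).const_add 1).smul_const ξ
    rw [add_zero, one_smul] at h2
    exact (χ.continuous.tendsto ξ).comp h2
  refine tendsto_nhds_unique h1 ?_
  have h3 : ∀ n : ℕ, χ ((1 + 1 / ((n : ℝ) + 1)) • ξ) = 0 := by
    intro n
    refine hχ.eq_zero _ ?_
    have h4 : 0 < 1 / ((n : ℝ) + 1) := by positivity
    rw [norm_smul, Real.norm_of_nonneg (by positivity)]
    nlinarith
  simp only [h3]
  exact tendsto_const_nhds

/-- The sharp projection removes the range of `P_{16a}`, whose frequencies are at most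
`4 / (3 · 16 a) = 1 / (12 a)`. -/
theorem IsCutoff.low_sharp (hχ : IsCutoff χ) {a : ℝ} (ha : 0 < a) (f : L2 ℂ) :
    mult (dil (16 * a) χ) (mult (sharpSymbol a) f) = 0 := by
  rw [mult_mult ((dil _ χ).memLp_top volume) (memLp_sharpSymbol a)]
  have h1 : (fun ξ => dil (16 * a) χ ξ * sharpSymbol a ξ) = fun _ => 0 := by
    ext ξ
    rw [sharpSymbol, Set.indicator_apply]
    split_ifs with h
    · rw [dil_apply (by positivity), hχ.eq_zero_of_le, zero_mul]
      rw [norm_smul, Real.norm_of_nonneg (by positivity)]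
      simp only [Set.mem_ofPred_eq] at h
      linarith
    · rw [mul_zero]
  rw [h1]
  refine mult_eq_of_fourier (memLp_top_const 0) ?_
  have h2 : (𝓕 (0 : L2 ℂ) : L2 ℂ) = 0 := (Lp.fourierTransformₗᵢ Plane ℂ).map_zero
  rw [h2]
  filter_upwards [Lp.coeFn_zero ℂ 2 (volume : Measure Plane)] with ξ h3
  rw [h3, zero_mul]; rfl

theorem mult_one_sub (s : Plane → ℂ) (hs : MemLp s ⊤ (volume : Measure Plane)) (f : L2 ℂ) :
    mult (fun ξ => 1 - s ξ) f = f - mult s f := by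
  rw [mult_sub_symbol (memLp_top_const 1) hs, mult_one]

/-- What the sharp projection removes lies in the range of `P_{8a}`, as `1 / 12 < 1 / 8`. -/
theorem IsCutoff.low_sub_sharp (hχ : IsCutoff χ) {a : ℝ} (ha : 0 < a) (f : L2 ℂ) :
    mult (dil (8 * a) χ) (f - mult (sharpSymbol a) f) = f - mult (sharpSymbol a) f := by
  have hm : MemLp (fun ξ => 1 - sharpSymbol a ξ) ⊤ volume :=
    (memLp_top_const 1).sub (memLp_sharpSymbol a)
  rw [← mult_one_sub _ (memLp_sharpSymbol a), mult_mult ((dil _ χ).memLp_top volume) hm]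
  congr 2
  ext ξ
  rw [sharpSymbol, Set.indicator_apply]
  split_ifs with h
  · simp
  · rw [hχ.dil_eq_one (by positivity), one_mul]
    simp only [Set.mem_ofPred_eq, not_le] at h
    linarith

end sharp

/-! ### Fluxes beyond the threshold -/

theorem exponentM_inv_add {m : ℝ≥0∞} (hm : 2 ≤ m) : (exponentM m)⁻¹ + 2⁻¹ + m⁻¹ = 1 := by
  have h1 : m⁻¹ ≤ 2⁻¹ := ENNReal.inv_le_inv.2 hm
  rw [exponentM, inv_inv, add_right_comm, tsub_add_cancel_of_le h1, ENNReal.inv_two_add_inv_two]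

theorem one_le_exponentM (m : ℝ≥0∞) : 1 ≤ exponentM m := by
  rw [exponentM, ENNReal.one_le_inv]
  exact tsub_le_self.trans (ENNReal.inv_le_one.2 one_le_two)

theorem exponentQ_inv (q : ℝ≥0∞) : (exponentQ q)⁻¹ = 2⁻¹ * (1 - q⁻¹) := by
  rw [exponentQ, ENNReal.mul_inv (Or.inl two_ne_zero) (Or.inl ENNReal.ofNat_ne_top), inv_inv]

theorem exponentQ_inv_add {q : ℝ≥0∞} (hq : 2 ≤ q) :
    (exponentQ q)⁻¹ + (exponentQ q)⁻¹ + q⁻¹ = 1 := by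
  have h1 : q⁻¹ ≤ 1 := ENNReal.inv_le_one.2 (one_le_two.trans hq)
  rw [exponentQ_inv, ← add_mul, ENNReal.inv_two_add_inv_two, one_mul, tsub_add_cancel_of_le h1]

theorem one_le_exponentQ (q : ℝ≥0∞) : 1 ≤ exponentQ q := by
  rw [← ENNReal.inv_le_one, exponentQ_inv]
  exact mul_le_one' (ENNReal.inv_le_one.2 one_le_two) tsub_le_self

theorem FourierDivFree.sharp {H : Fin 2 → L2 ℂ} (hH : FourierDivFree H) (a : ℝ) :
    FourierDivFree fun j => _root_.mult (sharpSymbol a) (H j) :=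
  hH.mult (memLp_sharpSymbol a)

theorem FourierDivFree.sub_sharp {H : Fin 2 → L2 ℂ} (hH : FourierDivFree H) (a : ℝ) :
    FourierDivFree fun j => H j - _root_.mult (sharpSymbol a) (H j) := by
  have h1 : MemLp (fun ξ => 1 - sharpSymbol a ξ) ⊤ volume :=
    (memLp_top_const 1).sub (memLp_sharpSymbol a)
  have h2 := hH.mult h1
  simpa only [mult_one_sub _ (memLp_sharpSymbol a)] using h2

namespace IsCutoff

variable {χ : SchwartzMap Plane ℂ}

theorem enorm_flux_self_le_sharp (hχ : IsCutoff χ) {a : ℝ} (ha : 0 < a) {H : Fin 2 → L2 ℂ}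
    (hH : FourierDivFree H) (g : L2 ℂ) {p r m q : ℝ≥0∞} (hp : 1 ≤ p) (hm : 1 ≤ m)
    (h : p⁻¹ + 2⁻¹ + m⁻¹ = 1) (h' : r⁻¹ + r⁻¹ + q⁻¹ = 1) :
    ‖flux χ a H g g‖ₑ ≤
      cutoffConst χ * (∑ j, diffNorm (H j) q) *
        eLpNorm (mult (dil (a / 2) χ) g - mult (dil (2 * a) χ) g : L2 ℂ) r volume ^ 2 +
      80 * cutoffConst χ ^ 3 * (∑ j, diffNorm (mult (sharpSymbol a) (H j)) m) *
        (eLpNorm g p volume * eLpNorm (g - mult (dil a χ) g : L2 ℂ) 2 volume) := by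
  have h1 := hχ.enorm_flux_self_le_total ha (hH.sharp a) (hH.sub_sharp a)
    (fun j => hχ.low_sub_sharp ha (H j)) (fun j => hχ.low_sharp ha (H j)) g hp hm h h'
  simpa only [add_sub_cancel] using h1

/-- The part of a field at frequencies below the sharp cutoff is Lipschitz continuous. -/
theorem exists_diffNorm_sub_sharp_le (hχ : IsCutoff χ) {a : ℝ} (ha : 0 < a) :
    ∃ C : ℝ≥0, ∀ f : L2 ℂ, diffNorm (f - mult (sharpSymbol a) f : L2 ℂ) ⊤ ≤ C * ‖f‖ₑ := by
  obtain ⟨C, hC⟩ := diffNorm_mult_top_le (dil (8 * a) χ)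
  refine ⟨C * 2, fun f => ?_⟩
  have h1 := hC (f - mult (sharpSymbol a) f)
  rw [hχ.low_sub_sharp ha, eLpNorm_two_eq] at h1
  refine h1.trans ?_
  rw [ENNReal.coe_mul, mul_assoc]
  refine mul_le_mul_right ((enorm_sub_le).trans ?_) _
  rw [ENNReal.coe_ofNat, two_mul]
  refine add_le_add le_rfl ?_
  rw [← ofReal_norm, ← ofReal_norm]
  refine ENNReal.ofReal_le_ofReal ?_
  simpa using norm_mult_le (memLp_sharpSymbol a) (norm_sharpSymbol_le a) f

theorem eLpNorm_low_add_le (χ : SchwartzMap Plane ℂ) {a : ℝ} (ha : 0 < a) (g : L2 ℂ) {p : ℝ≥0∞}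
    (hp : 1 ≤ p) :
    eLpNorm (mult (dil a χ) g + g : L2 ℂ) p volume ≤ (cutoffConst χ + 1) * eLpNorm g p volume := by
  rw [eLpNorm_congr_ae (Lp.coeFn_add _ _), add_mul, one_mul]
  exact (eLpNorm_add_le (Lp.aestronglyMeasurable _) (Lp.aestronglyMeasurable _) hp).trans
    (add_le_add (eLpNorm_low_le χ ha g hp) le_rfl)

/-- A bound for the fluxes through all the thresholds beyond `1 / a`; the constant `C` is that of
`exists_diffNorm_sub_sharp_le`. -/
theorem enorm_flux_self_le_uniform (hχ : IsCutoff χ) {a : ℝ} (ha : 0 < a) {C : ℝ≥0}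
    (hC : ∀ f : L2 ℂ, diffNorm (f - mult (sharpSymbol a) f : L2 ℂ) ⊤ ≤ C * ‖f‖ₑ)
    {H : Fin 2 → L2 ℂ} (hH : FourierDivFree H) (g : L2 ℂ) {p m : ℝ≥0∞} (hp : 1 ≤ p)
    (h : p⁻¹ + 2⁻¹ + m⁻¹ = 1) (n : ℕ) :
    ‖flux χ (a / 2 ^ (n + 1)) H g g‖ₑ ≤ cutoffConst χ * (cutoffConst χ + 1) *
      ((∑ j, diffNorm (mult (sharpSymbol a) (H j)) m) * eLpNorm g p volume *
          ‖g - mult (dil a χ) g‖ₑ +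
        C * (∑ j, ‖H j‖ₑ) * ‖g‖ₑ * ‖g - mult (dil a χ) g‖ₑ) := by
  have h5 : (2 : ℝ) ≤ 2 ^ (n + 1) := by
    calc (2 : ℝ) = 2 ^ 1 := by norm_num
      _ ≤ 2 ^ (n + 1) := pow_le_pow_right₀ (by norm_num) (by lia)
  have h6 : a / 2 ^ (n + 1) ≤ a / 2 := by gcongr
  have hb : 0 < a / 2 ^ (n + 1) := by positivity
  have h1 := hχ.two_mul_flux_eq ha hb (by linarith) hH g
  have h2 := hχ.enorm_flux_symm_le hb (fun j => mult (sharpSymbol a) (H j))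
    (fun j => H j - mult (sharpSymbol a) (H j)) (mult (dil a χ) g + g) (g - mult (dil a χ) g) h
  simp only [add_sub_cancel] at h2
  rw [← h1, eLpNorm_two_eq (g - mult (dil a χ) g)] at h2
  have h3 : ‖flux χ (a / 2 ^ (n + 1)) H g g‖ₑ ≤ ‖2 * flux χ (a / 2 ^ (n + 1)) H g g‖ₑ := by
    rw [← ofReal_norm, ← ofReal_norm, norm_mul, Complex.norm_ofNat]
    exact ENNReal.ofReal_le_ofReal (le_mul_of_one_le_left (norm_nonneg _) one_le_two)
  refine h3.trans (h2.trans ?_)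
  have e1 := eLpNorm_low_add_le χ ha g hp
  have e2 := eLpNorm_low_add_le χ ha g one_le_two
  rw [eLpNorm_two_eq g] at e2
  have e3 : ∑ j, diffNorm (H j - mult (sharpSymbol a) (H j) : L2 ℂ) ⊤ ≤ C * ∑ j, ‖H j‖ₑ := by
    rw [Finset.mul_sum]
    exact Finset.sum_le_sum fun j _ => hC (H j)
  calc _ ≤ cutoffConst χ * ((∑ j, diffNorm (mult (sharpSymbol a) (H j)) m) *
          ((cutoffConst χ + 1) * eLpNorm g p volume) +
        C * (∑ j, ‖H j‖ₑ) * ((cutoffConst χ + 1) * ‖g‖ₑ)) * ‖g - mult (dil a χ) g‖ₑ := by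
        gcongr
    _ = _ := by ring

/-- If the part of `g` above the threshold vanishes so do all the fluxes beyond it; otherwise the
hypothesis bounds the other two factors. -/
theorem tendsto_flux_self_sharp (hχ : IsCutoff χ) {a : ℝ} (ha : 0 < a) {C : ℝ≥0}
    (hC : ∀ f : L2 ℂ, diffNorm (f - mult (sharpSymbol a) f : L2 ℂ) ⊤ ≤ C * ‖f‖ₑ)
    {H : Fin 2 → L2 ℂ} (hH : FourierDivFree H) (g : L2 ℂ) {p m : ℝ≥0∞} (hp : 1 ≤ p)
    (h : p⁻¹ + 2⁻¹ + m⁻¹ = 1)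
    (hfin : (∑ j, diffNorm (mult (sharpSymbol a) (H j)) m) * eLpNorm g p volume *
          ‖g - mult (dil a χ) g‖ₑ ≠ ⊤) :
    Tendsto (fun n : ℕ => flux χ (a / 2 ^ (n + 1)) H g g) atTop (𝓝 0) := by
  rcases eq_or_ne (g - mult (dil a χ) g) 0 with h0 | h0
  · have h1 : ∀ n, flux χ (a / 2 ^ (n + 1)) H g g = 0 := by
      intro n
      have h2 := hχ.enorm_flux_self_le_uniform ha hC hH g hp h n
      simpa [h0] using h2
    simp only [h1]
    exact tendsto_const_nhds
  · have hBP : (∑ j, diffNorm (mult (sharpSymbol a) (H j)) m) * eLpNorm g p volume ≠ ⊤ := by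
      intro htop
      rw [htop, ENNReal.top_mul (by simpa using h0)] at hfin
      exact hfin rfl
    have h1 := hχ.tendsto_flux_self ha (H' := fun j => mult (sharpSymbol a) (H j))
      (H'' := fun j => H j - mult (sharpSymbol a) (H j)) (by simpa only [add_sub_cancel] using hH)
      g h ?_
    · simp only [add_sub_cancel] at h1
      exact (tendsto_add_atTop_iff_nat 1).2 h1
    · have e1 := eLpNorm_low_add_le χ ha g hp
      have e3 : ∑ j, diffNorm (H j - mult (sharpSymbol a) (H j) : L2 ℂ) ⊤ ≤ C * ∑ j, ‖H j‖ₑ := by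
        rw [Finset.mul_sum]
        exact Finset.sum_le_sum fun j _ => hC (H j)
      refine ENNReal.mul_ne_top (cutoffConst_ne_top χ) (ENNReal.add_ne_top.2 ⟨?_, ?_⟩)
      · refine ne_top_of_le_ne_top (ENNReal.mul_ne_top (a := cutoffConst χ + 1)
          (ENNReal.add_ne_top.2 ⟨cutoffConst_ne_top χ, ENNReal.one_ne_top⟩) hBP) ?_
        calc _ ≤ (∑ j, diffNorm (mult (sharpSymbol a) (H j)) m) *
              ((cutoffConst χ + 1) * eLpNorm g p volume) := by gcongr
          _ = _ := by ring
      · rw [eLpNorm_two_eq]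
        refine ENNReal.mul_ne_top (ne_top_of_le_ne_top (ENNReal.mul_ne_top ENNReal.coe_ne_top
          (ENNReal.sum_ne_top.2 fun j _ => enorm_ne_top)) e3) enorm_ne_top

set_option synthInstance.maxHeartbeats 200000 in
theorem aestronglyMeasurable_flux (χ : SchwartzMap Plane ℂ) (a : ℝ) {μ : Measure ℝ}
    {H : Fin 2 → ℝ → L2 ℂ} {G : ℝ → L2 ℂ}
    (hG : AEStronglyMeasurable G μ) (hH : ∀ j, AEStronglyMeasurable (H j) μ) :
    AEStronglyMeasurable (fun τ => flux χ a (fun j => H j τ) (G τ) (G τ)) μ := by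
  unfold flux
  refine Finset.aestronglyMeasurable_fun_sum _ fun j _ => ?_
  have h1 := (tripleFunctional (derivSymbol j (dil a χ))).aestronglyMeasurable_comp₂ hG (hH j)
  exact isBoundedBilinearMap_apply.continuous.comp_aestronglyMeasurable (h1.prodMk hG)

/-- As the threshold tends to infinity, only the force remains in the energy balance. Dominated
convergence applies as the fluxes are bounded by `enorm_flux_self_le_uniform`, whose first term is
integrable by assumption, and the second one as `G` is bounded and `H` integrable in time. -/
theorem tendsto_integral_energy (hχ : IsCutoff χ) {a : ℝ} (ha : 0 < a) {μ : Measure ℝ}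
    {H : Fin 2 → ℝ → L2 ℂ} {F G : ℝ → L2 ℂ}
    (hG : AEStronglyMeasurable G μ) {M : ℝ} (hGM : ∀ᵐ τ ∂μ, ‖G τ‖ ≤ M)
    (hH : ∀ j, Integrable (H j) μ) (hF : Integrable F μ)
    (hdiv : ∀ᵐ τ ∂μ, FourierDivFree fun j => H j τ) {p m : ℝ≥0∞} (hp : 1 ≤ p)
    (h : p⁻¹ + 2⁻¹ + m⁻¹ = 1)
    (hfin : ∫⁻ τ, (∑ j, diffNorm (mult (sharpSymbol a) (H j τ)) m) * eLpNorm (G τ) p volume *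
          ‖G τ - mult (dil a χ) (G τ)‖ₑ ∂μ ≠ ⊤) :
    Tendsto (fun n : ℕ => ∫ τ, 2 * (flux χ (a / 2 ^ (n + 1)) (fun j => H j τ) (G τ) (G τ) +
        inner ℂ (F τ) (mult (dil (a / 2 ^ (n + 1)) χ) (G τ))).re ∂μ) atTop
      (𝓝 (∫ τ, 2 * (inner ℂ (F τ) (G τ)).re ∂μ)) := by
  obtain ⟨C, hC⟩ := hχ.exists_diffNorm_sub_sharp_le ha
  set Y : ℝ → L2 ℂ := fun τ => G τ - mult (dil a χ) (G τ) with hY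
  have hYm : AEStronglyMeasurable Y μ :=
    hG.sub ((mult (dil a χ)).continuous.comp_aestronglyMeasurable hG)
  set X : ℝ → ℝ≥0∞ := fun τ => (∑ j, diffNorm (mult (sharpSymbol a) (H j τ)) m) *
    eLpNorm (G τ) p volume * ‖Y τ‖ₑ with hX
  have hXm : AEMeasurable X μ := by
    refine ((Finset.aemeasurable_fun_sum _ fun j _ => ?_).mul ?_).mul hYm.enorm
    · exact AEMeasurable.of_lowerSemicontinuous (lowerSemicontinuous_diffNorm m)
        ((mult (sharpSymbol a)).continuous.comp_aestronglyMeasurable (hH j).1)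
    · exact AEMeasurable.of_lowerSemicontinuous (lowerSemicontinuous_eLpNorm p) hG
  have hYle : ∀ τ, ‖Y τ‖ ≤ 2 * ‖G τ‖ := fun τ => by
    rw [two_mul]
    exact (norm_sub_le _ _).trans (add_le_add le_rfl (hχ.norm_low_le ha _))
  set Z : ℝ → ℝ≥0∞ := fun τ => C * (∑ j, ‖H j τ‖ₑ) * ‖G τ‖ₑ * ‖Y τ‖ₑ with hZ
  have hZm : AEMeasurable Z μ :=
    (((Finset.aemeasurable_fun_sum _ fun j _ => (hH j).1.enorm).const_mul _).mul hG.enorm).mul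
      hYm.enorm
  have hZfin : ∫⁻ τ, Z τ ∂μ ≠ ⊤ := by
    refine ne_top_of_le_ne_top (b := ∫⁻ τ, (C * ENNReal.ofReal M * ENNReal.ofReal (2 * M)) *
      (∑ j, ‖H j τ‖ₑ) ∂μ) ?_ (lintegral_mono_ae ?_)
    · rw [lintegral_const_mul'' _ (Finset.aemeasurable_fun_sum _ fun j _ => (hH j).1.enorm),
        lintegral_finsetSum' _ fun j _ => (hH j).1.enorm]
      exact ENNReal.mul_ne_top (by finiteness) (ENNReal.sum_ne_top.2 fun j _ => (hH j).2.ne)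
    · filter_upwards [hGM] with τ hτ
      have e1 : ‖G τ‖ₑ ≤ ENNReal.ofReal M := by
        rw [← ofReal_norm]; exact ENNReal.ofReal_le_ofReal hτ
      have e2 : ‖Y τ‖ₑ ≤ ENNReal.ofReal (2 * M) := by
        rw [← ofReal_norm]; exact ENNReal.ofReal_le_ofReal ((hYle τ).trans (by linarith))
      calc Z τ ≤ C * (∑ j, ‖H j τ‖ₑ) * ENNReal.ofReal M * ENNReal.ofReal (2 * M) := by
            simp only [hZ]; gcongr
        _ = _ := by ring
  set D : ℝ → ℝ≥0∞ := fun τ => cutoffConst χ * (cutoffConst χ + 1) * (X τ + Z τ) with hD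
  have hDm : AEMeasurable D μ := (hXm.add hZm).const_mul _
  have hDfin : ∫⁻ τ, D τ ∂μ ≠ ⊤ := by
    have h1 : ∫⁻ τ, D τ ∂μ = cutoffConst χ * (cutoffConst χ + 1) *
        (∫⁻ τ, X τ ∂μ + ∫⁻ τ, Z τ ∂μ) := by
      rw [← lintegral_add_left' hXm]
      exact lintegral_const_mul'' _ (hXm.add hZm)
    rw [h1]
    have := cutoffConst_ne_top χ
    finiteness
  have hPm : ∀ n : ℕ, AEStronglyMeasurable (fun τ => mult (dil (a / 2 ^ (n + 1)) χ) (G τ)) μ :=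
    fun n => (mult _).continuous.comp_aestronglyMeasurable hG
  refine tendsto_integral_of_dominated_convergence
    (fun τ => 2 * ((D τ).toReal + M * ‖F τ‖)) (fun n => ?_)
    (((integrable_toReal_of_lintegral_ne_top hDm hDfin).add (hF.norm.const_mul M)).const_mul 2)
    (fun n => ?_) ?_
  · exact (Complex.continuous_re.comp_aestronglyMeasurable
      ((aestronglyMeasurable_flux χ _ hG fun j => (hH j).1).add (hF.1.inner (hPm n)))).const_mul 2
  · filter_upwards [ae_lt_top' hDm hDfin, hGM, hdiv] with τ h1 h2 h3
    rw [norm_mul, Real.norm_ofNat]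
    refine mul_le_mul_of_nonneg_left ?_ two_pos.le
    refine (Complex.abs_re_le_norm _).trans ((norm_add_le _ _).trans (add_le_add ?_ ?_))
    · have h4 := ENNReal.toReal_mono h1.ne
        (hχ.enorm_flux_self_le_uniform ha hC h3 (G τ) hp h n)
      rwa [toReal_enorm] at h4
    · refine (norm_inner_le_norm _ _).trans ?_
      rw [mul_comm]
      gcongr
      exact (hχ.norm_low_le (by positivity) _).trans h2
  · filter_upwards [ae_lt_top' hXm hfin, hdiv] with τ h1 h3
    have h4 := hχ.tendsto_flux_self_sharp ha hC h3 (G τ) hp h h1.ne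
    have h5 := (tendsto_add_atTop_iff_nat 1).2 (hχ.tendsto_low ha (G τ))
    have h6 := h4.add ((tendsto_const_nhds (x := F τ)).inner (𝕜 := ℂ) h5)
    rw [zero_add] at h6
    exact ((Complex.continuous_re.tendsto _).comp h6).const_mul 2

end IsCutoff

/-! ### The energy inequality for the high frequencies -/

namespace IsCutoff

variable {χ : SchwartzMap Plane ℂ}

/-- The energy balance for the high frequencies of a weak solution, as the difference of the
balances for the total energy (the limit of infinite thresholds) and for the low frequencies. -/
theorem energy_balance_high (hχ : IsCutoff χ) {a : ℝ} (ha : 0 < a) {T : ℝ} {h : ℝ → L2 Plane}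
    {F g : ℝ → L2 ℝ} {g₀ : L2 ℝ} (hsol : IsWeakTransportSolution T h F g g₀)
    (hh : IntegrableOn h (Set.Icc 0 T) volume)
    (hdiv : ∀ᵐ τ ∂volume.restrict (Set.Icc 0 T), IsDivergenceFree (h τ))
    (hF : IntegrableOn F (Set.Icc 0 T) volume)
    (hg : AEStronglyMeasurable g (volume.restrict (Set.Icc 0 T))) (hg2 : IsEssBoundedInLp T g 2)
    {p m : ℝ≥0∞} (hp : 1 ≤ p) (hpm : p⁻¹ + 2⁻¹ + m⁻¹ = 1) {t : ℝ} (ht : t ∈ Set.Icc 0 T)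
    (hfin : ∫⁻ τ in Set.Icc 0 t,
      (∑ j, diffNorm (mult (sharpSymbol a) (fieldComp j (h τ))) m) *
        eLpNorm (toComplex (g τ)) p volume *
        ‖toComplex (g τ) - mult (dil a χ) (toComplex (g τ))‖ₑ ≠ ⊤)
    (hflux : Integrable (fun τ => flux χ a (fun j => fieldComp j (h τ)) (toComplex (g τ))
      (toComplex (g τ))) (volume.restrict (Set.Icc 0 t))) :
    (inner ℂ (toComplex (g t)) (toComplex (g t) - mult (dil a χ) (toComplex (g t)))).re =
      (inner ℂ (toComplex g₀) (toComplex g₀ - mult (dil a χ) (toComplex g₀))).re +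
      ∫ τ in Set.Icc 0 t, 2 * (inner ℂ (toComplex (F τ))
        (toComplex (g τ) - mult (dil a χ) (toComplex (g τ))) -
        flux χ a (fun j => fieldComp j (h τ)) (toComplex (g τ)) (toComplex (g τ))).re := by
  obtain ⟨M, hM⟩ := hg2
  have hsub : volume.restrict (Set.Icc 0 t) ≤ volume.restrict (Set.Icc 0 T) :=
    Measure.restrict_mono (Set.Icc_subset_Icc_right ht.2) le_rfl
  have hG : AEStronglyMeasurable (fun τ => toComplex (g τ)) (volume.restrict (Set.Icc 0 T)) :=
    toComplex.continuous.comp_aestronglyMeasurable hg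
  have hH : ∀ j, Integrable (fun τ => fieldComp j (h τ)) (volume.restrict (Set.Icc 0 T)) :=
    fun j => (fieldComp j).integrable_comp hh
  have hFc : Integrable (fun τ => toComplex (F τ)) (volume.restrict (Set.Icc 0 T)) :=
    toComplex.integrable_comp hF
  have hGM : ∀ᵐ τ ∂volume.restrict (Set.Icc 0 T), ‖toComplex (g τ)‖ ≤ M := by
    filter_upwards [hM] with τ hτ
    rw [← eLpNorm_toComplex, eLpNorm_two_eq, ← ofReal_norm] at hτ
    exact (ENNReal.ofReal_le_ofReal_iff M.coe_nonneg).1 (by rwa [ENNReal.ofReal_coe_nnreal])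
  have hGH : ∀ j, IntegrableOn (fun τ => ‖toComplex (g τ)‖ * ‖fieldComp j (h τ)‖)
      (Set.Icc 0 T) volume := fun j =>
    (hH j).norm.bdd_mul (c := M) hG.norm (by
      filter_upwards [hGM] with τ hτ
      rwa [norm_norm])
  have hid := fun {b : ℝ} (hb : 0 < b) =>
    hχ.energy_identity hb hsol hG (fun j => (hH j).1) hGH hFc ht
  have hdiv' : ∀ᵐ τ ∂volume.restrict (Set.Icc 0 t), FourierDivFree fun j => fieldComp j (h τ) :=
    (ae_mono hsub) (hdiv.mono fun τ hτ => IsDivergenceFree.fourierDivFree hχ hτ)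
  have hlim := hχ.tendsto_integral_energy ha (hG.mono_measure hsub) ((ae_mono hsub) hGM)
    (fun j => (hH j).mono_measure hsub) (hFc.mono_measure hsub) hdiv' hp hpm hfin
  have hE : ∀ f : L2 ℂ, Tendsto (fun n : ℕ => (inner ℂ f (mult (dil (a / 2 ^ (n + 1)) χ) f)).re)
      atTop (𝓝 (inner ℂ f f).re) := fun f =>
    (Complex.continuous_re.tendsto _).comp ((tendsto_const_nhds (x := f)).inner (𝕜 := ℂ)
      ((tendsto_add_atTop_iff_nat 1).2 (hχ.tendsto_low ha f)))
  have htotal : (inner ℂ (toComplex (g t)) (toComplex (g t))).re =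
      (inner ℂ (toComplex g₀) (toComplex g₀)).re +
        ∫ τ in Set.Icc 0 t, 2 * (inner ℂ (toComplex (F τ)) (toComplex (g τ))).re := by
    refine tendsto_nhds_unique (hE (toComplex (g t))) ?_
    refine ((hE (toComplex g₀)).add hlim).congr fun n => ?_
    exact (hid (b := a / 2 ^ (n + 1)) (by positivity)).symm
  have hinner : ∀ A : L2 ℂ →L[ℂ] L2 ℂ, (∀ f, ‖A f‖ ≤ ‖f‖) → Integrable
      (fun τ => inner ℂ (toComplex (F τ)) (A (toComplex (g τ)))) (volume.restrict (Set.Icc 0 t)) := by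
    intro A hA
    refine (Integrable.mono' (hFc.norm.const_mul (M : ℝ))
      (hFc.1.inner (A.continuous.comp_aestronglyMeasurable hG)) ?_).mono_measure hsub
    filter_upwards [hGM] with τ hτ
    refine (norm_inner_le_norm _ _).trans ?_
    rw [mul_comm]
    gcongr
    exact (hA _).trans hτ
  have i1 := (hinner (ContinuousLinearMap.id ℂ _) fun f => le_rfl).re.const_mul 2
  have i2 := ((hflux.add (hinner (mult (dil a χ)) (hχ.norm_low_le ha))).re).const_mul 2
  have h0 := hid ha
  have h1 : ∫ τ in Set.Icc 0 t, 2 * (inner ℂ (toComplex (F τ))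
        (toComplex (g τ) - mult (dil a χ) (toComplex (g τ))) -
        flux χ a (fun j => fieldComp j (h τ)) (toComplex (g τ)) (toComplex (g τ))).re =
      (∫ τ in Set.Icc 0 t, 2 * (inner ℂ (toComplex (F τ)) (toComplex (g τ))).re) -
      ∫ τ in Set.Icc 0 t, 2 * (flux χ a (fun j => fieldComp j (h τ)) (toComplex (g τ))
        (toComplex (g τ)) + inner ℂ (toComplex (F τ)) (mult (dil a χ) (toComplex (g τ)))).re := by
    refine Eq.trans ?_ (integral_sub i1 i2)
    refine integral_congr_ae (ae_of_all _ fun τ => ?_)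
    beta_reduce
    rw [inner_sub_right, Complex.sub_re, Complex.sub_re, Complex.add_re]
    ring
  rw [h1]
  simp only [inner_sub_right, Complex.sub_re]
  linarith

end IsCutoff

namespace IsLittlewoodPaleyPair

variable {ψ φ : Plane → ℝ}

theorem inner_self_high (h : IsLittlewoodPaleyPair ψ φ) {a : ℝ} (ha : 0 < a) (f : L2 ℂ) :
    (inner ℂ f (f - mult (dil a h.cutoff) f)).re = ‖mult (highSymbol ψ a) f‖ ^ 2 := by
  rw [← h.inner_high ha]
  exact inner_self_eq_norm_sq (𝕜 := ℂ) _

/-- The energy inequality for the high frequencies, with the flux through the frequency `1 / a`.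
The flux need not be assumed integrable, as the bound is trivial otherwise. -/
theorem energy_inequality (hψφ : IsLittlewoodPaleyPair ψ φ) {a : ℝ} (ha : 0 < a) {T : ℝ}
    {h : ℝ → L2 Plane} {F g : ℝ → L2 ℝ} {g₀ : L2 ℝ} (hsol : IsWeakTransportSolution T h F g g₀)
    (hh : IntegrableOn h (Set.Icc 0 T) volume)
    (hdiv : ∀ᵐ τ ∂volume.restrict (Set.Icc 0 T), IsDivergenceFree (h τ))
    (hF : IntegrableOn F (Set.Icc 0 T) volume)
    (hg : AEStronglyMeasurable g (volume.restrict (Set.Icc 0 T))) (hg2 : IsEssBoundedInLp T g 2)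
    {p m : ℝ≥0∞} (hp : 1 ≤ p) (hpm : p⁻¹ + 2⁻¹ + m⁻¹ = 1) {t : ℝ} (ht : t ∈ Set.Icc 0 T)
    (hfin : ∫⁻ τ in Set.Icc 0 t,
      (∑ j, diffNorm (mult (sharpSymbol a) (fieldComp j (h τ))) m) *
        eLpNorm (toComplex (g τ)) p volume *
        ‖toComplex (g τ) - mult (dil a hψφ.cutoff) (toComplex (g τ))‖ₑ ≠ ⊤) :
    2⁻¹ * ‖mult (highSymbol ψ a) (toComplex (g t))‖ₑ ^ 2 ≤
      2⁻¹ * ‖mult (highSymbol ψ a) (toComplex g₀)‖ₑ ^ 2 +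
      (∫⁻ τ in Set.Icc 0 t, ‖mult (highSymbol ψ a) (toComplex (F τ))‖ₑ *
        ‖mult (highSymbol ψ a) (toComplex (g τ))‖ₑ) +
      ∫⁻ τ in Set.Icc 0 t, ‖flux hψφ.cutoff a (fun j => fieldComp j (h τ)) (toComplex (g τ))
        (toComplex (g τ))‖ₑ := by
  have hsub : volume.restrict (Set.Icc 0 t) ≤ volume.restrict (Set.Icc 0 T) :=
    Measure.restrict_mono (Set.Icc_subset_Icc_right ht.2) le_rfl
  have hfm : AEStronglyMeasurable (fun τ => flux hψφ.cutoff a (fun j => fieldComp j (h τ))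
      (toComplex (g τ)) (toComplex (g τ))) (volume.restrict (Set.Icc 0 t)) :=
    (IsCutoff.aestronglyMeasurable_flux hψφ.cutoff a
      (toComplex.continuous.comp_aestronglyMeasurable hg)
      fun j => (fieldComp j).continuous.comp_aestronglyMeasurable hh.1).mono_measure hsub
  by_cases hflux : ∫⁻ τ in Set.Icc 0 t, ‖flux hψφ.cutoff a (fun j => fieldComp j (h τ))
      (toComplex (g τ)) (toComplex (g τ))‖ₑ = ⊤
  · rw [hflux, add_top]; exact le_top
  have key := hψφ.isCutoff.energy_balance_high ha hsol hh hdiv hF hg hg2 hp hpm ht hfin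
    ⟨hfm, lt_top_iff_ne_top.2 hflux⟩
  rw [hψφ.inner_self_high ha, hψφ.inner_self_high ha] at key
  set S := mult (highSymbol ψ a)
  set I := ∫ τ in Set.Icc 0 t, 2 * (inner ℂ (toComplex (F τ))
        (toComplex (g τ) - mult (dil a hψφ.cutoff) (toComplex (g τ))) -
        flux hψφ.cutoff a (fun j => fieldComp j (h τ)) (toComplex (g τ)) (toComplex (g τ))).re
    with hI
  have hIle : ‖I‖ₑ ≤ 2 * ((∫⁻ τ in Set.Icc 0 t, ‖S (toComplex (F τ))‖ₑ * ‖S (toComplex (g τ))‖ₑ) +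
      ∫⁻ τ in Set.Icc 0 t, ‖flux hψφ.cutoff a (fun j => fieldComp j (h τ)) (toComplex (g τ))
        (toComplex (g τ))‖ₑ) := by
    rw [← lintegral_add_right' _ hfm.enorm, ← lintegral_const_mul' _ _ ENNReal.ofNat_ne_top]
    refine (enorm_integral_le_lintegral_enorm _).trans (lintegral_mono fun τ => ?_)
    beta_reduce
    rw [enorm_mul, ← hψφ.inner_high ha]
    gcongr
    · rw [← ofReal_norm]; simp
    · refine (?_ : _ ≤ ‖inner ℂ (S (toComplex (F τ))) (S (toComplex (g τ))) -
        flux hψφ.cutoff a (fun j => fieldComp j (h τ)) (toComplex (g τ)) (toComplex (g τ))‖ₑ).trans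
        ((enorm_sub_le).trans (add_le_add ?_ le_rfl))
      · rw [← ofReal_norm, ← ofReal_norm]
        exact ENNReal.ofReal_le_ofReal (Complex.abs_re_le_norm _)
      · rw [← ofReal_norm, ← ofReal_norm, ← ofReal_norm, ← ENNReal.ofReal_mul (norm_nonneg _)]
        exact ENNReal.ofReal_le_ofReal (norm_inner_le_norm _ _)
  have hsq : ∀ f : L2 ℂ, ‖S f‖ₑ ^ 2 = ENNReal.ofReal (‖S f‖ ^ 2) := fun f => by
    rw [ENNReal.ofReal_pow (norm_nonneg _), ofReal_norm]
  have h1 : ‖S (toComplex (g t))‖ₑ ^ 2 ≤ ‖S (toComplex g₀)‖ₑ ^ 2 + ‖I‖ₑ := by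
    rw [hsq, hsq, key, ← ofReal_norm, ← ENNReal.ofReal_add (by positivity) (norm_nonneg _)]
    exact ENNReal.ofReal_le_ofReal (add_le_add le_rfl (Real.le_norm_self I))
  calc _ ≤ 2⁻¹ * (‖S (toComplex g₀)‖ₑ ^ 2 + 2 * ((∫⁻ τ in Set.Icc 0 t, ‖S (toComplex (F τ))‖ₑ *
        ‖S (toComplex (g τ))‖ₑ) + ∫⁻ τ in Set.Icc 0 t, ‖flux hψφ.cutoff a
        (fun j => fieldComp j (h τ)) (toComplex (g τ)) (toComplex (g τ))‖ₑ)) :=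
        mul_le_mul_right (h1.trans (add_le_add le_rfl hIle)) _
    _ = _ := by
        rw [mul_add, ← mul_assoc, ENNReal.inv_mul_cancel two_ne_zero ENNReal.ofNat_ne_top, one_mul,
          add_assoc]

/-- The flux at the frequency `Θ`, estimated by the quantities of the theorem. -/
theorem enorm_flux_le (hψφ : IsLittlewoodPaleyPair ψ φ) {Θ : ℝ} (hΘ : 0 < Θ) {h : L2 Plane}
    (hh : IsDivergenceFree h) (g : L2 ℝ) {q m : ℝ≥0∞} (hq : 2 ≤ q) (hm : 2 ≤ m) :
    ‖flux hψφ.cutoff (2 * Real.pi / Θ) (fun j => fieldComp j h) (toComplex g) (toComplex g)‖ₑ ≤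
      2 * cutoffConst hψφ.cutoff * ((∑ j, diffNorm (fieldComp j h) q) *
          eLpNorm (dyadicBlock φ Θ (-1) g) (exponentQ q) volume ^ 2) +
      2 * cutoffConst hψφ.cutoff * ((∑ j, diffNorm (fieldComp j h) q) *
          eLpNorm (dyadicBlock φ Θ 0 g) (exponentQ q) volume ^ 2) +
      80 * cutoffConst hψφ.cutoff ^ 3 *
        ((∑ j, diffNorm (mult (sharpSymbol (2 * Real.pi / Θ)) (fieldComp j h)) m) *
          eLpNorm g (exponentM m) volume * eLpNorm (sqrtHigh ψ Θ g) 2 volume) := by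
  set χ := hψφ.cutoff
  set a := 2 * Real.pi / Θ with ha_def
  have ha : 0 < a := by positivity
  set G := toComplex g
  have h1 := hψφ.isCutoff.enorm_flux_self_le_sharp ha
    (IsDivergenceFree.fourierDivFree hψφ.isCutoff hh) G (one_le_exponentM m)
    (one_le_two.trans hm) (exponentM_inv_add hm) (exponentQ_inv_add hq)
  have hblock : mult (dil (a / 2) χ) G - mult (dil (2 * a) χ) G =
      dyadicBlock φ Θ (-1) g + dyadicBlock φ Θ 0 g := by
    rw [hψφ.dyadicBlock_eq hΘ, hψφ.dyadicBlock_eq hΘ, neg_neg, zpow_one, neg_zero, zpow_zero,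
      one_mul, mul_div_cancel_left₀ _ (two_ne_zero' ℝ)]
    abel
  have h2 : eLpNorm (mult (dil (a / 2) χ) G - mult (dil (2 * a) χ) G : L2 ℂ) (exponentQ q) volume ^ 2 ≤
      2 * (eLpNorm (dyadicBlock φ Θ (-1) g) (exponentQ q) volume ^ 2 +
        eLpNorm (dyadicBlock φ Θ 0 g) (exponentQ q) volume ^ 2) := by
    rw [hblock, eLpNorm_congr_ae (Lp.coeFn_add _ _)]
    have h3 := eLpNorm_add_le (Lp.aestronglyMeasurable (dyadicBlock φ Θ (-1) g))
      (Lp.aestronglyMeasurable (dyadicBlock φ Θ 0 g)) (one_le_exponentQ q)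
    refine (pow_le_pow_left' h3 2).trans ?_
    have h4 := ENNReal.rpow_add_le_mul_rpow_add_rpow (p := 2)
      (eLpNorm (dyadicBlock φ Θ (-1) g) (exponentQ q) volume)
      (eLpNorm (dyadicBlock φ Θ 0 g) (exponentQ q) volume) one_le_two
    norm_num at h4
    exact h4
  have h3 : eLpNorm (G - mult (dil a χ) G : L2 ℂ) 2 volume ≤ eLpNorm (sqrtHigh ψ Θ g) 2 volume := by
    rw [hψφ.sqrtHigh_eq, eLpNorm_two_eq, eLpNorm_two_eq, ← ofReal_norm, ← ofReal_norm]
    exact ENNReal.ofReal_le_ofReal (hψφ.norm_sub_low_le ha G)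
  rw [eLpNorm_toComplex] at h1
  refine (h1.trans (add_le_add (mul_le_mul_right h2 _)
    (mul_le_mul_right (mul_le_mul_right h3 _) _))).trans_eq ?_
  ring

theorem sum_diffNorm_sharp_le {Θ : ℝ} (hΘ : 0 < Θ) (h : L2 Plane) {m : ℝ≥0∞} (hm : 1 ≤ m) :
    ∑ j, diffNorm (mult (sharpSymbol (2 * Real.pi / Θ)) (fieldComp j h)) m ≤
      2 * gradNorm (sharpHigh (Θ / 12) h) m := by
  simp only [← complexComp_sharpHigh hΘ]
  refine (Finset.sum_le_sum fun j _ => diffNorm_complexComp_le_gradNorm j _ hm).trans ?_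
  simp

theorem sum_diffNorm_le (h : L2 Plane) {q : ℝ≥0∞} (hq : 1 ≤ q) :
    ∑ j, diffNorm (fieldComp j h) q ≤ 2 * gradNorm h q := by
  refine (Finset.sum_le_sum fun j _ => diffNorm_fieldComp_le_gradNorm j h hq).trans ?_
  simp

/-- The flux at the frequency `Θ`, integrated in time. As `gradNorm` is not known to depend
measurably on the field, the integral is split while the field is still measured by `diffNorm`. -/
theorem lintegral_enorm_flux_le (hψφ : IsLittlewoodPaleyPair ψ φ) {Θ : ℝ} (hΘ : 0 < Θ)
    {μ : Measure ℝ} {h : ℝ → L2 Plane} {g : ℝ → L2 ℝ} (hh : AEStronglyMeasurable h μ)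
    (hdiv : ∀ᵐ τ ∂μ, IsDivergenceFree (h τ)) (hg : AEStronglyMeasurable g μ) {q m : ℝ≥0∞}
    (hq : 2 ≤ q) (hm : 2 ≤ m) :
    ∫⁻ τ, ‖flux hψφ.cutoff (2 * Real.pi / Θ) (fun j => fieldComp j (h τ)) (toComplex (g τ))
        (toComplex (g τ))‖ₑ ∂μ ≤
      160 * cutoffConst hψφ.cutoff ^ 3 * (∑ i ∈ Finset.Icc (-1 : ℤ) 0, ∫⁻ τ,
        gradNorm (h τ) q * eLpNorm (dyadicBlock φ Θ i (g τ)) (exponentQ q) volume ^ 2 ∂μ) +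
      160 * cutoffConst hψφ.cutoff ^ 3 * ∫⁻ τ, gradNorm (sharpHigh (Θ / 12) (h τ)) m *
        eLpNorm (g τ) (exponentM m) volume * eLpNorm (sqrtHigh ψ Θ (g τ)) 2 volume ∂μ := by
  set K := cutoffConst hψφ.cutoff with hK
  have hK1 : 1 ≤ K := one_le_cutoffConst _
  have hKtop : K ≠ ⊤ := cutoffConst_ne_top _
  have hGm : AEStronglyMeasurable (fun τ => toComplex (g τ)) μ :=
    toComplex.continuous.comp_aestronglyMeasurable hg
  have hAm : AEMeasurable (fun τ => ∑ j, diffNorm (fieldComp j (h τ)) q) μ :=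
    Finset.aemeasurable_fun_sum _ fun j _ =>
      AEMeasurable.of_lowerSemicontinuous (lowerSemicontinuous_diffNorm q)
        ((fieldComp j).continuous.comp_aestronglyMeasurable hh)
  have hXm : ∀ i : ℤ, AEMeasurable (fun τ => 2 * K * ((∑ j, diffNorm (fieldComp j (h τ)) q) *
      eLpNorm (dyadicBlock φ Θ i (g τ)) (exponentQ q) volume ^ 2)) μ := by
    intro i
    refine (hAm.mul (AEMeasurable.pow_const ?_ 2)).const_mul _
    refine AEMeasurable.of_lowerSemicontinuous (lowerSemicontinuous_eLpNorm (exponentQ q)) ?_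
    simp only [hψφ.dyadicBlock_eq hΘ]
    exact ((mult _).continuous.comp_aestronglyMeasurable hGm).sub
      ((mult _).continuous.comp_aestronglyMeasurable hGm)
  have hmono : ∀ i : ℤ, ∫⁻ τ, 2 * K * ((∑ j, diffNorm (fieldComp j (h τ)) q) *
      eLpNorm (dyadicBlock φ Θ i (g τ)) (exponentQ q) volume ^ 2) ∂μ ≤
      160 * K ^ 3 * ∫⁻ τ, gradNorm (h τ) q *
        eLpNorm (dyadicBlock φ Θ i (g τ)) (exponentQ q) volume ^ 2 ∂μ := by
    intro i
    rw [← lintegral_const_mul' _ _ (by finiteness)]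
    refine lintegral_mono fun τ => ?_
    have h1 : 2 * K * 2 ≤ 160 * K ^ 3 := by
      calc 2 * K * 2 = 4 * K ^ 1 := by ring
        _ ≤ 160 * K ^ 3 := mul_le_mul' (by norm_num) (pow_le_pow_right₀ hK1 (by norm_num))
    calc _ ≤ 2 * K * ((2 * gradNorm (h τ) q) *
          eLpNorm (dyadicBlock φ Θ i (g τ)) (exponentQ q) volume ^ 2) := by
          gcongr
          exact sum_diffNorm_le (h τ) (one_le_two.trans hq)
      _ = 2 * K * 2 * (gradNorm (h τ) q *
          eLpNorm (dyadicBlock φ Θ i (g τ)) (exponentQ q) volume ^ 2) := by ring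
      _ ≤ _ := mul_le_mul_left h1 _
  refine (lintegral_mono_ae (hdiv.mono fun τ hτ => hψφ.enorm_flux_le hΘ hτ (g τ) hq hm)).trans ?_
  rw [lintegral_add_left', lintegral_add_left']
  rotate_left
  · exact hXm (-1)
  · exact (hXm (-1)).add (hXm 0)
  have hsum : Finset.Icc (-1 : ℤ) 0 = {-1, 0} := rfl
  rw [hsum, Finset.sum_pair (by norm_num), mul_add]
  refine add_le_add (add_le_add (hmono _) (hmono _)) ?_
  rw [← lintegral_const_mul' _ _ (by finiteness)]
  refine lintegral_mono fun τ => ?_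
  calc _ ≤ 80 * K ^ 3 * ((2 * gradNorm (sharpHigh (Θ / 12) (h τ)) m) *
        eLpNorm (g τ) (exponentM m) volume * eLpNorm (sqrtHigh ψ Θ (g τ)) 2 volume) := by
        gcongr
        exact sum_diffNorm_sharp_le hΘ (h τ) (one_le_two.trans hm)
    _ = _ := by ring

end IsLittlewoodPaleyPair

end

theorem proposition3p5 (ψ φ : Plane → ℝ) (hψφ : IsLittlewoodPaleyPair ψ φ) :
    ∃ C : ℝ≥0, 0 < C ∧
      ∀ (Θ T : ℝ), 0 < Θ → 0 < T →
      ∀ (q m : ℝ≥0∞), 2 ≤ q → 2 ≤ m →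
      ∀ (h : ℝ → L2 Plane) (F g : ℝ → L2 ℝ)
        (g₀ : L2 ℝ),
        IntegrableOn h (Set.Icc 0 T) volume →
        (∀ᵐ τ ∂volume.restrict (Set.Icc 0 T), IsDivergenceFree (h τ)) →
        IntegrableOn F (Set.Icc 0 T) volume →
        AEStronglyMeasurable g (volume.restrict (Set.Icc 0 T)) →
        IsEssBoundedInLp T g 2 →
        IsEssBoundedInLp T g (exponentM m) →
        IsEssBoundedInLp T g (exponentQ q) →
        IsWeakTransportSolution T h F g g₀ →
        ∀ t ∈ Set.Icc 0 T,
          2⁻¹ * eLpNorm (sqrtHigh ψ Θ (g t)) 2 volume ^ 2 ≤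
            2⁻¹ * eLpNorm (sqrtHigh ψ Θ g₀) 2 volume ^ 2
            + (∫⁻ τ in Set.Icc 0 t,
                eLpNorm (sqrtHigh ψ Θ (F τ)) 2 volume * eLpNorm (sqrtHigh ψ Θ (g τ)) 2 volume)
            + C * (∑ i ∈ Finset.Icc (-1 : ℤ) 0, ∫⁻ τ in Set.Icc 0 t,
                gradNorm (h τ) q * eLpNorm (dyadicBlock φ Θ i (g τ)) (exponentQ q) volume ^ 2)
            + C * (∫⁻ τ in Set.Icc 0 t,
                gradNorm (sharpHigh (Θ / 12) (h τ)) m * eLpNorm (g τ) (exponentM m) volume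
                  * eLpNorm (dyadicBlock φ Θ 0 (g τ)) 2 volume)
            + C * (∫⁻ τ in Set.Icc 0 t,
                gradNorm (sharpHigh (Θ / 12) (h τ)) m * eLpNorm (g τ) (exponentM m) volume
                  * eLpNorm (sqrtHigh ψ Θ (g τ)) 2 volume) := by
  set K := cutoffConst hψφ.cutoff with hK
  have hK1 : 1 ≤ K := one_le_cutoffConst _
  have hKtop : K ≠ ⊤ := cutoffConst_ne_top _
  have hCtop : 160 * K ^ 3 ≠ ⊤ := by finiteness
  have hCne : 160 * K ^ 3 ≠ 0 :=
    mul_ne_zero (by norm_num) (pow_ne_zero 3 (zero_lt_one.trans_le hK1).ne')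
  refine ⟨(160 * K ^ 3).toNNReal, ENNReal.toNNReal_pos hCne hCtop, ?_⟩
  intro Θ T hΘ _ q m hq hm h F g g₀ hh hdiv hF hg hg2 _ _ hsol t ht
  rw [ENNReal.coe_toNNReal hCtop]
  have ha : 0 < 2 * Real.pi / Θ := by positivity
  have hsub : volume.restrict (Set.Icc 0 t) ≤ volume.restrict (Set.Icc 0 T) :=
    Measure.restrict_mono (Set.Icc_subset_Icc_right ht.2) le_rfl
  set W := ∫⁻ τ in Set.Icc 0 t, gradNorm (sharpHigh (Θ / 12) (h τ)) m *
    eLpNorm (g τ) (exponentM m) volume * eLpNorm (sqrtHigh ψ Θ (g τ)) 2 volume with hW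
  -- if the last integral is infinite there is nothing to prove
  rcases eq_or_ne W ⊤ with hWtop | hWtop
  · rw [hWtop, ENNReal.mul_top hCne, add_top]
    exact le_top
  have hfin : ∫⁻ τ in Set.Icc 0 t,
      (∑ j, diffNorm (mult (sharpSymbol (2 * Real.pi / Θ)) (fieldComp j (h τ))) m) *
        eLpNorm (toComplex (g τ)) (exponentM m) volume *
        ‖toComplex (g τ) - mult (dil (2 * Real.pi / Θ) hψφ.cutoff) (toComplex (g τ))‖ₑ ≠ ⊤ := by
    refine ne_top_of_le_ne_top (ENNReal.mul_ne_top ENNReal.ofNat_ne_top hWtop :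
      2 * W ≠ ⊤) ?_
    rw [hW, ← lintegral_const_mul' _ _ ENNReal.ofNat_ne_top]
    refine lintegral_mono fun τ => ?_
    beta_reduce
    rw [eLpNorm_toComplex, hψφ.sqrtHigh_eq, eLpNorm_two_eq, ← mul_assoc, ← mul_assoc]
    gcongr ?_ * _ * ?_
    · exact IsLittlewoodPaleyPair.sum_diffNorm_sharp_le hΘ (h τ) (one_le_two.trans hm)
    · rw [← ofReal_norm, ← ofReal_norm]
      exact ENNReal.ofReal_le_ofReal (hψφ.norm_sub_low_le ha _)
  have h1 := hψφ.energy_inequality ha hsol hh hdiv hF hg hg2 (one_le_exponentM m)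
    (exponentM_inv_add hm) ht hfin
  have h2 := hψφ.lintegral_enorm_flux_le hΘ (hh.1.mono_measure hsub) ((ae_mono hsub) hdiv)
    (hg.mono_measure hsub) hq hm
  simp only [← eLpNorm_two_eq, ← hψφ.sqrtHigh_eq] at h1
  refine h1.trans ((add_le_add le_rfl h2).trans ?_)
  rw [← add_assoc]
  exact add_le_add le_self_add le_rfl
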